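/- **Setting.** Let $\Sigma$ be a finite many-sorted first-order alphabet of predicate, function and constant symbols, containing $z:Nat$ and $s:Nat\to Nat$, together with a special $0$-ary predicate $Time$. A *configuration* is a finite multiset $\mathcal S=\{Time@t,F_1@t_1,\dots,F_n@t_n\}$ of ground facts with timestamps in $\mathbb N$ and exactly one $Time$ fact; $t$ is its global time. *Time constraints* have the form $T>T'\pm N$, $T=T'\pm N$ or $T\ge T'\pm N$ with $N\in\mathbb N$. The *tick rule* is $Time@T\to Time@(T+1)$. An *instantaneous rule* has the form $$Time@T,\mathcal W,F_1@T_1',\dots,F_n@T_n'\mid\mathcal C\;\to\;Time@T,\mathcal W,Q_1@(T+D_1),\dots,Q_{n'}@(T+D_{n'}),$$ where $\mathcal W$ is a finite multiset of timestamped facts, no fact of $\mathcal W$ and no $F_i$ or $Q_j$ is $Time$, $D_j\in\mathbb N$, and $\mathcal C$ is a finite set of time constraints on the time variables of the left-hand side. It applies to a configuration if, for some ground substitution, the instance of the left-hand side is contained (as a multiset) in the configuration and the instance of $\mathcal C$ holds; the instance of the left-hand side is then replaced by that of the right-hand side. A *timed MSR system* $\mathcal A$ consists of the tick rule and a finite set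 of instantaneous rules. It is a *progressive timed system* (PTS) if, in every instantaneous rule, $n=n'$, some $D_j\ge 1$, and $\mathcal C$ contains $T\ge T_i'$ for all $1\le i\le n$. A *critical configuration specification* $\mathcal{CS}$ is a finite set of pairs $\langle\{F_1@T_1,\dots,F_p@T_p\},\mathcal C\rangle$, with $\mathcal C$ a finite set of constraints on $T_1,\dots,T_p$ (here $Time$ is allowed among the $F_i$); a configuration is *critical* if, for one of the pairs and some substitution, it contains the instance of the multiset and the instance of $\mathcal C$ holds. A trace uses the *lazy time sampling* if the tick rule is used in it only at configurations to which no instantaneous rule of $\mathcal A$ applies. $\mathcal A$ is *realizable* (with respect to the lazy time sampling, $\mathcal{CS}$ and $\mathcal S_0$) if there is a trace from $\mathcal S_0$ that uses the lazy time sampling, contains no critical configuration, and in which the global time tends to infinity. The size of a fact is the number of alphabet symbols in it. **Theorem.** For every $\Sigma$ there is a polynomial $p$ such that for every PTS $\mathcal A$ and every critical configuration specification $\mathcal{CS}$ over $\Sigma$ there is a deterministic Turing machine which, given an initial configuration $\mathcal S_0$ (facts written as words over $\Sigma$, timestamps in binary), decides whether $\mathcal A$ is realizable with respect to the lazy time sampling,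 $\mathcal{CS}$ and $\mathcal S_0$, and uses space at most $p(m,k,\lfloor\log_2 D_{\max}\rfloor)$ (where $\log_2 0$ is read as $0$). This holds for all $\mathcal S_0,k,D_{\max}$ such that $k$ is an upper bound on the size of the facts other than $Time$ that occur in traces from $\mathcal S_0$ under the lazy time sampling and $D_{\max}$ is an upper bound on the natural numbers in $\mathcal S_0$ (timestamps), $\mathcal A$ (the $D_j$ and the $N$ in constraints) and $\mathcal{CS}$ (the $N$ in constraints); $m$ is the number of facts of $\mathcal S_0$. -/

import Mathlib

namespace TimedMSR

/-- A finite first-order many-sorted alphabet: sorts, function symbols (constants are the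
function symbols of arity zero) and predicate symbols, with a sort of natural numbers that has a
constant zero and a successor function. The special predicate `Time` of arity zero is not listed
among the predicate symbols; it is built into configurations, rules and patterns. -/
structure Alphabet where
  Srt : Type
  Fn : Type
  Pr : Type
  finite_srt : Finite Srt
  finite_fn : Finite Fn
  finite_pr : Finite Pr
  fnArity : Fn → ℕ
  fnArg : (f : Fn) → Fin (fnArity f) → Srt
  fnRes : Fn → Srt
  prArity : Pr → ℕ
  prArg : (P : Pr) → Fin (prArity P) → Srt
  nat : Srt
  zero : Fn
  zero_arity : fnArity zero = 0
  zero_res : fnRes zero = nat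
  succ : Fn
  succ_arity : fnArity succ = 1
  succ_arg : ∀ i, fnArg succ i = nat
  succ_res : fnRes succ = nat

variable {Sg : Alphabet}

/-- Well-sorted terms. There are countably many variables of each sort. -/
inductive Term (Sg : Alphabet) : Sg.Srt → Type
  | var (s : Sg.Srt) (x : ℕ) : Term Sg s
  | app (f : Sg.Fn) (args : (i : Fin (Sg.fnArity f)) → Term Sg (Sg.fnArg f i)) :
      Term Sg (Sg.fnRes f)

/-- A sort-preserving substitution of terms for variables. -/
abbrev Subst (Sg : Alphabet) : Type := (s : Sg.Srt) → ℕ → Term Sg s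

/-- The symbols in which an initial configuration is written for a machine. -/
inductive Sym (Sg : Alphabet) : Type
  | fn (f : Sg.Fn) : Sym Sg
  | pr (P : Sg.Pr) : Sym Sg
  | bit (b : Bool) : Sym Sg

namespace Term

/-- The number of symbols of a term. -/
def size : {s : Sg.Srt} → Term Sg s → ℕ
  | _, var _ _ => 1
  | _, app _ args => 1 + ∑ i, (args i).size

def IsGround : {s : Sg.Srt} → Term Sg s → Prop
  | _, var _ _ => False
  | _, app _ args => ∀ i, (args i).IsGround

def subst (θ : Subst Sg) : {s : Sg.Srt} → Term Sg s → Term Sg s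
  | _, var s x => θ s x
  | _, app f args => app f (fun i => (args i).subst θ)

/-- Prefix notation. It is used for ground terms only, so the clause for variables is
irrelevant. -/
def encode : {s : Sg.Srt} → Term Sg s → List (Sym Sg)
  | _, var _ _ => []
  | _, app f args => Sym.fn f :: (List.ofFn fun i => (args i).encode).flatten

end Term

/-- Facts other than `Time`, possibly with variables. -/
structure Fact (Sg : Alphabet) where
  pred : Sg.Pr
  args : (i : Fin (Sg.prArity pred)) → Term Sg (Sg.prArg pred i)

namespace Fact

/-- The total number of alphabet symbols of a fact. -/
def size (F : Fact Sg) : ℕ := 1 + ∑ i, (F.args i).size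

def IsGround (F : Fact Sg) : Prop := ∀ i, (F.args i).IsGround

def subst (θ : Subst Sg) (F : Fact Sg) : Fact Sg := ⟨F.pred, fun i => (F.args i).subst θ⟩

def encode (F : Fact Sg) : List (Sym Sg) :=
  Sym.pr F.pred :: (List.ofFn fun i => (F.args i).encode).flatten

end Fact

/-- A configuration `{Time@t, F₁@t₁, …, Fₙ@tₙ}`: a multiset of ground timestamped facts with a
single occurrence of `Time`. `time` is the global time `t` and `facts` are the other facts. -/
structure Config (Sg : Alphabet) where
  time : ℕ
  facts : Multiset (Fact Sg × ℕ)
  ground : ∀ F ∈ facts, F.1.IsGround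

/-- The number of facts of a configuration, `Time` included. -/
def Config.numFacts (S : Config Sg) : ℕ := S.facts.card + 1

/-- The whole multiset of timestamped facts of a configuration; `none` stands for `Time`. -/
def Config.all (S : Config Sg) : Multiset (Option (Fact Sg) × ℕ) :=
  (none, S.time) ::ₘ S.facts.map (fun F => (some F.1, F.2))

/-- The comparisons of time constraints. -/
inductive Cmp
  | gt
  | eq
  | ge

/-- A time constraint `T > T' + N`, `T = T' + N` or `T ≥ T' + N` with an integer offset `N`, where
`T` and `T'` are time variables (time variables are indexed by natural numbers). -/
structure TimeConstraint where
  cmp : Cmp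
  lhs : ℕ
  rhs : ℕ
  offset : ℤ

/-- Validity of a time constraint under an assignment `τ` of natural numbers to time variables. -/
def TimeConstraint.Holds (c : TimeConstraint) (τ : ℕ → ℕ) : Prop :=
  match c.cmp with
  | Cmp.gt => (τ c.lhs : ℤ) > (τ c.rhs : ℤ) + c.offset
  | Cmp.eq => (τ c.lhs : ℤ) = (τ c.rhs : ℤ) + c.offset
  | Cmp.ge => (τ c.lhs : ℤ) ≥ (τ c.rhs : ℤ) + c.offset

/-- An instantaneous rule
`Time@T, W₁@T₁, …, Wₚ@Tₚ, F₁@T₁', …, Fₙ@Tₙ' | C ⟶ Time@T, W₁@T₁, …, Wₚ@Tₚ, Q₁@(T+D₁), …, Qₘ@(T+Dₘ)`.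
`context` holds the pairs `(Wᵢ, Tᵢ)`, `consumed` the pairs `(Fᵢ, Tᵢ')` (the second components are
time variables) and `created` the pairs `(Qᵢ, Dᵢ)`. -/
structure Rule (Sg : Alphabet) where
  time : ℕ
  context : Multiset (Fact Sg × ℕ)
  consumed : Multiset (Fact Sg × ℕ)
  created : Multiset (Fact Sg × ℕ)
  guard : Finset TimeConstraint
  guard_vars : ∀ c ∈ guard, ∀ v, v = c.lhs ∨ v = c.rhs →
    v = time ∨ v ∈ (context + consumed).map Prod.snd

/-- Instance of a multiset of facts `F@T` with time variables `T`. -/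
def inst (θ : Subst Sg) (τ : ℕ → ℕ) (W : Multiset (Fact Sg × ℕ)) : Multiset (Fact Sg × ℕ) :=
  W.map fun F => (F.1.subst θ, τ F.2)

/-- One application of an instantaneous rule. Since configurations are ground, `θ` is ground on
all variables of the rule. -/
def Rule.Rewrites (r : Rule Sg) (S S' : Config Sg) : Prop :=
  ∃ (θ : Subst Sg) (τ : ℕ → ℕ) (rest : Multiset (Fact Sg × ℕ)),
    τ r.time = S.time ∧ (∀ c ∈ r.guard, c.Holds τ) ∧
    S.facts = inst θ τ r.context + inst θ τ r.consumed + rest ∧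
    S'.time = S.time ∧
    S'.facts = inst θ τ r.context + r.created.map (fun Q => (Q.1.subst θ, S.time + Q.2)) + rest

def Rule.Applicable (r : Rule Sg) (S : Config Sg) : Prop := ∃ S', r.Rewrites S S'

/-- The rule `Time@T ⟶ Time@(T+1)`. -/
def Tick (S S' : Config Sg) : Prop := S'.time = S.time + 1 ∧ S'.facts = S.facts

/- A timed MSR system is given by the set `A` of its instantaneous rules; the tick rule is always
present. -/

/-- As many facts are created as are consumed. -/
def IsBalanced (A : Set (Rule Sg)) : Prop := ∀ r ∈ A, r.created.card = r.consumed.card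

/-- Progressive timed MSR systems (PTS). -/
def IsProgressive (A : Set (Rule Sg)) : Prop :=
  IsBalanced A ∧ ∀ r ∈ A, (∃ Q ∈ r.created, 1 ≤ Q.2) ∧
    ∀ F ∈ r.consumed, (⟨Cmp.ge, r.time, F.2, 0⟩ : TimeConstraint) ∈ r.guard

/-- Infinite traces. -/
def IsTrace (A : Set (Rule Sg)) (P : ℕ → Config Sg) : Prop :=
  ∀ i, Tick (P i) (P (i + 1)) ∨ ∃ r ∈ A, r.Rewrites (P i) (P (i + 1))

/-- Lazy time sampling: the tick rule is used only when no instantaneous rule is applicable. -/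
def UsesLazySampling (A : Set (Rule Sg)) (P : ℕ → Config Sg) : Prop :=
  ∀ i, Tick (P i) (P (i + 1)) → ∀ r ∈ A, ¬ r.Applicable (P i)

/-- A pair `⟨{F₁@T₁, …, Fₚ@Tₚ}, C⟩` of a critical configuration specification. The second
components in `facts` are time variables, and `none` stands for `Time`. -/
structure CriticalPair (Sg : Alphabet) where
  facts : Multiset (Option (Fact Sg) × ℕ)
  guard : Finset TimeConstraint
  guard_vars : ∀ c ∈ guard, ∀ v, v = c.lhs ∨ v = c.rhs → v ∈ facts.map Prod.snd

def IsCritical (CS : Set (CriticalPair Sg)) (S : Config Sg) : Prop :=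
  ∃ p ∈ CS, ∃ (θ : Subst Sg) (τ : ℕ → ℕ),
    p.facts.map (fun F => (F.1.map (Fact.subst θ), τ F.2)) ≤ S.all ∧ ∀ c ∈ p.guard, c.Holds τ

def IsCompliant (CS : Set (CriticalPair Sg)) (P : ℕ → Config Sg) : Prop :=
  ∀ i, ¬ IsCritical CS (P i)

/-- Realizability with respect to the lazy time sampling. A trace in which the global time tends to
infinity is necessarily infinite. -/
def Realizable (A : Set (Rule Sg)) (CS : Set (CriticalPair Sg)) (S₀ : Config Sg) : Prop :=
  ∃ P : ℕ → Config Sg, IsTrace A P ∧ P 0 = S₀ ∧ UsesLazySampling A P ∧ IsCompliant CS P ∧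
    Filter.Tendsto (fun i => (P i).time) Filter.atTop Filter.atTop

/-- `k` bounds the size of the facts that occur in the traces from `S₀` under the lazy time
sampling. -/
def IsFactSizeBound (A : Set (Rule Sg)) (S₀ : Config Sg) (k : ℕ) : Prop :=
  ∀ P : ℕ → Config Sg, IsTrace A P → P 0 = S₀ → UsesLazySampling A P →
    ∀ i, ∀ F ∈ (P i).facts, F.1.size ≤ k

/-- `D` bounds the natural numbers that appear in `S₀`, `A` and `CS`: the timestamps of `S₀`, the
numbers `Dᵢ` of rules, and the numbers in the time constraints of `A` and of `CS`. -/
def IsNumericBound (A : Set (Rule Sg)) (CS : Set (CriticalPair Sg)) (S₀ : Config Sg) (D : ℕ) :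
    Prop :=
  S₀.time ≤ D ∧ (∀ F ∈ S₀.facts, F.2 ≤ D) ∧
  (∀ r ∈ A, (∀ Q ∈ r.created, Q.2 ≤ D) ∧ ∀ c ∈ r.guard, c.offset.natAbs ≤ D) ∧
  ∀ p ∈ CS, ∀ c ∈ p.guard, c.offset.natAbs ≤ D

/-- The input word for the configuration `{Time@t} ∪ l`, for an enumeration `l` of the facts other
than `Time`: the global time, followed by the facts, each followed by its timestamp. Numbers are in
binary. -/
def encodeConfig (t : ℕ) (l : List (Fact Sg × ℕ)) : List (Sym Sg) :=
  (Nat.bits t).map Sym.bit ++ l.flatMap fun F => F.1.encode ++ (Nat.bits F.2).map Sym.bit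

/-- The deterministic Turing machine `M`, started on the input word `w`, halts with the answer
whether `Q` holds, and in the whole computation its tapes (stacks), the input included, never hold
more than `s` symbols altogether. -/
def DecidesInSpace {Γ : Type} (M : Turing.TM2ComputableAux Γ Bool) (w : List Γ) (Q : Prop)
    (s : ℕ) : Prop :=
  (∃ b : Bool, (b = true ↔ Q) ∧
    Nonempty (Turing.TM2Outputs M.tm (w.map M.inputAlphabet.symm)
      (some [M.outputAlphabet.symm b]))) ∧
  ∀ c : M.tm.Cfg,
    StateTransition.Reaches M.tm.step (Turing.initList M.tm (w.map M.inputAlphabet.symm)) c →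
      ∑ j ∈ @Finset.univ M.tm.K M.tm.kFin, (Turing.TM2.Cfg.stk c j).length ≤ s

end TimedMSR

set_option linter.unusedSectionVars false

/-! Realizability is reduced to the existence of a reachable cycle in a finite graph of words, and
such a cycle is found by Savitch's algorithm.

In a PTS a rule consumes only facts that are not in the future, creates equally many, and places at
least one of them in the future. So the number of rule applications between two ticks is bounded by
the number of facts, and time diverges along every infinite lazy trace (`tendsto_time`).
Realizability therefore asks only for an infinite lazy trace without critical configurations.

Times are unbounded, but constraints compare them with offsets below a constant `G` of the system.
Two time differences that are both at least `G` cannot be distinguished, and configurations that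
agree up to such gaps (`Sim`) have matching steps, the same applicable rules and the same critical
status. The abstract system `Edge` adds to the lazy steps the shortening of a large gap by one, and
allows a tick only if no gap can be shortened. By the pigeonhole principle the times of reachable
configurations are then bounded (`time_lt_of_not_shift`, `bounds_of_reachable`). Each shortening
lowers the global time, so infinite abstract paths still contain infinitely many genuine steps
(`realizable_iff`). Reachable configurations become words of polynomial length, and there is an
infinite path iff a cycle is reachable (`cycleF_iff`).

The machine is obtained from a calculus of definable relations. `Def` says that a relation between
words of length at most `N` is decided by a stack program in space `O(N²)`. It is closed under
Boolean operations, bounded quantifiers (`Def.ex`) and, by Savitch's recursion, reflexive transitive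
closure (`Def.tc`). Binary arithmetic, recognition of terms, matching, rule application and the
shortening of gaps are all expressed in it (`def_edgeF`). `Prog.code_correct` compiles the programs
to machines and keeps track of space at every step.

Two difficulties remain. First, the machine knows neither `k` nor `Dmax`, hence no sufficient `N`.
It tries all `N` in turn and stops when every word `x` that is reachable within `N` satisfies `c *
x.length + c ≤ N`, a definable condition (`adequateF`). Successors are only linearly longer than
their predecessors, so then none of them is lost. The critical point is a variable that occurs only
in created facts: either its sort has only terms of bounded size, or it could take values that
contradict the bound `k` (`Rule.Rewrites.recLen_le`). Second, the polynomial must not depend on the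
system, whereas the constants of the program do. Short inputs are answered from a table in the
finite control, and for the remaining ones the constant is smaller than the input length and costs
one more factor (`exists_machine`, `space_bound`). -/

namespace StackProg

/-! ### Structured stack programs and their compilation to machines -/

open Function Turing

/-- The finite control of a stack program. -/
structure Ctl (G : Type) where
  flag : Bool
  mode : Fin 3
  reg : Option G
  reg' : Option G

instance Ctl.finite {G : Type} [Finite G] : Finite (Ctl G) :=
  Finite.of_injective (fun v : Ctl G => (v.flag, v.mode, v.reg, v.reg')) (by
    rintro ⟨_, _, _, _⟩ ⟨_, _, _, _⟩ h
    simpa using h)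

/-- The initial control state. -/
def Ctl.init (G : Type) : Ctl G := ⟨false, 0, none, none⟩

/-- Structured programs over stacks indexed by the natural numbers. -/
inductive Prog (G : Type) : Type
  | push (k : ℕ) (f : Ctl G → G)
  | pop (k : ℕ) (f : Ctl G → Option G → Ctl G)
  | load (f : Ctl G → Ctl G)
  | seq (p q : Prog G)
  | ite (b : Ctl G → Bool) (p q : Prog G)
  | while (b : Ctl G → Bool) (p : Prog G)

/-- The contents of all stacks. -/
abbrev Stacks (G : Type) : Type := ℕ → List G

variable {G : Type}

/-- Big-step semantics, where stack `k` never grows beyond `s k` symbols. -/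
inductive Exec (s : ℕ → ℕ) : Prog G → Ctl G → Stacks G → Ctl G → Stacks G → Prop
  | push {k f v S} : (S k).length < s k → Exec s (.push k f) v S v (update S k (f v :: S k))
  | pop {k f v S} : Exec s (.pop k f) v S (f v (S k).head?) (update S k (S k).tail)
  | load {f v S} : Exec s (.load f) v S (f v) S
  | seq {p q v S v₁ S₁ v₂ S₂} : Exec s p v S v₁ S₁ → Exec s q v₁ S₁ v₂ S₂ →
      Exec s (.seq p q) v S v₂ S₂
  | ite {b p q v S v₁ S₁} : Exec s (bif b v then p else q) v S v₁ S₁ →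
      Exec s (.ite b p q) v S v₁ S₁
  | while_false {b p v S} : b v = false → Exec s (.while b p) v S v S
  | while_true {b p v S v₁ S₁ v₂ S₂} : b v = true → Exec s p v S v₁ S₁ →
      Exec s (.while b p) v₁ S₁ v₂ S₂ → Exec s (.while b p) v S v₂ S₂

/-- A bound for the indices of the stacks that a program uses. -/
def Prog.width : Prog G → ℕ
  | .push k _ => k + 1
  | .pop k _ => k + 1
  | .load _ => 0
  | .seq p q => max p.width q.width
  | .ite _ p q => max p.width q.width
  | .while _ p => p.width

/-- The labels of the machine code of a program. -/
def Prog.Lab : Prog G → Type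
  | .push _ _ => Unit
  | .pop _ _ => Unit
  | .load _ => Unit
  | .seq p q => p.Lab ⊕ q.Lab
  | .ite _ p q => Unit ⊕ (p.Lab ⊕ q.Lab)
  | .while _ p => Unit ⊕ p.Lab

def Prog.entry : (p : Prog G) → p.Lab
  | .push _ _ => ()
  | .pop _ _ => ()
  | .load _ => ()
  | .seq p _ => Sum.inl p.entry
  | .ite _ _ _ => Sum.inl ()
  | .while _ _ => Sum.inl ()

theorem Prog.finite_lab : (p : Prog G) → Finite p.Lab
  | .push _ _ => inferInstanceAs (Finite Unit)
  | .pop _ _ => inferInstanceAs (Finite Unit)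
  | .load _ => inferInstanceAs (Finite Unit)
  | .seq p q =>
    have := p.finite_lab
    have := q.finite_lab
    inferInstanceAs (Finite (p.Lab ⊕ q.Lab))
  | .ite _ p q =>
    have := p.finite_lab
    have := q.finite_lab
    inferInstanceAs (Finite (Unit ⊕ (p.Lab ⊕ q.Lab)))
  | .while _ p =>
    have := p.finite_lab
    inferInstanceAs (Finite (Unit ⊕ p.Lab))

/-- The stack alphabets of a machine with `M` work stacks, an input stack over `I` and an output
stack over `Bool`. -/
abbrev StkAlph (G I : Type) (M : ℕ) : Fin M ⊕ Bool → Type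
  | .inl _ => G
  | .inr false => I
  | .inr true => Bool

/-- The stacks of the machine. -/
def mkStk {I : Type} (M : ℕ) (S : Stacks G) (w : List I) (o : List Bool) :
    (k : Fin M ⊕ Bool) → List (StkAlph G I M k)
  | .inl i => S i
  | .inr false => w
  | .inr true => o

section
variable {I : Type} {M : ℕ}

theorem mkStk_update_work (S : Stacks G) (w : List I) (o : List Bool) {k : ℕ} (h : k < M)
    (x : List G) :
    update (mkStk M S w o) (.inl ⟨k, h⟩) x = mkStk M (update S k x) w o := by
  funext j
  rcases j with j | j
  · by_cases hj : j = ⟨k, h⟩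
    · subst hj; simp [mkStk]
    · have : (j : ℕ) ≠ k := fun h' => hj (Fin.ext h')
      simp [mkStk, update_of_ne, hj, this]
  · cases j <;> simp [mkStk]

theorem mkStk_update_input (S : Stacks G) (w w' : List I) (o : List Bool) :
    update (mkStk M S w o) (.inr false) w' = mkStk M S w' o := by
  funext j
  rcases j with j | j
  · simp [mkStk]
  · cases j <;> simp [mkStk]

theorem mkStk_update_output (S : Stacks G) (w : List I) (o o' : List Bool) :
    update (mkStk M S w o) (.inr true) o' = mkStk M S w o' := by
  funext j
  rcases j with j | j
  · simp [mkStk]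
  · cases j <;> simp [mkStk]

/-- The machine code of a program. -/
def Prog.code {Λ : Type} : (p : Prog G) → (p.Lab → Λ) → Λ → p.Lab →
    TM2.Stmt (StkAlph G I M) Λ (Ctl G)
  | .push k f, _, exit => fun _ =>
      -- An index outside the available stacks does not arise for programs of width at most `M`; the
      -- plain jump only makes the definition total.
      if h : k < M then .push (.inl ⟨k, h⟩) f (.goto fun _ => exit) else .goto fun _ => exit
  | .pop k f, _, exit => fun _ =>
      if h : k < M then .pop (.inl ⟨k, h⟩) f (.goto fun _ => exit) else .goto fun _ => exit
  | .load f, _, exit => fun _ => .load f (.goto fun _ => exit)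
  | .seq p q, emb, exit => fun l => match l with
      | .inl l => p.code (emb ∘ Sum.inl) (emb (.inr q.entry)) l
      | .inr l => q.code (emb ∘ Sum.inr) exit l
  | .ite b p q, emb, exit => fun l => match l with
      | .inl _ => .branch b (.goto fun _ => emb (.inr (.inl p.entry)))
          (.goto fun _ => emb (.inr (.inr q.entry)))
      | .inr (.inl l) => p.code (emb ∘ Sum.inr ∘ Sum.inl) exit l
      | .inr (.inr l) => q.code (emb ∘ Sum.inr ∘ Sum.inr) exit l
  | .while b p, emb, exit => fun l => match l with
      | .inl _ => .branch b (.goto fun _ => emb (.inr p.entry)) (.goto fun _ => exit)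
      | .inr l => p.code (emb ∘ Sum.inr) (emb (.inl ())) l

/-- One step of a machine from a configuration with the property `Good`. -/
def GoodStep {C : Type} (step : C → Option C) (Good : C → Prop) (a b : C) : Prop :=
  step a = some b ∧ Good a

/-- Induction on the execution. The labels of a subprogram enter through `emb`, and its exit is the
entry of whatever follows (the loop head, for the body of a loop), so that the runs glue together.
Carrying `Good` along every single step extends the space bound to all intermediate configurations.
-/
theorem Prog.code_correct {Λ : Type} (m : Λ → TM2.Stmt (StkAlph G I M) Λ (Ctl G))
    {s : ℕ → ℕ} {w : List I} {o : List Bool}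
    (Good : TM2.Cfg (StkAlph G I M) Λ (Ctl G) → Prop)
    (hGood : ∀ l v S, (∀ k, (S k).length ≤ s k) → Good ⟨some l, v, mkStk M S w o⟩)
    {p : Prog G} {v S v' S'} (h : Exec s p v S v' S') :
    ∀ (emb : p.Lab → Λ) (exit : Λ), p.width ≤ M → (∀ l, m (emb l) = p.code emb exit l) →
      (∀ k, (S k).length ≤ s k) →
      (∀ k, (S' k).length ≤ s k) ∧
      Relation.ReflTransGen (GoodStep (TM2.step m) Good)
        ⟨some (emb p.entry), v, mkStk M S w o⟩ ⟨some exit, v', mkStk M S' w o⟩ := by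
  induction h with
  | @push k f v S hk =>
    intro emb exit hw hm hS
    have hkM : k < M := hw
    refine ⟨fun j => ?_, .single ⟨?_, hGood _ _ _ hS⟩⟩
    · by_cases hj : j = k
      · subst hj; simpa using hk
      · simpa [update_of_ne hj] using hS j
    · simp only [TM2.step, hm, Prog.code, dif_pos hkM, TM2.stepAux]
      rw [mkStk_update_work]; rfl
  | @pop k f v S =>
    intro emb exit hw hm hS
    have hkM : k < M := hw
    refine ⟨fun j => ?_, .single ⟨?_, hGood _ _ _ hS⟩⟩
    · by_cases hj : j = k
      · subst hj
        simpa using (hS j).trans' (Nat.sub_le _ _)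
      · simpa [update_of_ne hj] using hS j
    · simp only [TM2.step, hm, Prog.code, dif_pos hkM, TM2.stepAux]
      rw [mkStk_update_work]; rfl
  | load =>
    intro emb exit hw hm hS
    refine ⟨hS, .single ⟨?_, hGood _ _ _ hS⟩⟩
    simp only [TM2.step, hm, Prog.code, TM2.stepAux]
  | @seq p q v S v₁ S₁ v₂ S₂ h₁ h₂ ih₁ ih₂ =>
    intro emb exit hw hm hS
    have hw' : max p.width q.width ≤ M := hw
    obtain ⟨hS₁, r₁⟩ := ih₁ (emb ∘ Sum.inl) (emb (.inr q.entry)) ((le_max_left _ _).trans hw')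
      (fun l => hm (.inl l)) hS
    obtain ⟨hS₂, r₂⟩ := ih₂ (emb ∘ Sum.inr) exit ((le_max_right _ _).trans hw')
      (fun l => hm (.inr l)) hS₁
    exact ⟨hS₂, r₁.trans r₂⟩
  | @ite b p q v S v₁ S₁ h ih =>
    intro emb exit hw hm hS
    have hw' : max p.width q.width ≤ M := hw
    cases hb : b v with
    | true =>
      rw [hb] at ih
      obtain ⟨hS₁, r₁⟩ := ih (emb ∘ Sum.inr ∘ Sum.inl) exit ((le_max_left _ _).trans hw')
        (fun l => hm (.inr (.inl l))) hS
      refine ⟨hS₁, .head ⟨?_, hGood _ _ _ hS⟩ r₁⟩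
      have := hm (.inl ())
      simp only [Prog.entry, TM2.step, this, Prog.code, TM2.stepAux, hb]
      rfl
    | false =>
      rw [hb] at ih
      obtain ⟨hS₁, r₁⟩ := ih (emb ∘ Sum.inr ∘ Sum.inr) exit ((le_max_right _ _).trans hw')
        (fun l => hm (.inr (.inr l))) hS
      refine ⟨hS₁, .head ⟨?_, hGood _ _ _ hS⟩ r₁⟩
      have := hm (.inl ())
      simp only [Prog.entry, TM2.step, this, Prog.code, TM2.stepAux, hb]
      rfl
  | @while_false b p v S hb =>
    intro emb exit hw hm hS
    refine ⟨hS, .single ⟨?_, hGood _ _ _ hS⟩⟩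
    have := hm (.inl ())
    simp only [Prog.entry, TM2.step, this, Prog.code, TM2.stepAux, hb]
    rfl
  | @while_true b p v S v₁ S₁ v₂ S₂ hb h₁ h₂ ih₁ ih₂ =>
    intro emb exit hw hm hS
    obtain ⟨hS₁, r₁⟩ := ih₁ (emb ∘ Sum.inr) (emb (.inl ())) hw (fun l => hm (.inr l)) hS
    obtain ⟨hS₂, r₂⟩ := ih₂ emb exit hw hm hS₁
    refine ⟨hS₂, .head ⟨?_, hGood _ _ _ hS⟩ (r₁.trans r₂)⟩
    have := hm (.inl ())
    simp only [Prog.entry, TM2.step, this, Prog.code, TM2.stepAux, hb]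
    rfl

end

/-- The machine that copies its input, reversed and translated by `e`, to work stack `0`, runs `p`,
and outputs the flag. -/
noncomputable def machine {I : Type} [Finite G] [Inhabited G] [Fintype I] (e : I → G) (p : Prog G) : FinTM2 where
  K := Fin (p.width + 1) ⊕ Bool
  k₀ := .inr false
  k₁ := .inr true
  Γ := StkAlph G I (p.width + 1)
  Λ := Bool ⊕ p.Lab
  main := .inl false
  ΛFin := @Fintype.ofFinite _ (@Finite.instSum _ _ _ p.finite_lab)
  σ := Ctl G
  initialState := .init G
  σFin := .ofFinite _
  Γk₀Fin := inferInstanceAs (Fintype I)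
  m := fun l => match l with
    | .inl false => .pop (.inr false) (fun v o => { v with reg := o.map e })
        (.branch (fun v => v.reg.isSome)
          (.push (.inl ⟨0, Nat.succ_pos _⟩) (fun v => v.reg.getD default)
            (.goto fun _ => .inl false))
          (.goto fun _ => .inr p.entry))
    -- `haltList` demands the initial control state, hence the reset before halting.
    | .inl true => .push (.inr true) (fun v => v.flag) (.load (fun _ => .init G) .halt)
    | .inr l => p.code Sum.inr (.inl true) l

theorem exists_evalsTo {C : Type} {step : C → Option C} {Good : C → Prop} {a b : C}
    (h : Relation.ReflTransGen (GoodStep step Good) a b) :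
    Nonempty (StateTransition.EvalsTo step a (some b)) := by
  induction h using Relation.ReflTransGen.head_induction_on with
  | refl => exact ⟨.refl _ _⟩
  | head h _ ih =>
    obtain ⟨e⟩ := ih
    exact ⟨⟨e.steps + 1, by
      rw [Function.iterate_succ_apply]
      have := e.evals_in_steps
      rw [← h.1] at this
      exact this⟩⟩

/-- Steps are deterministic, so whatever is reachable from `a` lies on the one run that ends in the
halting configuration `b`. -/
theorem good_of_reaches {C : Type} {step : C → Option C} {Good : C → Prop} {a b c : C}
    (h : Relation.ReflTransGen (GoodStep step Good) a b) (hb : step b = none) (hG : Good b)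
    (hc : StateTransition.Reaches step a c) : Good c := by
  induction h using Relation.ReflTransGen.head_induction_on with
  | refl =>
    rcases hc.cases_head with rfl | ⟨d, hd, _⟩
    · exact hG
    · simp [hb] at hd
  | head h _ ih =>
    rcases hc.cases_head with rfl | ⟨d, hd, hdc⟩
    · exact h.2
    · rw [h.1] at hd
      cases hd
      exact ih hdc

theorem sum_length_mkStk {I : Type} (M : ℕ) (S : Stacks G) (w : List I) (o : List Bool) :
    ∑ j, (mkStk M S w o j).length = ∑ i ∈ Finset.range M, (S i).length + (w.length + o.length) := by
  rw [Fintype.sum_sum_type, Finset.sum_range]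
  simp only [mkStk, Fintype.univ_bool, Finset.mem_singleton, Bool.true_eq_false, not_false_eq_true,
    Finset.sum_insert, Finset.sum_singleton]
  omega

section
variable {I : Type} [Finite G] [Inhabited G] [Fintype I] (e : I → G) (p : Prog G)

/-- While the input is copied, the input stack and work stack `0` together hold exactly the input.
Afterwards the bounds `s` of the execution take over. The summand `1` pays for the output symbol. -/
theorem machine_spec {s : ℕ → ℕ} {w : List I} {v' : Ctl G} {B : ℕ}
    (h : Exec s p (.init G) (fun k => if k = 0 then (w.map e).reverse else []) v' fun _ => [])
    (hs : w.length ≤ s 0) (hB : ∑ k ∈ Finset.range (p.width + 1), s k + 1 ≤ B) :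
    Nonempty (TM2Outputs (machine e p) w (some [v'.flag])) ∧
    ∀ c, StateTransition.Reaches (machine e p).step (initList (machine e p) w) c →
      ∑ j ∈ @Finset.univ (machine e p).K (machine e p).kFin, (TM2.Cfg.stk c j).length ≤ B := by
  set M := p.width + 1 with hM
  let m : Bool ⊕ p.Lab → TM2.Stmt (StkAlph G I M) (Bool ⊕ p.Lab) (Ctl G) := (machine e p).m
  let Good : TM2.Cfg (StkAlph G I M) (Bool ⊕ p.Lab) (Ctl G) → Prop :=
    fun c => ∑ j, (c.stk j).length ≤ B
  have hinit : initList (machine e p) w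
      = (⟨some (.inl false), .init G, mkStk M (fun _ => []) w []⟩ :
        TM2.Cfg (StkAlph G I M) (Bool ⊕ p.Lab) (Ctl G)) := by
    unfold initList
    congr 1
    funext k
    rcases k with k | k
    · rfl
    · cases k <;> rfl
  have hhalt : ∀ b : Bool, haltList (machine e p) [b]
      = (⟨none, .init G, mkStk M (fun _ => []) [] [b]⟩ :
        TM2.Cfg (StkAlph G I M) (Bool ⊕ p.Lab) (Ctl G)) := by
    intro b
    unfold haltList
    congr 1
    funext k
    rcases k with k | k
    · rfl
    · cases k <;> rfl
  have hgood : ∀ (l : Option (Bool ⊕ p.Lab)) (v : Ctl G) (u w' : List I),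
      u.length + w'.length = w.length →
      Good ⟨l, v, mkStk M (fun k => if k = 0 then (u.map e).reverse else []) w' []⟩ := by
    intro l v u w' hl
    simp only [Good]
    rw [sum_length_mkStk, Finset.sum_eq_single_of_mem 0 (by simp [hM])]
    · simp at hl ⊢
      have := Finset.single_le_sum (f := s) (fun _ _ => Nat.zero_le _)
        (show 0 ∈ Finset.range M by simp [hM])
      omega
    · intro b _ hb; simp [hb]
  have hpop : ∀ (v : Ctl G) (S : Stacks G) (a : I) (w' : List I),
      TM2.step m ⟨some (.inl false), v, mkStk M S (a :: w') []⟩ = some ⟨some (.inl false),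
        { v with reg := some (e a) }, mkStk M (update S 0 (e a :: S 0)) w' []⟩ := by
    intro v S a w'
    rw [← mkStk_update_work (h := Nat.succ_pos _), ← mkStk_update_input _ (a :: w') w']
    rfl
  have hend : ∀ (v : Ctl G) (S : Stacks G),
      TM2.step m ⟨some (.inl false), v, mkStk M S [] []⟩ = some ⟨some (.inr p.entry),
        { v with reg := none }, mkStk M S [] []⟩ := by
    intro v S
    have := mkStk_update_input (M := M) S ([] : List I) [] []
    conv_rhs => rw [← this]
    rfl
  have hread : ∀ (w' u : List I) (v : Ctl G), v.flag = false → v.mode = 0 → v.reg' = none →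
      u.length + w'.length = w.length →
      Relation.ReflTransGen (GoodStep (TM2.step m) Good)
        ⟨some (.inl false), v, mkStk M (fun k => if k = 0 then (u.map e).reverse else []) w' []⟩
        ⟨some (.inr p.entry), .init G,
          mkStk M (fun k => if k = 0 then ((u ++ w').map e).reverse else []) [] []⟩ := by
    intro w'
    induction w' with
    | nil =>
      intro u v h₁ h₂ h₃ hl
      refine .single ⟨?_, hgood _ _ _ _ hl⟩
      obtain ⟨f, md, r, r'⟩ := v
      simp only at h₁ h₂ h₃
      subst h₁ h₂ h₃
      rw [hend, List.append_nil]
      rfl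
    | cons a w' ih =>
      intro u v h₁ h₂ h₃ hl
      have hl' : (u ++ [a]).length + w'.length = w.length := by
        simp at hl ⊢; omega
      have := ih (u ++ [a]) { v with reg := some (e a) } h₁ h₂ h₃ hl'
      rw [List.append_assoc, List.singleton_append] at this
      refine .head ⟨?_, hgood _ _ _ _ hl⟩ this
      rw [hpop]
      congr 3
      funext k
      by_cases hk : k = 0
      · subst hk; simp
      · simp [hk]
  obtain ⟨-, hrun⟩ := Prog.code_correct (I := I) (M := M) m (s := s) (w := []) (o := []) Good
    (fun l v S hS => by
      simp only [Good]
      rw [sum_length_mkStk]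
      have := Finset.sum_le_sum fun i (_ : i ∈ Finset.range M) => hS i
      simp
      omega) h Sum.inr (.inl true) (Nat.le_succ _) (fun l => rfl) (fun k => by
        by_cases hk : k = 0
        · subst hk; simpa using hs
        · simp [hk])
  have hfin : GoodStep (TM2.step m) Good ⟨some (.inl true), v', mkStk M (fun _ => []) [] []⟩
      ⟨none, .init G, mkStk M (fun _ => []) [] [v'.flag]⟩ := by
    refine ⟨?_, ?_⟩
    · rw [← mkStk_update_output _ [] [] [v'.flag]]
      rfl
    · simp only [Good]
      rw [sum_length_mkStk]; simp
  have hall := ((hread w [] (.init G) rfl rfl rfl (by simp)).trans hrun).tail hfin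
  have e0 : mkStk M (fun k => if k = 0 then (([] : List I).map e).reverse else []) w []
      = mkStk M (fun _ => []) w [] := by
    congr 1; funext k; simp
  rw [e0] at hall
  refine ⟨?_, ?_⟩
  · unfold TM2Outputs
    rw [hinit, Option.map_some, hhalt]
    exact exists_evalsTo hall
  · intro c hc
    rw [hinit] at hc
    have hG : Good ⟨none, .init G, mkStk M (fun _ => []) [] [v'.flag]⟩ := by
      simp only [Good]
      rw [sum_length_mkStk]
      simp
      omega
    exact good_of_reaches (Good := Good) hall rfl hG hc

end

end StackProg

/-! ### Specifications of programs and basic stack operations -/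

namespace StackProg

open Function

variable {G : Type}

/-- `Runs s p b m S b' m' S'`: started with flag `b`, mode `m` and stacks `S`, the program `p` ends
with flag `b'`, mode `m'` and stacks `S'`, within the space bounds `s`. -/
def Runs (s : ℕ → ℕ) (p : Prog G) (b : Bool) (m : Fin 3) (S : Stacks G) (b' : Bool) (m' : Fin 3)
    (S' : Stacks G) : Prop :=
  ∀ v : Ctl G, v.flag = b → v.mode = m →
    ∃ v' : Ctl G, v'.flag = b' ∧ v'.mode = m' ∧ Exec s p v S v' S'

section
variable {s : ℕ → ℕ} {p q : Prog G} {b b₁ b₂ : Bool} {m m₁ m₂ : Fin 3} {S S₁ S₂ : Stacks G}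

theorem Runs.seq (h₁ : Runs s p b m S b₁ m₁ S₁) (h₂ : Runs s q b₁ m₁ S₁ b₂ m₂ S₂) :
    Runs s (.seq p q) b m S b₂ m₂ S₂ := by
  intro v hb hm
  obtain ⟨v₁, hb₁, hm₁, e₁⟩ := h₁ v hb hm
  obtain ⟨v₂, hb₂, hm₂, e₂⟩ := h₂ v₁ hb₁ hm₁
  exact ⟨v₂, hb₂, hm₂, .seq e₁ e₂⟩

theorem Runs.congr (h : Runs s p b m S b₁ m₁ S₁) (hS : S₁ = S₂) : Runs s p b m S b₁ m₁ S₂ :=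
  hS ▸ h

theorem Runs.ite_flag (h : Runs s (bif b then p else q) b m S b₁ m₁ S₁) :
    Runs s (.ite (fun v => v.flag) p q) b m S b₁ m₁ S₁ := by
  intro v hb hm
  obtain ⟨v₁, hb₁, hm₁, e₁⟩ := h v hb hm
  exact ⟨v₁, hb₁, hm₁, .ite (by rw [hb]; exact e₁)⟩

theorem Runs.ite_mode (t : Fin 3 → Bool) (h : Runs s (bif t m then p else q) b m S b₁ m₁ S₁) :
    Runs s (.ite (fun v => t v.mode) p q) b m S b₁ m₁ S₁ := by
  intro v hb hm
  obtain ⟨v₁, hb₁, hm₁, e₁⟩ := h v hb hm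
  exact ⟨v₁, hb₁, hm₁, .ite (by rw [hm]; exact e₁)⟩

theorem Runs.while_stop (t : Bool → Fin 3 → Bool) (h : t b m = false) :
    Runs s (.while (fun v => t v.flag v.mode) p) b m S b m S := by
  intro v hb hm
  exact ⟨v, hb, hm, .while_false (by rw [hb, hm]; exact h)⟩

theorem Runs.while_step (t : Bool → Fin 3 → Bool) (h : t b m = true)
    (h₁ : Runs s p b m S b₁ m₁ S₁)
    (h₂ : Runs s (.while (fun v => t v.flag v.mode) p) b₁ m₁ S₁ b₂ m₂ S₂) :
    Runs s (.while (fun v => t v.flag v.mode) p) b m S b₂ m₂ S₂ := by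
  intro v hb hm
  obtain ⟨v₁, hb₁, hm₁, e₁⟩ := h₁ v hb hm
  obtain ⟨v₂, hb₂, hm₂, e₂⟩ := h₂ v₁ hb₁ hm₁
  exact ⟨v₂, hb₂, hm₂, .while_true (by rw [hb, hm]; exact h) e₁ e₂⟩

/-- Set the flag and the mode. -/
def setCtl (f : Bool → Bool) (m : Fin 3) : Prog G := .load fun v => { v with flag := f v.flag, mode := m }

theorem runs_setCtl (f : Bool → Bool) (m' : Fin 3) : Runs s (setCtl f m') b m S (f b) m' S := by
  intro v hb hm
  exact ⟨_, by simp [hb], rfl, .load⟩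

/-- Push a fixed symbol. -/
def pushC (k : ℕ) (a : G) : Prog G := .push k fun _ => a

theorem runs_pushC {k : ℕ} {a : G} (h : (S k).length < s k) :
    Runs s (pushC k a) b m S b m (update S k (a :: S k)) := by
  intro v hb hm
  exact ⟨v, hb, hm, .push h⟩

end

/-- Pop stack `k` into the register. -/
def popR (k : ℕ) : Prog G := .pop k fun v o => { v with reg := o }

/-- Pop stack `k` into the second register. -/
def popR' (k : ℕ) : Prog G := .pop k fun v o => { v with reg' := o }

/-- Pop stack `k` until it is empty; the body is run for each symbol. -/
def drain (k : ℕ) (body : Prog G) : Prog G :=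
  .seq (popR k) (.while (fun v => v.reg.isSome) (.seq body (popR k)))

/-- For each popped symbol `a` the body puts the word `c a j` on stack `j`. The contribution of the
symbol popped last ends on top, whence the reversal. Space is required only on stacks that receive
something. -/
theorem drain_exec {s : ℕ → ℕ} {k : ℕ} {body : Prog G} {c : G → ℕ → List G}
    (hk : ∀ a, c a k = [])
    (hbody : ∀ a (v : Ctl G) S, v.reg = some a → (∀ j, c a j ≠ [] → (c a j ++ S j).length ≤ s j) →
      Exec s body v S v (fun j => c a j ++ S j)) :
    ∀ (x : List G) (v : Ctl G) (S : Stacks G), S k = x →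
      (∀ j, x.flatMap (c · j) ≠ [] → (x.flatMap (c · j)).length + (S j).length ≤ s j) →
      Exec s (drain k body) v S { v with reg := none }
        (update (fun j => x.reverse.flatMap (c · j) ++ S j) k []) := by
  have key : ∀ (x : List G) (v : Ctl G) (S : Stacks G) (a : G), S k = x → v.reg = some a →
      (∀ j, (a :: x).flatMap (c · j) ≠ [] →
        ((a :: x).flatMap (c · j)).length + (S j).length ≤ s j) →
      Exec s (.while (fun v => v.reg.isSome) (.seq body (popR k))) v S { v with reg := none }
        (update (fun j => (a :: x).reverse.flatMap (c · j) ++ S j) k []) := by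
    intro x
    induction x with
    | nil =>
      intro v S a hS hv hs
      have e := hbody a v S hv (fun j hj => by simpa using hs j (by simpa using hj))
      refine .while_true (by simp [hv]) (.seq e .pop) ?_
      have : ∀ S' : Stacks G, S' = update (fun j => c a j ++ S j) k [] →
        Exec s (.while (fun v : Ctl G => v.reg.isSome) (.seq body (popR k))) { v with reg := none } S'
          { v with reg := none } (update (fun j => [a].reverse.flatMap (c · j) ++ S j) k []) := by
        rintro _ rfl
        simpa using Exec.while_false (by rfl)
      simp only [hk, hS]
      exact this _ (by simp)
    | cons a' x ih =>
      intro v S a hS hv hs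
      have e := hbody a v S hv (fun j hj => by
        have := hs j (by simp [hj])
        simp at this ⊢
        omega)
      refine .while_true (by simp [hv]) (.seq e .pop) ?_
      simp only [hk, hS, List.nil_append, List.head?_cons, List.tail_cons]
      have := ih { v with reg := some a' } (update (fun j => c a j ++ S j) k x) a' (by simp) rfl ?_
      · convert this using 1
        funext j
        by_cases hj : j = k
        · subst hj; simp
        · simp [update_of_ne hj, List.flatMap_append]
      · intro j hj
        by_cases hjk : j = k
        · subst hjk
          exact absurd (by simp [hk]) hj
        · have := hs j (by
            rw [List.flatMap_cons]
            exact fun h => hj (List.append_eq_nil_iff.1 h).2)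
          simp [update_of_ne hjk] at this ⊢
          omega
  intro x v S hS hs
  refine .seq .pop ?_
  cases x with
  | nil =>
    rw [hS]
    have : update S k [] = update (fun j => ([] : List G).reverse.flatMap (c · j) ++ S j) k [] := by
      simp
    rw [← this]
    exact .while_false rfl
  | cons a x =>
    rw [hS]
    have := key x { v with reg := some a } (update S k x) a (by simp) rfl ?_
    · simp only [List.head?_cons, List.tail_cons]
      convert this using 1
      funext j
      by_cases hj : j = k
      · subst hj; simp
      · simp [update_of_ne hj]
    · intro j hj
      by_cases hjk : j = k
      · subst hjk
        exact absurd (by simp [hk]) hj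
      · have := hs j hj
        simpa [update_of_ne hjk] using this

variable [Inhabited G]

/-- Push the register on stack `k`. -/
def pushR (k : ℕ) : Prog G := .push k fun v => v.reg.getD default

def clear (k : ℕ) : Prog G := drain k (.load id)

def move (k t : ℕ) : Prog G := drain k (pushR t)

def move₂ (k t t' : ℕ) : Prog G := drain k (.seq (pushR t) (pushR t'))

section
variable {s : ℕ → ℕ} {b : Bool} {m : Fin 3} {S : Stacks G}

theorem runs_clear (k : ℕ) : Runs s (clear k) b m S b m (update S k []) := by
  intro v hb hm
  refine ⟨{ v with reg := none }, hb, hm, ?_⟩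
  have := drain_exec (s := s) (k := k) (body := .load id) (c := fun _ _ => []) (fun _ => rfl)
    (fun a v S _ _ => by simpa using Exec.load (f := id)) _ v S rfl (by simp)
  have e : ∀ x : List G, x.flatMap (fun _ => ([] : List G)) = [] := fun x => by
    rw [List.flatMap_eq_nil_iff]; simp
  simp only [e, List.nil_append] at this
  exact this

theorem runs_move {k t : ℕ} (hkt : k ≠ t) (h : (S k).length + (S t).length ≤ s t) :
    Runs s (move k t) b m S b m (update (update S k []) t ((S k).reverse ++ S t)) := by
  intro v hb hm
  refine ⟨{ v with reg := none }, hb, hm, ?_⟩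
  · have := drain_exec (s := s) (k := k) (body := pushR t)
      (c := fun a j => if j = t then [a] else []) (by simp [hkt]) ?_ (S k) v S rfl ?_
    · unfold move
      convert this using 1
      funext j
      by_cases hj : j = k
      · subst hj; simp [update_of_ne hkt]
      · by_cases hjt : j = t
        · subst hjt; simp [update_of_ne hj]
        · simp [update_of_ne hj, hjt]
    · intro a v S hv hs
      have h' := hs t (by simp)
      have : (fun j => (if j = t then [a] else []) ++ S j) = update S t (a :: S t) := by
        funext j
        by_cases hjt : j = t
        · subst hjt; simp
        · simp [hjt]
      rw [this]
      have e : Exec s (pushR t) v S v (update S t (v.reg.getD default :: S t)) :=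
        .push (by simp at h'; omega)
      simpa [hv] using e
    · intro j hj
      by_cases hjt : j = t
      · subst hjt; simpa using h
      · simp [hjt] at hj

theorem runs_move₂ {k t t' : ℕ} (hkt : k ≠ t) (hkt' : k ≠ t') (htt' : t ≠ t')
    (h : (S k).length + (S t).length ≤ s t) (h' : (S k).length + (S t').length ≤ s t') :
    Runs s (move₂ k t t') b m S b m
      (update (update (update S k []) t ((S k).reverse ++ S t)) t' ((S k).reverse ++ S t')) := by
  intro v hb hm
  refine ⟨{ v with reg := none }, hb, hm, ?_⟩
  · have := drain_exec (s := s) (k := k) (body := .seq (pushR t) (pushR t'))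
      (c := fun a j => if j = t ∨ j = t' then [a] else []) (by simp [hkt, hkt']) ?_ (S k) v S rfl ?_
    · unfold move₂
      convert this using 1
      funext j
      by_cases hj : j = k
      · subst hj; simp [update_of_ne, hkt, hkt']
      · by_cases hjt : j = t
        · subst hjt; simp [update_of_ne, hj, htt']
        · by_cases hjt' : j = t'
          · subst hjt'; simp [update_of_ne hj]
          · simp [update_of_ne, hj, hjt, hjt']
    · intro a v S hv hs
      have h₁ := hs t (by simp)
      have h₂ := hs t' (by simp)
      have : (fun j => (if j = t ∨ j = t' then [a] else []) ++ S j)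
          = update (update S t (a :: S t)) t' (a :: update S t (a :: S t) t') := by
        funext j
        by_cases hjt' : j = t'
        · subst hjt'; simp [update_of_ne (Ne.symm htt')]
        · by_cases hjt : j = t
          · subst hjt; simp [update_of_ne hjt']
          · simp [hjt, hjt']
      rw [this]
      have e₁ : Exec s (pushR t) v S v (update S t (v.reg.getD default :: S t)) :=
        .push (by simp at h₁; omega)
      have e₂ : ∀ S : Stacks G, (S t').length < s t' →
        Exec s (pushR t') v S v (update S t' (v.reg.getD default :: S t')) := fun S h => .push h
      simp only [hv, Option.getD_some] at e₁ e₂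
      exact .seq e₁ (e₂ _ (by simp [update_of_ne (Ne.symm htt')] at h₂ ⊢; omega))
    · intro j hj
      by_cases hjt : j = t
      · subst hjt; simpa using h
      · by_cases hjt' : j = t'
        · subst hjt'; simpa using h'
        · simp [hjt, hjt'] at hj

/-- Push a copy of stack `k` on stack `t`, with the empty stack `u` as scratch space. -/
def copy (k t u : ℕ) : Prog G := .seq (move k u) (move₂ u k t)

theorem runs_copy {k t u : ℕ} (hkt : k ≠ t) (hku : k ≠ u) (htu : t ≠ u) (hu : S u = [])
    (h : (S k).length + (S t).length ≤ s t) (h₁ : (S k).length ≤ s k) (h₂ : (S k).length ≤ s u) :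
    Runs s (copy k t u) b m S b m (update S t (S k ++ S t)) := by
  refine (Runs.seq (runs_move hku (by simpa [hu] using h₂)) (runs_move₂ hku.symm htu.symm hkt
    ?_ ?_)).congr ?_
  · simpa [hu, update_of_ne hku] using h₁
  · simpa [hu, update_of_ne, hkt.symm, htu] using h
  · funext j
    by_cases hj : j = t
    · subst hj; simp [hu, update_of_ne, hkt.symm, htu]
    · by_cases hj' : j = k
      · subst hj'; simp [hu, update_of_ne, hj, hku]
      · by_cases hj'' : j = u
        · subst hj''; simp [hu, update_of_ne, hj, hj']
        · simp [update_of_ne, hj, hj', hj'']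

end

end StackProg

namespace StackProg

open Function

variable {G : Type}

/-! ### Synchronous comparison of two stacks -/

/-- Do all pairs of symbols at the same place of two lists pass the test? -/
def allPairs (test : Option G → Option G → Bool) : List G → List G → Bool
  | [], [] => true
  | a :: x, [] => test (some a) none && allPairs test x []
  | [], b :: y => test none (some b) && allPairs test [] y
  | a :: x, b :: y => test (some a) (some b) && allPairs test x y

/-- Set the flag to the value of `allPairs`, emptying both stacks. -/
def compare (k k' : ℕ) (test : Option G → Option G → Bool) : Prog G :=
  .seq (.load fun v => { v with flag := true }) (.seq (popR k) (.seq (popR' k')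
    (.while (fun v => v.reg.isSome || v.reg'.isSome)
      (.seq (.load fun v => { v with flag := v.flag && test v.reg v.reg' })
        (.seq (popR k) (popR' k'))))))

theorem runs_compare {s : ℕ → ℕ} {b : Bool} {m : Fin 3} {S : Stacks G} {k k' : ℕ} (hk : k ≠ k')
    (test : Option G → Option G → Bool) :
    Runs s (compare k k' test) b m S (allPairs test (S k) (S k')) m
      (update (update S k []) k' []) := by
  intro v hb hm
  -- Loop invariant: the registers hold the heads of the lists still to be compared and the stacks
  -- hold their tails. The induction is on the total length.
  have key : ∀ (n : ℕ) (x y : List G) (v : Ctl G) (S : Stacks G), x.length + y.length ≤ n →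
      S k = x.tail → S k' = y.tail → v.reg = x.head? → v.reg' = y.head? →
      Exec s (.while (fun v => v.reg.isSome || v.reg'.isSome)
        (.seq (.load fun v => { v with flag := v.flag && test v.reg v.reg' })
        (.seq (popR k) (popR' k')))) v S
        { v with flag := v.flag && allPairs test x y, reg := none, reg' := none }
        (update (update S k []) k' []) := by
    intro n
    induction n with
    | zero =>
      intro x y v S hn hx hy hv hv'
      obtain rfl : x = [] := List.length_eq_zero_iff.1 (by omega)
      obtain rfl : y = [] := List.length_eq_zero_iff.1 (by omega)
      have e : update (update S k []) k' [] = S := by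
        funext j
        by_cases hj' : j = k'
        · subst hj'; simpa using hy.symm
        · by_cases hj : j = k
          · subst hj; simpa [update_of_ne hj'] using hx.symm
          · simp [update_of_ne, hj, hj']
      obtain ⟨f, md, r, r'⟩ := v
      simp only [List.head?_nil] at hv hv'
      subst hv hv'
      rw [e]
      simpa [allPairs] using Exec.while_false rfl
    | succ n ih =>
      intro x y v S hn hx hy hv hv'
      by_cases hne : x = [] ∧ y = []
      · obtain ⟨rfl, rfl⟩ := hne
        exact ih [] [] v S (by simp) hx hy hv hv'
      have hlt : x.tail.length + y.tail.length ≤ n := by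
        rcases x with - | ⟨a, x⟩ <;> rcases y with - | ⟨b, y⟩ <;> simp at hn hne ⊢ <;> omega
      have hstep : allPairs test x y = (test x.head? y.head? && allPairs test x.tail y.tail) := by
        rcases x with - | ⟨a, x⟩ <;> rcases y with - | ⟨b, y⟩ <;> simp [allPairs] at hne ⊢
      have h₂ := ih x.tail y.tail
        { v with flag := v.flag && test v.reg v.reg', reg := x.tail.head?, reg' := y.tail.head? }
        (update (update S k x.tail.tail) k' y.tail.tail) hlt (by simp [update_of_ne hk])
        (by simp) rfl rfl
      refine .while_true ?_ (.seq .load (.seq .pop .pop)) ?_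
      · rw [hv, hv']
        rcases x with - | ⟨a, x⟩ <;> rcases y with - | ⟨b, y⟩ <;> simp at hne ⊢
      · simp only [update_of_ne hk.symm, hx, hy]
        convert h₂ using 1
        · rw [hstep, hv, hv', Bool.and_assoc]
        · funext j
          by_cases hj' : j = k'
          · subst hj'; simp
          · by_cases hj : j = k
            · subst hj; simp [update_of_ne hj']
            · simp [update_of_ne, hj, hj']
  have e := key _ (S k) (S k') ⟨true, v.mode, (S k).head?, (S k').head?⟩
    (update (update S k (S k).tail) k' (S k').tail) le_rfl (by simp [update_of_ne hk])
    (by simp) rfl rfl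
  refine ⟨⟨allPairs test (S k) (S k'), v.mode, none, none⟩, rfl, hm, .seq .load (.seq .pop
    (.seq .pop ?_))⟩
  simp only [update_of_ne hk.symm]
  simp only [Bool.true_and] at e
  convert e using 1
  funext j
  by_cases hj' : j = k'
  · subst hj'; simp
  · by_cases hj : j = k
    · subst hj; simp [update_of_ne hj']
    · simp [update_of_ne, hj, hj']

theorem allPairs_eq [DecidableEq G] : ∀ x y : List G,
    allPairs (fun o o' => decide (o = o')) x y = true ↔ x = y
  | [], [] => by simp [allPairs]
  | a :: x, [] => by simp [allPairs]
  | [], b :: y => by simp [allPairs]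
  | a :: x, b :: y => by simp [allPairs, allPairs_eq x y]

theorem allPairs_le : ∀ x y : List G,
    allPairs (fun o o' => o.isNone || o'.isSome) x y = true ↔ x.length ≤ y.length
  | [], [] => by simp [allPairs]
  | a :: x, [] => by simp [allPairs]
  | [], b :: y => by simpa [allPairs] using allPairs_le [] y
  | a :: x, b :: y => by simp [allPairs, allPairs_le x y]

section
variable [Inhabited G]

/-- Set the flag according to whether the stacks `x` and `y` are equal, with scratch `u`, `u + 1`
and `u + 2`. -/
def isEq [DecidableEq G] (x y u : ℕ) : Prog G :=
  .seq (copy x u (u + 2)) (.seq (copy y (u + 1) (u + 2))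
    (compare u (u + 1) fun o o' => decide (o = o')))

theorem runs_isEq [DecidableEq G] {B : ℕ} {b : Bool} {m : Fin 3} {S : Stacks G} {x y u : ℕ}
    (hx : x < u) (hy : y < u) (h₀ : S u = []) (h₁ : S (u + 1) = []) (h₂ : S (u + 2) = [])
    (hxB : (S x).length ≤ B) (hyB : (S y).length ≤ B) :
    Runs (fun _ => B) (isEq x y u) b m S (decide (S x = S y)) m S := by
  refine Runs.seq (runs_copy (by omega) (by omega) (by omega) h₂ (by simpa [h₀] using hxB) hxB hxB)
    (Runs.seq (runs_copy (by omega) (by omega) (by omega) ?_ ?_ ?_ ?_)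
      (?_ : Runs _ _ b m _ _ m S))
  · simpa using h₂
  · have : y ≠ u := by omega
    simpa [h₁, update_of_ne this] using hyB
  · have : y ≠ u := by omega
    simpa [update_of_ne this] using hyB
  · have : y ≠ u := by omega
    simpa [update_of_ne this] using hyB
  · have hyu : y ≠ u := by omega
    have := runs_compare (s := fun _ => B) (b := b) (m := m)
      (S := update (update S u (S x)) (u + 1) (S y)) (show u ≠ u + 1 by omega)
      (fun o o' : Option G => decide (o = o'))
    simp only [h₀, h₁, List.append_nil, update_of_ne hyu,
      update_of_ne (show u + 1 ≠ u by omega)]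
    convert this using 1
    · rw [Bool.eq_iff_iff, decide_eq_true_iff, allPairs_eq]
      simp
    · funext j
      by_cases hj : j = u
      · subst hj; simp [h₀]
      · by_cases hj' : j = u + 1
        · subst hj'; simp [h₁]
        · simp [update_of_ne, hj, hj']

/-- Set the flag according to whether stack `x` is at most as high as stack `y`. -/
def isLe (x y u : ℕ) : Prog G :=
  .seq (copy x u (u + 2)) (.seq (copy y (u + 1) (u + 2))
    (compare u (u + 1) fun o o' => o.isNone || o'.isSome))

theorem runs_isLe {B : ℕ} {b : Bool} {m : Fin 3} {S : Stacks G} {x y u : ℕ}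
    (hx : x < u) (hy : y < u) (h₀ : S u = []) (h₁ : S (u + 1) = []) (h₂ : S (u + 2) = [])
    (hxB : (S x).length ≤ B) (hyB : (S y).length ≤ B) :
    Runs (fun _ => B) (isLe x y u) b m S (decide ((S x).length ≤ (S y).length)) m S := by
  refine Runs.seq (runs_copy (by omega) (by omega) (by omega) h₂ (by simpa [h₀] using hxB) hxB hxB)
    (Runs.seq (runs_copy (by omega) (by omega) (by omega) ?_ ?_ ?_ ?_)
      (?_ : Runs _ _ b m _ _ m S))
  · simpa using h₂
  · have : y ≠ u := by omega
    simpa [h₁, update_of_ne this] using hyB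
  · have : y ≠ u := by omega
    simpa [update_of_ne this] using hyB
  · have : y ≠ u := by omega
    simpa [update_of_ne this] using hyB
  · have hyu : y ≠ u := by omega
    have := runs_compare (s := fun _ => B) (b := b) (m := m)
      (S := update (update S u (S x)) (u + 1) (S y)) (show u ≠ u + 1 by omega)
      (fun o o' : Option G => o.isNone || o'.isSome)
    simp only [h₀, h₁, List.append_nil, update_of_ne hyu,
      update_of_ne (show u + 1 ≠ u by omega)]
    convert this using 1
    · rw [Bool.eq_iff_iff, decide_eq_true_iff, allPairs_le]
      simp
    · funext j
      by_cases hj : j = u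
      · subst hj; simp [h₀]
      · by_cases hj' : j = u + 1
        · subst hj'; simp [h₁]
        · simp [update_of_ne, hj, hj']

end

/-! ### Enumeration of strings -/

section
variable [Fintype G]

noncomputable def symIdx (a : G) : Fin (Fintype.card G) := Fintype.equivFin G a

open Classical in
/-- The next symbol, if any, in a fixed enumeration of the alphabet. -/
noncomputable def nextSym (a : G) : Option G :=
  if h : (symIdx a : ℕ) + 1 < Fintype.card G then some ((Fintype.equivFin G).symm ⟨_, h⟩) else none

/-- The first symbol in a fixed enumeration of the alphabet. -/
noncomputable def firstSym [Inhabited G] : G :=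
  (Fintype.equivFin G).symm ⟨0, Fintype.card_pos⟩

variable [Inhabited G]

/-- The next string in an enumeration of all strings. -/
noncomputable def nextStr : List G → List G
  | [] => [firstSym]
  | a :: x => match nextSym a with
    | some b => b :: x
    | none => firstSym :: nextStr x

theorem length_le_nextStr : ∀ x : List G, x.length ≤ (nextStr x).length
  | [] => by simp [nextStr]
  | a :: x => by
    rw [nextStr]
    cases nextSym a <;> simp [length_le_nextStr x]

theorem length_nextStr_le : ∀ x : List G, (nextStr x).length ≤ x.length + 1
  | [] => by simp [nextStr]
  | a :: x => by
    rw [nextStr]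
    cases nextSym a <;> simp [length_nextStr_le x]

/-- Words are numerals in bijective base `card G`, least significant digit first, and `nextStr` is
the successor. The predecessor borrows through the leading first symbols, and the value of the
numeral, which is the `foldr`, decreases. -/
theorem exists_nextStr_eq (x : List G) (hx : x ≠ []) :
    ∃ y : List G, nextStr y = x ∧
      y.foldr (fun a n => symIdx a + 1 + Fintype.card G * n) 0
        < x.foldr (fun a n => symIdx a + 1 + Fintype.card G * n) 0 := by
  induction x with
  | nil => exact absurd rfl hx
  | cons a x ih =>
    by_cases ha : (symIdx a : ℕ) = 0
    · have ha' : a = firstSym := by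
        rw [firstSym, Equiv.eq_symm_apply]
        exact Fin.ext ha
      by_cases hx' : x = []
      · subst hx'
        exact ⟨[], by simp [nextStr, ha'], by simp⟩
      · obtain ⟨y, hy, hlt⟩ := ih hx'
        have hc : 0 < Fintype.card G := Fintype.card_pos
        let l : G := (Fintype.equivFin G).symm ⟨Fintype.card G - 1, by omega⟩
        have hl : (symIdx l : ℕ) = Fintype.card G - 1 := by simp [symIdx, l]
        refine ⟨l :: y, ?_, ?_⟩
        · have : nextSym l = none := by
            rw [nextSym, dif_neg]; omega
          rw [nextStr, this]
          simp [hy, ha']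
        · simp only [List.foldr_cons, hl, ha]
          have := Nat.mul_le_mul_left (Fintype.card G) (Nat.succ_le_of_lt hlt)
          rw [Nat.mul_succ] at this
          omega
    · let l : G := (Fintype.equivFin G).symm ⟨symIdx a - 1, by have := (symIdx a).2; omega⟩
      have hl : (symIdx l : ℕ) = symIdx a - 1 := by simp [symIdx, l]
      refine ⟨l :: x, ?_, ?_⟩
      · have : nextSym l = some a := by
          have h := (symIdx a).2
          rw [nextSym, dif_pos (by omega)]
          congr 1
          rw [Equiv.symm_apply_eq]
          apply Fin.ext
          simp only [hl]
          show _ = ((symIdx a : Fin _) : ℕ)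
          omega
        rw [nextStr, this]
      · simp only [List.foldr_cons, hl]
        omega

theorem exists_iterate_nextStr (x : List G) : ∃ n, nextStr^[n] [] = x := by
  induction h : x.foldr (fun a n => symIdx a + 1 + Fintype.card G * n) 0 using
    Nat.strong_induction_on generalizing x with
  | _ n ih =>
    by_cases hx : x = []
    · exact ⟨0, hx.symm⟩
    · obtain ⟨y, hy, hlt⟩ := exists_nextStr_eq x hx
      obtain ⟨k, hk⟩ := ih _ (h ▸ hlt) y rfl
      exact ⟨k + 1, by rw [Function.iterate_succ_apply', hk, hy]⟩

/-- Once the enumeration has passed length `N`, no word of length at most `N` is still to come. This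
justifies stopping a bounded search. -/
theorem length_iterate_nextStr_mono {i j : ℕ} (h : i ≤ j) :
    (nextStr^[i] ([] : List G)).length ≤ (nextStr^[j] ([] : List G)).length := by
  induction h with
  | refl => exact le_rfl
  | step _ ih =>
    rw [Function.iterate_succ_apply']
    exact ih.trans (length_le_nextStr _)

/-- Replace stack `k` by the next string, with scratch stack `u`. -/
noncomputable def next (k u : ℕ) : Prog G :=
  .seq (popR k) (.seq
    (.while (fun v => v.reg.isSome && (v.reg.bind nextSym).isNone) (.seq (pushC u firstSym) (popR k)))
    (.seq (.push k fun v => (v.reg.bind nextSym).getD firstSym) (move u k)))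

theorem runs_next {B : ℕ} {b : Bool} {m : Fin 3} {S : Stacks G} {k u : ℕ} (hk : k ≠ u)
    (hu : S u = []) (hB : (S k).length < B) :
    Runs (fun _ => B) (next k u) b m S b m (update S k (nextStr (S k))) := by
  -- The loop pops the symbols that overflow and stores a `firstSym` for each of them on `u`. It
  -- stops at a symbol that can be raised, or at the end of the word, where `getD` supplies the
  -- additional digit.
  have key : ∀ (x : List G) (v : Ctl G) (S : Stacks G) (n : ℕ), S k = x.tail → v.reg = x.head? →
      S u = List.replicate n firstSym → n + x.length < B →
      ∃ v' j y, v'.flag = v.flag ∧ v'.mode = v.mode ∧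
        nextStr x = List.replicate j firstSym ++ (v'.reg.bind nextSym).getD firstSym :: y ∧
        Exec (fun _ => B) (.while (fun v => v.reg.isSome && (v.reg.bind nextSym).isNone)
          (.seq (pushC u firstSym) (popR k))) v S v'
          (update (update S k y) u (List.replicate (j + n) firstSym)) := by
    intro x
    induction x with
    | nil =>
      intro v S n hS hv hSu hn
      refine ⟨v, 0, [], rfl, rfl, ?_, ?_⟩
      · simp [nextStr, hv]
      · have : update (update S k []) u (List.replicate (0 + n) firstSym) = S := by
          rw [Nat.zero_add, ← hSu, ← show S k = [] from hS]
          simp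
        rw [this]
        exact .while_false (by simp [hv])
    | cons a x ih =>
      intro v S n hS hv hSu hn
      simp only [List.head?_cons, List.tail_cons, List.length_cons] at hv hS hn
      cases ha : nextSym a with
      | some a' =>
        refine ⟨v, 0, x, rfl, rfl, ?_, ?_⟩
        · simp [nextStr, hv, ha]
        · have : update (update S k x) u (List.replicate (0 + n) firstSym) = S := by
            rw [Nat.zero_add, ← hSu, ← hS]
            simp
          rw [this]
          exact .while_false (by simp [hv, ha])
      | none =>
        obtain ⟨v', j, y, h₁, h₂, h₃, h₄⟩ := ih { v with reg := x.head? }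
          (update (update S u (firstSym :: S u)) k x.tail) (n + 1) (by simp) rfl
          (by simp [update_of_ne hk.symm, hSu, List.replicate_succ]) (by omega)
        refine ⟨v', j + 1, y, h₁, h₂, ?_, ?_⟩
        · simp only [nextStr, ha, h₃, List.replicate_succ, List.cons_append]
        · refine .while_true (by simp [hv, ha]) (.seq (.push (by simp [hSu]; omega)) .pop) ?_
          simp only [update_of_ne hk, hS]
          convert h₄ using 1
          funext i
          by_cases hi : i = u
          · subst hi; simp; omega
          · by_cases hi' : i = k
            · subst hi'; simp [update_of_ne hi]
            · simp [update_of_ne, hi, hi']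
  intro v hb hm
  obtain ⟨v', j, y, h₁, h₂, h₃, h₄⟩ := key (S k) { v with reg := (S k).head? }
    (update S k (S k).tail) 0 (by simp) rfl (by simp [update_of_ne hk.symm, hu]) (by simpa using hB)
  have hlen : j + 1 + y.length ≤ B := by
    have := congrArg List.length h₃
    have h' := length_nextStr_le (S k)
    simp at this
    omega
  have hmv := runs_move (s := fun _ => B) (b := b) (m := m) (k := u) (t := k) (S :=
    update (update (update S k y) u (List.replicate j firstSym)) k
      ((v'.reg.bind nextSym).getD firstSym :: y)) hk.symm (by
        simp [update_of_ne hk.symm]; omega)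
  obtain ⟨v'', hb', hm', e⟩ := hmv v' (h₁.trans hb) (h₂.trans hm)
  refine ⟨v'', hb', hm', .seq .pop (.seq h₄ (.seq (.push ?_) ?_))⟩
  · simp [update_of_ne hk]; omega
  · simp only [update_of_ne hk, update_self, Nat.add_zero, update_idem]
    convert e using 1
    funext i
    by_cases hi : i = k
    · subst hi; simp [update_of_ne hk.symm, h₃]
    · by_cases hi' : i = u
      · subst hi'; simp [update_of_ne hi, hu]
      · simp [update_of_ne, hi, hi']

end

/-! ### Frames -/

section
variable [Inhabited G] [DecidableEq G] (one zero : G)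

/-- A self-delimiting code of strings. -/
def frame (x : List G) : List G := x.flatMap (fun a => [one, a]) ++ [zero]

omit [Inhabited G] [DecidableEq G] in
theorem length_frame (x : List G) : (frame one zero x).length = 2 * x.length + 1 := by
  simp [frame, List.length_flatMap, mul_comm]

/-- The word travels from `k` to `u` and back, so that `k` keeps it. On the way back each symbol is
also put on `F` with the marker `one` above it. The terminator `zero` goes in first and so lies at
the bottom of the frame. -/
def pushFrame (k F u : ℕ) : Prog G :=
  .seq (pushC F zero) (.seq (move k u)
    (drain u (.seq (pushR k) (.seq (pushR F) (pushC F one)))))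

def popFrame (F k u : ℕ) : Prog G :=
  .seq (popR F) (.seq
    (.while (fun v => decide (v.reg = some one)) (.seq (popR F) (.seq (pushR u) (popR F))))
    (move u k))

omit [DecidableEq G] in
theorem runs_pushFrame {B : ℕ} {b : Bool} {m : Fin 3} {S : Stacks G} {k F u : ℕ} (hkF : k ≠ F)
    (hku : k ≠ u) (hFu : F ≠ u) (hu : S u = []) (hB : 2 * (S k).length + 1 + (S F).length ≤ B) :
    Runs (fun _ => B) (pushFrame one zero k F u) b m S b m
      (update S F (frame one zero (S k) ++ S F)) := by
  have hd : Runs (fun _ => B) (drain u (.seq (pushR k) (.seq (pushR F) (pushC F one)))) b m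
      (update (update (update S F (zero :: S F)) k []) u (S k).reverse) b m
      (update S F (frame one zero (S k) ++ S F)) := by
    intro v hb hm
    refine ⟨{ v with reg := none }, hb, hm, ?_⟩
    have := drain_exec (s := fun _ => B) (k := u)
      (body := .seq (pushR k) (.seq (pushR F) (pushC F one)))
      (c := fun a j => if j = k then [a] else if j = F then [one, a] else [])
      (by simp [hku.symm, hFu.symm]) ?_ (S k).reverse v
      (update (update (update S F (zero :: S F)) k []) u (S k).reverse) (by simp) ?_
    · convert this using 1
      funext j
      by_cases hj : j = u
      · subst hj; simp [update_of_ne hFu.symm, hu]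
      · by_cases hjk : j = k
        · subst hjk; simp [update_of_ne, hkF, hj]
        · by_cases hjF : j = F
          · subst hjF; simp [update_of_ne, hj, hjk, frame]
          · simp [update_of_ne, hj, hjk, hjF]
    · intro a v S hv hs
      have h₁ := hs k (by simp)
      have h₂ := hs F (by simp [hkF.symm])
      have : (fun j => (if j = k then [a] else if j = F then [one, a] else []) ++ S j)
          = update (update (update S k (a :: S k)) F (a :: S F)) F (one :: a :: S F) := by
        funext j
        by_cases hj : j = F
        · subst hj; simp [hkF.symm]
        · by_cases hj' : j = k
          · subst hj'; simp [update_of_ne hj]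
          · simp [hj, hj']
      rw [this]
      simp [hkF.symm] at h₁ h₂
      have e₁ : Exec (fun _ => B) (pushR k) v S v (update S k (v.reg.getD default :: S k)) :=
        .push (by omega)
      have e₂ : ∀ S' : Stacks G, (S' F).length < B → Exec (fun _ => B) (pushR F) v S' v
        (update S' F (v.reg.getD default :: S' F)) := fun S' h => .push h
      have e₃ : ∀ S' : Stacks G, (S' F).length < B → Exec (fun _ => B) (pushC F one) v S' v
        (update S' F (one :: S' F)) := fun S' h => .push h
      simp only [hv, Option.getD_some] at e₁ e₂
      have e₂' := e₂ (update S k (a :: S k)) (by simp [update_of_ne hkF.symm]; omega)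
      simp only [update_of_ne hkF.symm] at e₂'
      have e₃' := e₃ (update (update S k (a :: S k)) F (a :: S F)) (by simp; omega)
      simp only [update_self] at e₃'
      exact .seq e₁ (.seq e₂' e₃')
    · intro j hj
      by_cases hjk : j = k
      · subst hjk; simp [update_of_ne hku]; omega
      · by_cases hjF : j = F
        · subst hjF
          simp [update_of_ne, hjk, hFu, List.length_flatMap]; omega
        · simp [hjk, hjF] at hj
  have hS₁ : update S F (zero :: S F) k = S k := by simp [update_of_ne hkF]
  have hS₂ : update S F (zero :: S F) u = [] := by simp [update_of_ne hFu.symm, hu]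
  refine Runs.seq (runs_pushC ?_) (Runs.seq (runs_move hku ?_) ?_)
  · omega
  · rw [hS₁, hS₂]; simp; omega
  · rw [hS₁, hS₂, List.append_nil]
    exact hd

theorem runs_popFrame {B : ℕ} {b : Bool} {m : Fin 3} {S : Stacks G} {k F u : ℕ}
    {x r : List G} (h01 : zero ≠ one) (hkF : k ≠ F)
    (hku : k ≠ u) (hFu : F ≠ u) (hu : S u = []) (hk : S k = []) (hF : S F = frame one zero x ++ r)
    (hB : x.length ≤ B) :
    Runs (fun _ => B) (popFrame one F k u) b m S b m (update (update S F r) k x) := by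
  have key : ∀ (x : List G) (v : Ctl G) (S : Stacks G), v.reg = (frame one zero x).head? →
      S F = (frame one zero x).tail ++ r → x.length + (S u).length ≤ B →
      Exec (fun _ => B) (.while (fun v => decide (v.reg = some one))
        (.seq (popR F) (.seq (pushR u) (popR F)))) v S { v with reg := some zero }
        (update (update S F r) u (x.reverse ++ S u)) := by
    intro x
    induction x with
    | nil =>
      intro v S hv hS hB
      obtain ⟨f, md, r, r'⟩ := v
      simp [frame] at hv hS
      subst hv
      have : ∀ S', S' = S → Exec (fun _ => B) (.while (fun v : Ctl G => decide (v.reg = some one))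
        (.seq (popR F) (.seq (pushR u) (popR F)))) ⟨f, md, some zero, r'⟩ S ⟨f, md, some zero, r'⟩
        S' := by
        rintro _ rfl
        exact Exec.while_false (by simp [h01])
      apply this
      rw [← hS]; simp
    | cons a x ih =>
      intro v S hv hS hB
      simp [frame] at hv hS
      have hrec := ih { v with reg := (frame one zero x).head? }
        (update (update (update S F (frame one zero x ++ r)) u (a :: S u)) F
          ((frame one zero x).tail ++ r)) rfl (by simp)
        (by simp [update_of_ne hFu.symm] at hB ⊢; omega)
      have hS' : S F = a :: (frame one zero x ++ r) := by
        rw [hS]; simp [frame]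
      have hne : frame one zero x ≠ [] := by simp [frame]
      have e₂ : ∀ S' : Stacks G, (S' u).length < B → Exec (fun _ => B) (pushR u)
        { v with reg := some a } S' { v with reg := some a } (update S' u (a :: S' u)) :=
        fun S' h => .push h
      have e₂' := e₂ (update S F (frame one zero x ++ r))
        (by simp [update_of_ne hFu.symm] at hB ⊢; omega)
      have e₁ : Exec (fun _ => B) (popR F) v S { v with reg := some a }
          (update S F (frame one zero x ++ r)) := by
        have : Exec (fun _ => B) (popR F) v S { v with reg := (S F).head? }
          (update S F (S F).tail) := .pop
        simpa [hS'] using this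
      simp only [update_of_ne hFu.symm] at e₂'
      have e₃ : Exec (fun _ => B) (popR F) { v with reg := some a }
          (update (update S F (frame one zero x ++ r)) u (a :: S u))
          { v with reg := (frame one zero x).head? }
          (update (update (update S F (frame one zero x ++ r)) u (a :: S u)) F
            ((frame one zero x).tail ++ r)) := by
        have : ∀ S' : Stacks G, Exec (fun _ => B) (popR F) { v with reg := some a } S'
          { v with reg := (S' F).head? } (update S' F (S' F).tail) := fun _ => .pop
        have := this (update (update S F (frame one zero x ++ r)) u (a :: S u))
        simp only [update_of_ne hFu, update_self, List.head?_append_of_ne_nil _ hne,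
          List.tail_append_of_ne_nil hne] at this
        exact this
      refine .while_true (by simp [hv]) (.seq e₁ (.seq e₂' e₃)) ?_
      convert hrec using 1
      funext i
      by_cases hi : i = u
      · subst hi; simp [update_of_ne hFu.symm]
      · by_cases hi' : i = F
        · subst hi'; simp [update_of_ne hi]
        · simp [update_of_ne, hi, hi']
  intro v hb hm
  have hne : frame one zero x ≠ [] := by simp [frame]
  have e₁ : Exec (fun _ => B) (popR F) v S { v with reg := (frame one zero x).head? }
      (update S F ((frame one zero x).tail ++ r)) := by
    have : Exec (fun _ => B) (popR F) v S { v with reg := (S F).head? }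
      (update S F (S F).tail) := .pop
    simp only [hF, List.head?_append_of_ne_nil _ hne,
          List.tail_append_of_ne_nil hne] at this
    exact this
  have e₂ := key x { v with reg := (frame one zero x).head? }
    (update S F ((frame one zero x).tail ++ r)) rfl (by simp)
    (by simpa [update_of_ne hFu.symm, hu] using hB)
  have hmv := runs_move (s := fun _ => B) (b := b) (m := m) (k := u) (t := k) (S :=
    update (update S F r) u x.reverse) hku.symm (by simp [update_of_ne, hku, hkF, hk, hB])
  obtain ⟨v', hb', hm', e₃⟩ := hmv { v with reg := some zero } hb hm
  refine ⟨v', hb', hm', .seq e₁ (.seq e₂ ?_)⟩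
  convert e₃ using 1
  · funext i
    by_cases hi : i = u
    · subst hi; simp [update_of_ne hFu.symm, hu]
    · simp [update_of_ne hi]
  · funext i
    by_cases hi : i = k
    · subst hi; simp [update_of_ne, hkF, hku, hk]
    · by_cases hi' : i = u
      · subst hi'; simp [update_of_ne, hi, hFu.symm, hu]
      · simp [update_of_ne, hi, hi']

end

end StackProg

/-! ### Definable relations: Boolean operations and bounded quantifiers -/

namespace StackProg

open Function

variable {G : Type} [Fintype G] [DecidableEq G] [Inhabited G]

/-- A relation between strings of length at most `N`, which are the values of the variables in `ι`,
is definable if, wherever the variables are placed, it is decided by a program in space `O(N²)`.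
Stack `0` holds `N` in unary. -/
def Def {ι : Type} (P : ℕ → (ι → List G) → Prop) : Prop :=
  ∀ (ρ : ι → ℕ) (d : ℕ), (∀ i, ρ i < d) → 0 < d → ∃ (p : Prog G) (c : ℕ),
    ∀ (N B : ℕ) (S : Stacks G) (b : Bool) (m : Fin 3), S 0 = List.replicate N default →
      (∀ i, (S (ρ i)).length ≤ N) → (∀ k, d ≤ k → S k = []) → c * (N + 2) ^ 2 ≤ B →
      ∃ b', (b' = true ↔ P N fun i => S (ρ i)) ∧ Runs (fun _ => B) p b m S b' 0 S

namespace Def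

variable {ι κ : Type} {P Q : ℕ → (ι → List G) → Prop}

omit [Fintype G] [DecidableEq G] in
theorem congr (h : Def P) (hPQ : ∀ N e, (∀ i, (e i).length ≤ N) → (P N e ↔ Q N e)) : Def Q := by
  intro ρ d hρ hd
  obtain ⟨p, c, hp⟩ := h ρ d hρ hd
  refine ⟨p, c, fun N B S b m h₀ hι hS hB => ?_⟩
  obtain ⟨b', hb', e⟩ := hp N B S b m h₀ hι hS hB
  exact ⟨b', hb'.trans (hPQ N _ hι), e⟩

omit [Fintype G] [DecidableEq G] in
theorem rename (h : Def P) (f : ι → κ) : Def fun N e => P N fun i => e (f i) := fun ρ d hρ hd =>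
  let ⟨p, c, hp⟩ := h (fun i => ρ (f i)) d (fun i => hρ (f i)) hd
  ⟨p, c, fun N B S b m h₀ hι hS hB => hp N B S b m h₀ (fun i => hι (f i)) hS hB⟩

theorem not (h : Def P) : Def fun N e => ¬ P N e := by
  intro ρ d hρ hd
  obtain ⟨p, c, hp⟩ := h ρ d hρ hd
  refine ⟨.seq p (setCtl (fun b => !b) 0), c, fun N B S b m h₀ hι hS hB => ?_⟩
  obtain ⟨b', hb', e⟩ := hp N B S b m h₀ hι hS hB
  exact ⟨!b', by simp [← hb'], e.seq (runs_setCtl (fun b => !b) 0)⟩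

theorem and (h : Def P) (h' : Def Q) : Def fun N e => P N e ∧ Q N e := by
  intro ρ d hρ hd
  obtain ⟨p, c, hp⟩ := h ρ d hρ hd
  obtain ⟨q, c', hq⟩ := h' ρ d hρ hd
  refine ⟨.seq p (.ite (fun v => v.flag) q (setCtl id 0)), max c c',
    fun N B S b m h₀ hι hS hB => ?_⟩
  obtain ⟨b₁, hb₁, e₁⟩ := hp N B S b m h₀ hι hS
    ((Nat.mul_le_mul_right _ (le_max_left _ _)).trans hB)
  obtain ⟨b₂, hb₂, e₂⟩ := hq N B S b₁ 0 h₀ hι hS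
    ((Nat.mul_le_mul_right _ (le_max_right _ _)).trans hB)
  refine ⟨b₁ && b₂, by simp [← hb₁, ← hb₂], e₁.seq (Runs.ite_flag ?_)⟩
  cases b₁ with
  | true => simpa using e₂
  | false => exact runs_setCtl id 0

theorem or (h : Def P) (h' : Def Q) : Def fun N e => P N e ∨ Q N e :=
  (h.not.and h'.not).not.congr fun N e _ => by tauto

theorem imp (h : Def P) (h' : Def Q) : Def fun N e => P N e → Q N e :=
  (h.not.or h').congr fun N e _ => by tauto

theorem sing (i : ι) (a : G) : Def fun (_ : ℕ) (e : ι → List G) => e i = [a] := by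
  intro ρ d hρ hd
  refine ⟨.seq (pushC d a) (.seq (isEq (ρ i) d (d + 1)) (.seq (clear d) (setCtl id 0))), 2,
    fun N B S b m h₀ hι hS hB => ?_⟩
  have hB' : N + 1 < B := by nlinarith
  have hi := hρ i
  have li := hι i
  have hd0 := hS d le_rfl
  have e₁ : Runs (fun _ => B) (pushC d a) b m S b m (update S d [a]) :=
    (runs_pushC (by simp [hd0]; omega)).congr (by rw [hd0])
  have e₂ := runs_isEq (B := B) (b := b) (m := m) (S := update S d [a]) (x := ρ i) (y := d)
    (u := d + 1) (by omega) (by omega) (by rw [update_of_ne (by omega)]; exact hS _ (by omega))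
    (by rw [update_of_ne (by omega)]; exact hS _ (by omega)) (by rw [update_of_ne (by omega)]; exact hS _ (by omega))
    (by simp [update_of_ne hi.ne]; omega) (by simp; omega)
  refine ⟨_, ?_, e₁.seq (e₂.seq ((runs_clear d).seq ((runs_setCtl id 0).congr ?_)))⟩
  · simp [update_of_ne hi.ne]
  · simp [hd0]

theorem cat (i j k : ι) : Def fun (_ : ℕ) (e : ι → List G) => e i = e j ++ e k := by
  intro ρ d hρ hd
  refine ⟨.seq (copy (ρ k) d (d + 1)) (.seq (copy (ρ j) d (d + 1))
    (.seq (isEq (ρ i) d (d + 1)) (.seq (clear d) (setCtl id 0)))), 2,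
    fun N B S b m h₀ hι hS hB => ?_⟩
  have hB' : 2 * N + 1 < B := by nlinarith
  have hi := hρ i
  have hj := hρ j
  have hk := hρ k
  have li := hι i
  have lj := hι j
  have lk := hι k
  have hd0 := hS d le_rfl
  have hd1 := hS (d + 1) (by omega)
  have e₀ : Runs (fun _ => B) (copy (ρ k) d (d + 1)) b m S b m (update S d (S (ρ k))) :=
    (runs_copy (by omega) (by omega) (by omega) hd1 (by simp [hd0]; omega) (by omega)
      (by omega)).congr (by simp [hd0])
  have e₁ : Runs (fun _ => B) (copy (ρ j) d (d + 1)) b m (update S d (S (ρ k))) b m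
      (update S d (S (ρ j) ++ S (ρ k))) :=
    (runs_copy (by omega) (by omega) (by omega) (by simpa using hd1)
      (by simp [update_of_ne hj.ne]; omega) (by simp [update_of_ne hj.ne]; omega)
      (by simp [update_of_ne hj.ne]; omega)).congr (by simp [update_of_ne hj.ne])
  have e₂ := runs_isEq (B := B) (b := b) (m := m) (S := update S d (S (ρ j) ++ S (ρ k)))
    (x := ρ i) (y := d) (u := d + 1) (by omega) (by omega) (by rw [update_of_ne (by omega)]; exact hS _ (by omega))
    (by rw [update_of_ne (by omega)]; exact hS _ (by omega)) (by rw [update_of_ne (by omega)]; exact hS _ (by omega))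
    (by simp [update_of_ne hi.ne]; omega) (by simp; omega)
  refine ⟨_, ?_, e₀.seq (e₁.seq (e₂.seq ((runs_clear d).seq ((runs_setCtl id 0).congr ?_))))⟩
  · simp [update_of_ne hi.ne]
  · simp [hd0]

theorem lenLe (i j : ι) : Def fun (_ : ℕ) (e : ι → List G) => (e i).length ≤ (e j).length := by
  intro ρ d hρ hd
  refine ⟨.seq (isLe (ρ i) (ρ j) d) (setCtl id 0), 2, fun N B S b m h₀ hι hS hB => ?_⟩
  have hB' : N + 1 < B := by nlinarith
  have li := hι i
  have lj := hι j
  refine ⟨_, ?_, (runs_isLe (hρ i) (hρ j) (hS _ le_rfl) (hS _ (by omega)) (hS _ (by omega))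
    (by omega) (by omega)).seq (runs_setCtl id 0)⟩
  simp

/-- Exhaustive search with the candidate on stack `d`, which becomes one more occupied stack for the
inner program. Mode `1` means that the search goes on, mode `0` that it has ended with the answer in
the flag. -/
theorem ex {P : ℕ → (ι → List G) → List G → Prop}
    (h : Def fun N (e : Option ι → List G) => P N (fun i => e (some i)) (e none)) :
    Def fun N e => ∃ x : List G, x.length ≤ N ∧ P N e x := by
  classical
  intro ρ d hρ hd
  obtain ⟨p, c, hp⟩ := h (fun o => o.elim d ρ) (d + 1)
    (fun o => by
      cases o with
      | none => simp
      | some i => exact (hρ i).trans (Nat.lt_succ_self _)) (Nat.succ_pos _)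
  let body : Prog G := .seq p (.ite (fun v => v.flag) (setCtl id 0)
      (.seq (next d (d + 1)) (.seq (isLe d 0 (d + 1))
        (.ite (fun v => v.flag) (setCtl (fun _ => false) 1) (setCtl (fun _ => false) 0)))))
  let t : Bool → Fin 3 → Bool := fun _ m => decide (m = 1)
  refine ⟨.seq (setCtl (fun _ => false) 1) (.seq (.while (fun v => t v.flag v.mode) body) (clear d)),
    -- The last candidate, which ends an unsuccessful search, has length `N + 1`; the constant `2`
    -- makes room for it.
    max c 2, fun N B S b m h₀ hι hS hB => ?_⟩
  have hB₁ : c * (N + 2) ^ 2 ≤ B := (Nat.mul_le_mul_right _ (le_max_left _ _)).trans hB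
  have hB₂ : N + 1 < B := by
    have : 2 * (N + 2) ^ 2 ≤ B := (Nat.mul_le_mul_right _ (le_max_right _ _)).trans hB
    nlinarith
  let x : ℕ → List G := fun n => nextStr^[n] []
  have hx : ∀ n, nextStr (x n) = x (n + 1) := fun n => by
    simp only [x, Function.iterate_succ_apply']
  -- At step `T` the enumeration has left the words of length at most `N`, so `T - n` measures the
  -- remaining work.
  obtain ⟨T, hT⟩ := exists_iterate_nextStr (List.replicate (N + 1) (default : G))
  have hT' : ∀ n, (x n).length ≤ N → n < T := fun n hn => by
    by_contra hlt
    have := length_iterate_nextStr_mono (G := G) (not_lt.1 hlt)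
    rw [hT] at this
    simp [x] at hn this
    omega
  have hpe : ∀ n (b : Bool) (m : Fin 3), (x n).length ≤ N →
      ∃ b', (b' = true ↔ P N (fun i => S (ρ i)) (x n)) ∧
        Runs (fun _ => B) p b m (update S d (x n)) b' 0 (update S d (x n)) := by
    intro n b m hn
    obtain ⟨b', hb', e⟩ := hp N B (update S d (x n)) b m (by rw [update_of_ne (by omega), h₀])
      (fun o => by
        cases o with
        | none => simpa using hn
        | some i => simpa [update_of_ne (hρ i).ne] using hι i)
      (fun k hk => by rw [update_of_ne (by omega)]; exact hS k (by omega)) hB₁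
    refine ⟨b', ?_, e⟩
    rw [hb']
    simp only [Option.elim, update_self]
    have e : (fun i => update S d (x n) (ρ i)) = fun i => S (ρ i) := by
      funext i
      rw [update_of_ne (hρ i).ne]
    rw [e]
  let E : ℕ → Prop := fun n => ∃ j, n ≤ j ∧ (x j).length ≤ N ∧ P N (fun i => S (ρ i)) (x j)
  have key : ∀ (r n : ℕ), T - n = r → (x n).length ≤ N → ∃ b' y, (b' = true ↔ E n) ∧
      Runs (fun _ => B) (.while (fun v => t v.flag v.mode) body) false 1 (update S d (x n)) b' 0
      (update S d y) := by
    intro r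
    induction r with
    | zero => intro n hr hn; have := hT' n hn; omega
    | succ r ih =>
      intro n hr hn
      obtain ⟨b', hb', e⟩ := hpe n false 1 hn
      cases b' with
      | true =>
        refine ⟨true, x n, by simpa [E] using ⟨n, le_rfl, hn, hb'.1 rfl⟩,
          Runs.while_step t rfl (b₁ := true) (m₁ := 0) (S₁ := update S d (x n)) ?_
            (Runs.while_stop t rfl)⟩
        exact e.seq (Runs.ite_flag (runs_setCtl id 0))
      | false =>
        have hP : ¬ P N (fun i => S (ρ i)) (x n) := by rw [← hb']; simp
        have e₁ : Runs (fun _ => B) (next d (d + 1)) false 0 (update S d (x n)) false 0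
            (update S d (x (n + 1))) := by
          refine (runs_next (by omega) ?_ ?_).congr ?_
          · simpa using hS _ (by omega)
          · simp; omega
          · simp [hx]
        have hl : (x (n + 1)).length ≤ N + 1 := by
          rw [← hx]; exact (length_nextStr_le _).trans (by omega)
        have hne : (0 : ℕ) ≠ d := by omega
        have e₂ : Runs (fun _ => B) (isLe d 0 (d + 1)) false 0 (update S d (x (n + 1)))
            (decide ((x (n + 1)).length ≤ N)) 0 (update S d (x (n + 1))) := by
          have := runs_isLe (B := B) (b := false) (m := 0) (S := update S d (x (n + 1))) (x := d)
            (y := 0) (u := d + 1) (by omega) (by omega) (by rw [update_of_ne (by omega)]; exact hS _ (by omega))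
            (by rw [update_of_ne (by omega)]; exact hS _ (by omega)) (by rw [update_of_ne (by omega)]; exact hS _ (by omega))
            (by simp; omega) (by rw [update_of_ne hne, h₀]; simp; omega)
          simpa [update_of_ne hne, h₀] using this
        by_cases hn' : (x (n + 1)).length ≤ N
        · obtain ⟨b', y, hb', hy⟩ := ih (n + 1) (by omega) hn'
          refine ⟨b', y, hb'.trans ?_, Runs.while_step t rfl (b₁ := false) (m₁ := 1)
            (S₁ := update S d (x (n + 1))) ?_ hy⟩
          · constructor
            · rintro ⟨j, h₁, h₂⟩
              exact ⟨j, by omega, h₂⟩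
            · rintro ⟨j, h₁, h₂, h₃⟩
              rcases h₁.eq_or_lt with rfl | h₁
              · exact absurd h₃ hP
              · exact ⟨j, h₁, h₂, h₃⟩
          · refine e.seq (Runs.ite_flag (e₁.seq (e₂.seq (Runs.ite_flag ?_))))
            simp only [hn', decide_true]
            exact runs_setCtl (fun _ => false) _
        · refine ⟨false, x (n + 1), ?_, Runs.while_step t rfl (b₁ := false) (m₁ := 0)
            (S₁ := update S d (x (n + 1))) ?_ (Runs.while_stop t rfl)⟩
          · simp only [Bool.false_eq_true, false_iff]
            rintro ⟨j, h₁, h₂, h₃⟩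
            rcases h₁.eq_or_lt with rfl | h₁
            · exact hP h₃
            · exact hn' ((length_iterate_nextStr_mono h₁).trans h₂)
          · refine e.seq (Runs.ite_flag (e₁.seq (e₂.seq (Runs.ite_flag ?_))))
            simp only [hn', decide_false]
            exact runs_setCtl (fun _ => false) _
  obtain ⟨b', y, hb', hy⟩ := key _ 0 rfl (by simp [x])
  have hiff : E 0 ↔
      ∃ x : List G, x.length ≤ N ∧ P N (fun i => S (ρ i)) x := by
    constructor
    · rintro ⟨j, -, hj⟩; exact ⟨_, hj⟩
    · rintro ⟨y, hy⟩
      obtain ⟨n, rfl⟩ := exists_iterate_nextStr y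
      exact ⟨n, Nat.zero_le _, hy⟩
  have hS0 : update S d (x 0) = S := by
    rw [update_eq_self_iff]; exact (hS d le_rfl).symm
  rw [hS0] at hy
  refine ⟨b', hb'.trans hiff, (runs_setCtl _ _).seq (hy.seq ((runs_clear d).congr ?_))⟩
  rw [update_idem, update_eq_self_iff]; exact (hS d le_rfl).symm

end Def

end StackProg

/-! ### Savitch's algorithm -/

namespace StackProg

open Function

variable {G : Type}

/-- Reachability through strings of length at most `N`. -/
def TC (N : ℕ) (r : List G → List G → Prop) : List G → List G → Prop :=
  Relation.ReflTransGen fun a b => a.length ≤ N ∧ b.length ≤ N ∧ r a b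

/-- Savitch's recursion: a path of length at most `2 ^ n`. -/
def Sav (N : ℕ) (r : List G → List G → Prop) : ℕ → List G → List G → Prop
  | 0, x, y => x = y ∨ r x y
  | n + 1, x, y => ∃ z : List G, z.length ≤ N ∧ Sav N r n x z ∧ Sav N r n z y

theorem Sav.tc {N : ℕ} {r : List G → List G → Prop} {n : ℕ} {x y : List G} (h : Sav N r n x y)
    (hx : x.length ≤ N) (hy : y.length ≤ N) : TC N r x y := by
  induction n generalizing x y with
  | zero =>
    rcases h with rfl | h
    · exact .refl
    · exact .single ⟨hx, hy, h⟩
  | succ n ih =>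
    obtain ⟨z, hz, h₁, h₂⟩ := h
    exact (ih h₁ hx hz).trans (ih h₂ hz hy)

theorem sav_of_path {N : ℕ} {r : List G → List G → Prop} (n : ℕ) : ∀ (d : ℕ) (f : ℕ → List G),
    (∀ i, i ≤ d → (f i).length ≤ N) → (∀ i, i < d → r (f i) (f (i + 1))) → d ≤ 2 ^ n →
    Sav N r n (f 0) (f d) := by
  induction n with
  | zero =>
    intro d f _ hr hd
    interval_cases d
    · exact Or.inl rfl
    · exact Or.inr (hr 0 Nat.one_pos)
  | succ n ih =>
    intro d f hl hr hd
    rw [pow_succ] at hd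
    -- The midpoint is chosen as far along the path as the first half permits; at most `2 ^ n` steps
    -- remain for the second.
    refine ⟨f (min d (2 ^ n)), hl _ (min_le_left _ _), ?_, ?_⟩
    · exact ih _ f (fun i hi => hl i (hi.trans (min_le_left _ _)))
        (fun i hi => hr i (hi.trans_le (min_le_left _ _))) (min_le_right _ _)
    · have := ih (d - min d (2 ^ n)) (fun i => f (min d (2 ^ n) + i))
        (fun i hi => hl _ (by omega)) (fun i hi => hr _ (by omega)) (by omega)
      simpa [show min d (2 ^ n) + (d - min d (2 ^ n)) = d by omega] using this

theorem exists_path {α : Type} {r : α → α → Prop} {x y : α} (h : Relation.ReflTransGen r x y) :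
    ∃ (d : ℕ) (f : ℕ → α), f 0 = x ∧ f d = y ∧ ∀ i, i < d → r (f i) (f (i + 1)) := by
  induction h using Relation.ReflTransGen.head_induction_on with
  | refl => exact ⟨0, fun _ => y, rfl, rfl, by simp⟩
  | @head a c hac _ ih =>
    obtain ⟨d, f, h₀, hd, hr⟩ := ih
    refine ⟨d + 1, fun i => i.casesOn a f, rfl, hd, ?_⟩
    intro i hi
    cases i with
    | zero => simpa [h₀] using hac
    | succ i => exact hr i (by omega)

/-- A shortest path repeats no vertex, since the segment between two equal vertices could be cut
out. -/
theorem exists_injective_path {α : Type} {r : α → α → Prop} {x y : α}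
    (h : Relation.ReflTransGen r x y) : ∃ (d : ℕ) (f : ℕ → α), f 0 = x ∧ f d = y ∧
      (∀ i, i < d → r (f i) (f (i + 1))) ∧ ∀ i j, i < j → j ≤ d → f i ≠ f j := by
  classical
  have hex := exists_path h
  obtain ⟨f, h₀, hd, hr⟩ := Nat.find_spec hex
  refine ⟨_, f, h₀, hd, hr, fun i j hij hj he => ?_⟩
  set d := Nat.find hex with hdef
  have hmin := Nat.find_min hex (m := d - (j - i)) (by omega)
  refine hmin ⟨fun k => if k ≤ i then f k else f (k + (j - i)), by simpa using h₀, ?_, ?_⟩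
  · by_cases hk : d - (j - i) ≤ i
    · have e₁ : d - (j - i) = i := by omega
      have e₂ : j = d := by omega
      show (if d - (j - i) ≤ i then f (d - (j - i)) else f (d - (j - i) + (j - i))) = y
      rw [if_pos hk, e₁, he, e₂, hd]
    · simp only [if_neg hk, show d - (j - i) + (j - i) = d by omega, hd]
  · intro k hk
    rcases lt_trichotomy k i with h | rfl | h
    · simp only [if_pos h.le, if_pos (show k + 1 ≤ i by omega)]
      exact hr k (by omega)
    · simp only [le_refl, if_true, if_neg (show ¬ k + 1 ≤ k by omega), he]
      rw [show k + 1 + (j - k) = j + 1 by omega]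
      exact hr j (by omega)
    · simp only [if_neg (show ¬ k ≤ i by omega), if_neg (show ¬ k + 1 ≤ i by omega)]
      rw [show k + 1 + (j - i) = k + (j - i) + 1 by omega]
      exact hr _ (by omega)

/-- A path without repetitions has at most as many vertices as there are words of length at most
`N`. Their number is at most `(card G + 1) ^ N ≤ 2 ^ (card G * N)`, which gives the depth of the
recursion. -/
theorem tc_iff_sav [Fintype G] {N : ℕ} {r : List G → List G → Prop} {x y : List G}
    (hx : x.length ≤ N) (hy : y.length ≤ N) : TC N r x y ↔ Sav N r (Fintype.card G * N) x y := by
  refine ⟨fun h => ?_, fun h => h.tc hx hy⟩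
  obtain ⟨d, f, h₀, hd, hr, hinj⟩ := exists_injective_path h
  have hl : ∀ i, i ≤ d → (f i).length ≤ N := by
    intro i hi
    rcases hi.eq_or_lt with rfl | hi
    · rwa [hd]
    · exact (hr i hi).1
  have hcard : d + 1 ≤ (Fintype.card G + 1) ^ N := by
    -- Words of length at most `N` are padded with `none` to functions on `Fin N`, and these are
    -- easily counted.
    let g : Fin (d + 1) → (Fin N → Option G) := fun i j => (f i)[(j : ℕ)]?
    have hg : Injective g := by
      intro i j hij
      have : f i = f j := by
        apply List.ext_getElem?
        intro n
        by_cases hn : n < N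
        · exact congrFun hij ⟨n, hn⟩
        · have h₁ := hl i (by omega)
          have h₂ := hl j (by omega)
          rw [List.getElem?_eq_none (by omega), List.getElem?_eq_none (by omega)]
      by_contra hne
      rcases lt_or_gt_of_ne hne with hlt | hlt
      · exact hinj i j hlt (by omega) this
      · exact hinj j i hlt (by omega) this.symm
    simpa using Fintype.card_le_of_injective g hg
  have hpow : (Fintype.card G + 1) ^ N ≤ 2 ^ (Fintype.card G * N) := by
    rw [pow_mul]
    exact Nat.pow_le_pow_left (Nat.lt_two_pow_self) N
  have := sav_of_path (r := r) (Fintype.card G * N) d f hl (fun i hi => (hr i hi).2.2) (by omega)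
  rwa [h₀, hd] at this

/-- The stacks `S` below `d` and the stacks `l` from `d` on. -/
def above (S : Stacks G) (d : ℕ) (l : List (List G)) : Stacks G :=
  fun k => if k < d then S k else l.getD (k - d) []

section above
variable {S : Stacks G} {d : ℕ} {l : List (List G)}

theorem above_lt {k : ℕ} (h : k < d) : above S d l k = S k := if_pos h

theorem above_add (i : ℕ) : above S d l (d + i) = l.getD i [] := by
  simp [above]

theorem update_above {i : ℕ} (hi : i < l.length) (x : List G) :
    update (above S d l) (d + i) x = above S d (l.set i x) := by
  funext k
  by_cases hk : k = d + i
  · subst hk; simp [above, hi]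
  · rw [update_of_ne hk]
    by_cases hkd : k < d
    · simp [above, hkd]
    · have : i ≠ k - d := by omega
      simp [above, hkd, List.getElem?_set_ne this]

end above

section savitch

variable [Fintype G] [DecidableEq G] [Inhabited G] (one zero : G) (d : ℕ) (p : Prog G)

/-- Set the flag according to whether stack `k` is nonempty, and pop it. -/
def testPop (k : ℕ) : Prog G := .pop k fun v o => { v with flag := o.isSome }

theorem runs_testPop {s : ℕ → ℕ} {b : Bool} {m : Fin 3} {S : Stacks G} (k : ℕ) :
    Runs s (testPop k) b m S (S k).head?.isSome m (update S k (S k).tail) :=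
  fun v _ hm => ⟨{ v with flag := (S k).head?.isSome }, rfl, hm, .pop⟩

/-- The mode that a phase symbol stands for. -/
def phaseMode : Option G → Fin 3
  | none => 2
  | some a => if a = one then 1 else 0

/-- Pop a phase symbol from stack `k` and set the mode accordingly. -/
def popPhase (k : ℕ) : Prog G := .pop k fun v o => { v with mode := phaseMode one o }

theorem runs_popPhase {s : ℕ → ℕ} {b : Bool} {m : Fin 3} {S : Stacks G} (k : ℕ) :
    Runs s (popPhase one k) b m S b (phaseMode one (S k).head?) (update S k (S k).tail) :=
  fun v hb _ => ⟨{ v with mode := phaseMode one (S k).head? }, hb, rfl, .pop⟩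

/-- Layout: the stacks `d`, `d + 1`, `d + 2` hold source, target and current midpoint, `d + 3` the
level in unary, `d + 4` to `d + 6` the suspended sources, targets and midpoints, `d + 7` their
phases. The stacks from `d + 8` on are scratch. -/
def savPush (a : G) : Prog G :=
  .seq (pushFrame one zero (d + 0) (d + 4) (d + 8)) (.seq (pushFrame one zero (d + 1) (d + 5) (d + 8))
    (.seq (pushFrame one zero (d + 2) (d + 6) (d + 8)) (pushC (d + 7) a)))

def savPop : Prog G :=
  .seq (popFrame one (d + 4) (d + 0) (d + 8)) (.seq (popFrame one (d + 5) (d + 1) (d + 8))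
    (popFrame one (d + 6) (d + 2) (d + 8)))

/-- Start the evaluation of the first (`k = 1`) or second (`k = 0`) half. -/
def savEnter (k : ℕ) (a : G) : Prog G :=
  .seq (savPush one zero d a) (.seq (clear (d + k)) (.seq (copy (d + 2) (d + k) (d + 8))
    (.seq (clear (d + 2)) (setCtl id 0))))

def savClear (b : Bool) : Prog G :=
  .seq (clear (d + 0)) (.seq (clear (d + 1)) (.seq (clear (d + 2)) (setCtl (fun _ => b) 1)))

/-- Leaving a query gives back the unit of level that `testPop` removed when the query was entered.
-/
def savFinish (b : Bool) : Prog G := .seq (pushC (d + 3) default) (savClear d b)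

def savLeaf : Prog G :=
  .seq (isEq (d + 0) (d + 1) (d + 8)) (.seq (.ite (fun v => v.flag) (setCtl id 0) p)
    (.ite (fun v => v.flag) (savClear d true) (savClear d false)))

noncomputable def savAdvance : Prog G :=
  .seq (next (d + 2) (d + 8)) (.seq (isLe (d + 2) 0 (d + 8))
    (.ite (fun v => v.flag) (savEnter one zero d 1 one) (savFinish d false)))

/-- At the head of the loop, mode `0` asks to evaluate the current query, mode `1` to return the
flag to the topmost frame, and mode `2` to stop. Inside the returning branch the mode is reused for
the popped phase: `1` if the first half was being evaluated, `0` if the second, and `2` if no frame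
is left. -/
noncomputable def savBody : Prog G :=
  .ite (fun v => decide (v.mode = 0))
    (.seq (testPop (d + 3)) (.ite (fun v => v.flag) (savEnter one zero d 1 one) (savLeaf d p)))
    (.seq (popPhase one (d + 7)) (.ite (fun v => decide (v.mode = 2)) (setCtl id 2)
      (.seq (savPop one d) (.ite (fun v => v.flag)
        (.ite (fun v => decide (v.mode = 1)) (savEnter one zero d 0 zero) (savFinish d true))
        (savAdvance one zero d)))))

/-- The stacks of Savitch's algorithm: the current query, the midpoint, the level and the frames. -/
def savState (S : Stacks G) (x y z : List G) (n : ℕ) (fs : List (List G × List G × List G × G)) :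
    Stacks G :=
  above S d [x, y, z, List.replicate n default, fs.flatMap fun f => frame one zero f.1,
    fs.flatMap fun f => frame one zero f.2.1, fs.flatMap fun f => frame one zero f.2.2.1,
    fs.map fun f => f.2.2.2, []]

/-- Bounds under which the stacks stay small. -/
structure SavBound (N K B : ℕ) (S : Stacks G) : Prop where
  pos : 0 < d
  le : K * (2 * N + 1) + 2 * N + 3 ≤ B
  unary : S 0 = List.replicate N default

/-- The frames hold strings of length at most `N`. -/
def SmallFrames (N : ℕ) (fs : List (List G × List G × List G × G)) : Prop :=
  ∀ f ∈ fs, f.1.length ≤ N ∧ f.2.1.length ≤ N ∧ f.2.2.1.length ≤ N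

theorem length_frames_le {N : ℕ} {fs : List (List G × List G × List G × G)}
    (g : List G × List G × List G × G → List G) (h : ∀ f ∈ fs, (g f).length ≤ N) :
    (fs.flatMap fun f => frame one zero (g f)).length ≤ fs.length * (2 * N + 1) := by
  induction fs with
  | nil => simp
  | cons f fs ih =>
    have h₁ := h f (by simp)
    have h₂ := ih fun f hf => h f (by simp [hf])
    have h₃ : (fs.length + 1) * (2 * N + 1) = fs.length * (2 * N + 1) + (2 * N + 1) := by ring
    simp only [List.flatMap_cons, List.length_append, length_frame, List.length_cons]
    omega

variable {one zero d p}
variable {N K B : ℕ} {S : Stacks G} (hb : SavBound d N K B S)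
  {x y z : List G} {n : ℕ} {fs : List (List G × List G × List G × G)} {b b₀ : Bool} {m : Fin 3} {S' : Stacks G}

include hb in
theorem runs_savPush (hK : fs.length < K) (hx : x.length ≤ N) (hy : y.length ≤ N)
    (hz : z.length ≤ N) (hfs : SmallFrames N fs) (a : G) :
    Runs (fun _ => B) (savPush one zero d a) b m (savState one zero d S x y z n fs) b m
      (savState one zero d S x y z n ((x, y, z, a) :: fs)) := by
  have hle := hb.le
  have hK' : (fs.length + 1) * (2 * N + 1) ≤ K * (2 * N + 1) := Nat.mul_le_mul_right _ hK
  rw [Nat.succ_mul] at hK'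
  have h₁ := length_frames_le one zero (fun f => f.1) (fun f hf => (hfs f hf).1)
  have h₂ := length_frames_le one zero (fun f => f.2.1) (fun f hf => (hfs f hf).2.1)
  have h₃ := length_frames_le one zero (fun f => f.2.2.1) (fun f hf => (hfs f hf).2.2)
  have h₄ : fs.length ≤ fs.length * (2 * N + 1) := Nat.le_mul_of_pos_right _ (by omega)
  unfold savState
  refine (Runs.seq (runs_pushFrame one zero (by omega) (by omega) (by omega) ?_ ?_)
    (Runs.seq (runs_pushFrame one zero (by omega) (by omega) (by omega) ?_ ?_)
    (Runs.seq (runs_pushFrame one zero (by omega) (by omega) (by omega) ?_ ?_) (runs_pushC ?_)))).congr ?_ <;>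
    simp only [above_add, update_above, List.length_cons, List.length_nil, Nat.reduceAdd, Nat.reduceLT,
      List.set_cons_zero, List.set_cons_succ, List.getD_cons_zero, List.getD_cons_succ,
      List.flatMap_cons, List.map_cons, List.length_map] <;> omega

theorem runs_savPop (h01 : zero ≠ one) {a : G} {l : ℕ} (hB : N ≤ B) (hx : x.length ≤ N) (hy : y.length ≤ N)
    (hz : z.length ≤ N) :
    Runs (fun _ => B) (savPop one d) b m (above S d [[], [], [], List.replicate l default,
      ((x, y, z, a) :: fs).flatMap fun f => frame one zero f.1,
      ((x, y, z, a) :: fs).flatMap fun f => frame one zero f.2.1,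
      ((x, y, z, a) :: fs).flatMap fun f => frame one zero f.2.2.1,
      fs.map fun f => f.2.2.2, []]) b m (savState one zero d S x y z l fs) := by
  have hx' := hx.trans hB
  have hy' := hy.trans hB
  have hz' := hz.trans hB
  unfold savState
  refine (Runs.seq (runs_popFrame one zero (x := x) (r := fs.flatMap fun f => frame one zero f.1)
      h01 (by omega) (by omega) (by omega) ?_ ?_ ?_ ?_)
    (Runs.seq (runs_popFrame one zero (x := y) (r := fs.flatMap fun f => frame one zero f.2.1)
      h01 (by omega) (by omega) (by omega) ?_ ?_ ?_ ?_)
    (runs_popFrame one zero (x := z) (r := fs.flatMap fun f => frame one zero f.2.2.1)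
      h01 (by omega) (by omega) (by omega) ?_ ?_ ?_ ?_))).congr ?_ <;>
    first | assumption | simp only [above_add, update_above, List.length_cons, List.length_nil, Nat.reduceAdd, Nat.reduceLT,
      List.set_cons_zero, List.set_cons_succ, List.getD_cons_zero, List.getD_cons_succ,
      List.flatMap_cons]

include hb in
theorem runs_savEnter_one (hK : fs.length < K) (hx : x.length ≤ N) (hy : y.length ≤ N)
    (hz : z.length ≤ N) (hfs : SmallFrames N fs) (a : G) :
    Runs (fun _ => B) (savEnter one zero d 1 a) b m (savState one zero d S x y z n fs) b 0
      (savState one zero d S x z [] n ((x, y, z, a) :: fs)) := by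
  have hle := hb.le
  refine (runs_savPush hb hK hx hy hz hfs a).seq ?_
  unfold savState
  refine (Runs.seq (runs_clear _) (Runs.seq (runs_copy (by omega) (by omega) (by omega) ?_ ?_ ?_ ?_)
    (Runs.seq (runs_clear _) (runs_setCtl id 0)))).congr ?_ <;>
    simp only [above_add, update_above, List.length_cons, List.length_nil, Nat.reduceAdd, Nat.reduceLT,
      List.set_cons_zero, List.set_cons_succ, List.getD_cons_zero, List.getD_cons_succ,
      List.flatMap_cons, List.map_cons, List.append_nil] <;> omega

include hb in
theorem runs_savEnter_zero (hK : fs.length < K) (hx : x.length ≤ N) (hy : y.length ≤ N)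
    (hz : z.length ≤ N) (hfs : SmallFrames N fs) (a : G) :
    Runs (fun _ => B) (savEnter one zero d 0 a) b m (savState one zero d S x y z n fs) b 0
      (savState one zero d S z y [] n ((x, y, z, a) :: fs)) := by
  have hle := hb.le
  refine (runs_savPush hb hK hx hy hz hfs a).seq ?_
  unfold savState
  refine (Runs.seq (runs_clear _) (Runs.seq (runs_copy (by omega) (by omega) (by omega) ?_ ?_ ?_ ?_)
    (Runs.seq (runs_clear _) (runs_setCtl id 0)))).congr ?_ <;>
    simp only [above_add, update_above, List.length_cons, List.length_nil, Nat.reduceAdd, Nat.reduceLT,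
      List.set_cons_zero, List.set_cons_succ, List.getD_cons_zero, List.getD_cons_succ,
      List.flatMap_cons, List.map_cons, List.append_nil] <;> omega

theorem runs_savClear {s : ℕ → ℕ} (b' : Bool) :
    Runs s (savClear d b') b m (savState one zero d S x y z n fs) b' 1
      (savState one zero d S [] [] [] n fs) := by
  unfold savState
  refine (Runs.seq (runs_clear _) (Runs.seq (runs_clear _) (Runs.seq (runs_clear _)
    (runs_setCtl (fun _ => b') 1)))).congr ?_
  simp only [update_above, List.length_cons, List.length_nil, Nat.reduceAdd, Nat.reduceLT,
      List.set_cons_zero, List.set_cons_succ]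

theorem runs_savFinish (hn : n < B) (b' : Bool) :
    Runs (fun _ => B) (savFinish d b') b m (savState one zero d S x y z n fs) b' 1
      (savState one zero d S [] [] [] (n + 1) fs) := by
  refine Runs.seq (b₁ := b) (m₁ := m) (S₁ := savState one zero d S x y z (n + 1) fs)
    ((runs_pushC ?_).congr ?_) (runs_savClear b') <;> unfold savState <;>
    simp only [above_add, update_above, List.length_cons, List.length_nil, Nat.reduceAdd, Nat.reduceLT,
      List.set_cons_zero, List.set_cons_succ, List.getD_cons_zero, List.getD_cons_succ,
      List.length_replicate, List.replicate_succ]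
  omega

include hb in
theorem runs_savAdvance (hK : fs.length < K) (hKB : K < B) (hn : n < K) (hx : x.length ≤ N) (hy : y.length ≤ N)
    (hz : z.length ≤ N) (hfs : SmallFrames N fs) :
    if (nextStr z).length ≤ N then
      Runs (fun _ => B) (savAdvance one zero d) b m (savState one zero d S x y z n fs) true 0
        (savState one zero d S x (nextStr z) [] n ((x, y, nextStr z, one) :: fs))
    else Runs (fun _ => B) (savAdvance one zero d) b m (savState one zero d S x y z n fs) false 1
        (savState one zero d S [] [] [] (n + 1) fs) := by
  have hle := hb.le
  have hlen := length_nextStr_le z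
  have hd := hb.pos
  have e₁ : Runs (fun _ => B) (next (d + 2) (d + 8)) b m (savState one zero d S x y z n fs) b m
      (savState one zero d S x y (nextStr z) n fs) := by
    unfold savState
    refine (runs_next (by omega) ?_ ?_).congr ?_ <;>
    simp only [above_add, update_above, List.length_cons, List.length_nil, Nat.reduceAdd, Nat.reduceLT,
      List.set_cons_zero, List.set_cons_succ, List.getD_cons_zero, List.getD_cons_succ]
    omega
  have e₂ : Runs (fun _ => B) (isLe (d + 2) 0 (d + 8)) b m (savState one zero d S x y (nextStr z) n fs)
      (decide ((nextStr z).length ≤ N)) m (savState one zero d S x y (nextStr z) n fs) := by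
    unfold savState
    have := runs_isLe (B := B) (b := b) (m := m) (S := savState one zero d S x y (nextStr z) n fs)
      (x := d + 2) (y := 0) (u := d + 8) (by omega) (by omega)
    unfold savState at this
    simp only [above_add, List.getD_cons_zero, List.getD_cons_succ, above_lt hd,
      hb.unary, List.length_replicate, add_assoc, Nat.reduceAdd, List.getD_nil] at this
    exact this trivial trivial trivial (by omega) (by omega)
  split_ifs with h
  · refine e₁.seq (e₂.seq (Runs.ite_flag ?_))
    simp only [h, decide_true]
    exact runs_savEnter_one hb hK hx hy h hfs one
  · refine e₁.seq (e₂.seq (Runs.ite_flag ?_))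
    simp only [h, decide_false]
    exact runs_savFinish (by omega) false

theorem runs_savBody_zero (h : Runs (fun _ => B) (savLeaf d p) false 0
    (savState one zero d S x y z 0 fs) b m S') :
    Runs (fun _ => B) (savBody one zero d p) b₀ 0 (savState one zero d S x y z 0 fs) b m S' := by
  refine Runs.ite_mode (fun m => decide (m = 0)) (Runs.seq ((runs_testPop _).congr (S₂ :=
    savState one zero d S x y z 0 fs) ?_) (Runs.ite_flag ?_))
  · unfold savState
    simp only [above_add, update_above, List.length_cons, List.length_nil, Nat.reduceAdd, Nat.reduceLT,
      List.set_cons_zero, List.set_cons_succ, List.getD_cons_zero, List.getD_cons_succ,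
      List.replicate_zero, List.tail_nil]
  · unfold savState at h ⊢
    simpa only [above_add, List.getD_cons_zero, List.getD_cons_succ, List.replicate_zero,
      List.head?_nil, Option.isSome_none, cond_false] using h

theorem runs_savBody_succ (h : Runs (fun _ => B) (savEnter one zero d 1 one) true 0
    (savState one zero d S x y z n fs) b m S') :
    Runs (fun _ => B) (savBody one zero d p) b₀ 0 (savState one zero d S x y z (n + 1) fs) b m S' := by
  refine Runs.ite_mode (fun m => decide (m = 0)) (Runs.seq ((runs_testPop _).congr (S₂ :=
    savState one zero d S x y z n fs) ?_) (Runs.ite_flag ?_))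
  · unfold savState
    simp only [above_add, update_above, List.length_cons, List.length_nil, Nat.reduceAdd, Nat.reduceLT,
      List.set_cons_zero, List.set_cons_succ, List.getD_cons_zero, List.getD_cons_succ,
      List.replicate_succ, List.tail_cons]
  · unfold savState at h ⊢
    simpa only [above_add, List.getD_cons_zero, List.getD_cons_succ, List.replicate_succ,
      List.head?_cons, Option.isSome_some, cond_true] using h

theorem runs_savBody_return (h01 : zero ≠ one) (hB : N ≤ B) {a : G} (hx : x.length ≤ N)
    (hy : y.length ≤ N) (hz : z.length ≤ N)
    (h : Runs (fun _ => B) (.ite (fun v => v.flag)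
        (.ite (fun v => decide (v.mode = 1)) (savEnter one zero d 0 zero) (savFinish d true))
        (savAdvance one zero d)) b₀ (phaseMode one (some a)) (savState one zero d S x y z n fs) b m S') :
    Runs (fun _ => B) (savBody one zero d p) b₀ 1
      (savState one zero d S [] [] [] n ((x, y, z, a) :: fs)) b m S' := by
  refine Runs.ite_mode (fun m => decide (m = 0)) (Runs.seq (runs_popPhase one _)
    (Runs.ite_mode (fun m => decide (m = 2)) ?_))
  unfold savState at h ⊢
  simp only [above_add, update_above, List.length_cons, List.length_nil, Nat.reduceAdd, Nat.reduceLT,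
      List.set_cons_zero, List.set_cons_succ, List.getD_cons_zero, List.getD_cons_succ,
      List.map_cons, List.head?_cons, List.tail_cons]
  have hm : decide (phaseMode one (some a) = 2) = false := by
    simp only [phaseMode]; split_ifs <;> rfl
  rw [hm]
  exact (runs_savPop h01 hB hx hy hz).seq h

theorem runs_savBody_done :
    Runs (fun _ => B) (savBody one zero d p) b 1 (savState one zero d S [] [] [] n []) b 2
      (savState one zero d S [] [] [] n []) := by
  refine Runs.ite_mode (fun m => decide (m = 0)) (Runs.seq ((runs_popPhase one _).congr (S₂ :=
    savState one zero d S [] [] [] n []) ?_) (Runs.ite_mode (fun m => decide (m = 2)) ?_))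
  · unfold savState
    simp only [above_add, update_above, List.length_cons, List.length_nil, Nat.reduceAdd, Nat.reduceLT,
      List.set_cons_zero, List.set_cons_succ, List.getD_cons_zero, List.getD_cons_succ,
      List.map_nil, List.tail_nil, List.flatMap_nil]
  · unfold savState
    simp only [above_add, List.getD_cons_zero, List.getD_cons_succ, List.map_nil, List.head?_nil,
      phaseMode, decide_true, cond_true]
    exact runs_setCtl id 2

-- The statement is in continuation style: whatever the loop does after the value of the query has
-- been returned, it does from the beginning of the query. Thus the evaluations of the two halves
-- compose without counting iterations. The inner induction `key` runs through the midpoints that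
-- remain to be tried. The invariant `fs.length + n ≤ K` limits the number of frames.
include hb in
theorem savitch_loop (h01 : zero ≠ one) (hKB : K < B) {r : List G → List G → Prop}
    (hleaf : ∀ x y : List G, x.length ≤ N → y.length ≤ N → ∀ b fs, ∃ b', (b' = true ↔ x = y ∨ r x y) ∧
      Runs (fun _ => B) (savLeaf d p) b 0 (savState one zero d S x y [] 0 fs) b' 1
        (savState one zero d S [] [] [] 0 fs)) :
    ∀ (n : ℕ) (x y : List G) fs b, x.length ≤ N → y.length ≤ N → SmallFrames N fs →
      fs.length + n ≤ K → ∃ b', (b' = true ↔ Sav N r n x y) ∧ ∀ bf mf Sf,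
        Runs (fun _ => B) (.while (fun v => decide (v.mode ≠ 2)) (savBody one zero d p)) b' 1
          (savState one zero d S [] [] [] n fs) bf mf Sf →
        Runs (fun _ => B) (.while (fun v => decide (v.mode ≠ 2)) (savBody one zero d p)) b 0
          (savState one zero d S x y [] n fs) bf mf Sf := by
  have hle := hb.le
  let t : Bool → Fin 3 → Bool := fun _ m => decide (m ≠ 2)
  intro n
  induction n with
  | zero =>
    intro x y fs b hx hy hfs hK
    obtain ⟨b', hb', e⟩ := hleaf x y hx hy false fs
    exact ⟨b', hb', fun bf mf Sf h => Runs.while_step t rfl (runs_savBody_zero e) h⟩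
  | succ n ih =>
    intro x y fs b hx hy hfs hK
    have hK' : fs.length < K := by omega
    obtain ⟨T, hT⟩ := exists_iterate_nextStr (List.replicate (N + 1) (default : G))
    let z : ℕ → List G := fun n => nextStr^[n] []
    have hz : ∀ n, nextStr (z n) = z (n + 1) := fun n => by
      simp only [z, Function.iterate_succ_apply']
    have hT' : ∀ n, (z n).length ≤ N → n < T := fun n hn => by
      by_contra hlt
      have := length_iterate_nextStr_mono (G := G) (not_lt.1 hlt)
      rw [hT] at this
      simp [z] at hn this
      omega
    have hfs' : ∀ (z : List G) (a : G), z.length ≤ N → SmallFrames N ((x, y, z, a) :: fs) := by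
      intro z a hz f hf
      rcases List.mem_cons.1 hf with rfl | hf
      · exact ⟨hx, hy, hz⟩
      · exact hfs f hf
    let E : ℕ → Prop := fun i => ∃ j, i ≤ j ∧ (z j).length ≤ N ∧ Sav N r n x (z j) ∧ Sav N r n (z j) y
    have key : ∀ (q i : ℕ) (b : Bool), T - i = q → (z i).length ≤ N → ∃ b', (b' = true ↔ E i) ∧
        ∀ bf mf Sf,
        Runs (fun _ => B) (.while (fun v => decide (v.mode ≠ 2)) (savBody one zero d p)) b' 1
          (savState one zero d S [] [] [] (n + 1) fs) bf mf Sf →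
        Runs (fun _ => B) (.while (fun v => decide (v.mode ≠ 2)) (savBody one zero d p)) b 0
          (savState one zero d S x (z i) [] n ((x, y, z i, one) :: fs)) bf mf Sf := by
      intro q
      induction q with
      | zero => intro i b hq hi; have := hT' i hi; omega
      | succ q ihq =>
        intro i b hq hi
        have hq' : T - (i + 1) = q := by rw [Nat.sub_add_eq, hq]; rfl
        have hadv : ∀ (b₀ : Bool) (a : G), ¬ (Sav N r n x (z i) ∧ Sav N r n (z i) y) →
            ∃ b', (b' = true ↔ E i) ∧ ∀ bf mf Sf,
            Runs (fun _ => B) (.while (fun v => decide (v.mode ≠ 2)) (savBody one zero d p)) b' 1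
              (savState one zero d S [] [] [] (n + 1) fs) bf mf Sf →
            Runs (fun _ => B) (.while (fun v => decide (v.mode ≠ 2)) (savBody one zero d p)) false 1
              (savState one zero d S [] [] [] n ((x, y, z i, a) :: fs)) bf mf Sf := by
          intro b₀ a hno
          have hE : E i ↔ E (i + 1) := by
            constructor
            · rintro ⟨j, h₁, h₂, h₃⟩
              rcases h₁.eq_or_lt with rfl | h₁
              · exact absurd h₃ hno
              · exact ⟨j, h₁, h₂, h₃⟩
            · rintro ⟨j, h₁, h₂⟩
              exact ⟨j, by omega, h₂⟩
          have had := runs_savAdvance hb (one := one) (zero := zero) (b := false)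
            (m := phaseMode one (some a)) hK' hKB (show n < K by omega) hx hy hi hfs
          rw [hz] at had
          by_cases hn : (z (i + 1)).length ≤ N
          · rw [if_pos hn] at had
            obtain ⟨b', hb', h⟩ := ihq (i + 1) true hq' hn
            refine ⟨b', hb'.trans hE.symm, fun bf mf Sf hf => Runs.while_step t rfl
              (runs_savBody_return h01 (by omega) hx hy hi (Runs.ite_flag ?_)) (h bf mf Sf hf)⟩
            exact had
          · rw [if_neg hn] at had
            refine ⟨false, ?_, fun bf mf Sf hf => Runs.while_step t rfl
              (runs_savBody_return h01 (by omega) hx hy hi (Runs.ite_flag ?_)) hf⟩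
            · simp only [Bool.false_eq_true, false_iff, hE]
              rintro ⟨j, h₁, h₂, -⟩
              exact hn ((length_iterate_nextStr_mono h₁).trans h₂)
            · exact had
        obtain ⟨b₁, hb₁, h₁⟩ := ih x (z i) ((x, y, z i, one) :: fs) b hx hi (hfs' _ _ hi)
          (by simp; omega)
        cases b₁ with
        | false =>
          obtain ⟨b', hb', h⟩ := hadv false one (fun h => by simpa using hb₁.2 h.1)
          exact ⟨b', hb', fun bf mf Sf hf => h₁ _ _ _ (h _ _ _ hf)⟩
        | true =>
          obtain ⟨b₂, hb₂, h₂⟩ := ih (z i) y ((x, y, z i, zero) :: fs) true hi hy (hfs' _ _ hi)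
            (by simp; omega)
          have hstep : ∀ bf mf Sf,
              Runs (fun _ => B) (.while (fun v => decide (v.mode ≠ 2)) (savBody one zero d p)) b₂ 1
                (savState one zero d S [] [] [] n ((x, y, z i, zero) :: fs)) bf mf Sf →
              Runs (fun _ => B) (.while (fun v => decide (v.mode ≠ 2)) (savBody one zero d p)) b 0
                (savState one zero d S x (z i) [] n ((x, y, z i, one) :: fs)) bf mf Sf := by
            intro bf mf Sf hf
            refine h₁ _ _ _ (Runs.while_step t rfl (runs_savBody_return h01 (by omega) hx hy hi
              (Runs.ite_flag (Runs.ite_mode (fun m => decide (m = 1)) ?_))) (h₂ _ _ _ hf))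
            simp only [phaseMode, if_true, decide_true, cond_true]
            exact runs_savEnter_zero hb hK' hx hy hi hfs zero
          cases b₂ with
          | false =>
            obtain ⟨b', hb', h⟩ := hadv false zero (fun h => by simpa using hb₂.2 h.2)
            exact ⟨b', hb', fun bf mf Sf hf => hstep _ _ _ (h _ _ _ hf)⟩
          | true =>
            refine ⟨true, ?_, fun bf mf Sf hf => hstep _ _ _ (Runs.while_step t rfl
              (runs_savBody_return h01 (by omega) hx hy hi
                (Runs.ite_flag (Runs.ite_mode (fun m => decide (m = 1)) ?_))) hf)⟩
            · simp only [true_iff]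
              exact ⟨i, le_rfl, hi, hb₁.1 rfl, hb₂.1 rfl⟩
            · simp only [phaseMode, if_neg h01]
              exact runs_savFinish (by omega) true
    obtain ⟨b', hb', h⟩ := key _ 0 true rfl (by simp [z])
    refine ⟨b', hb'.trans ?_, fun bf mf Sf hf => Runs.while_step t rfl
      (runs_savBody_succ (runs_savEnter_one hb hK' hx hy (by simp) hfs one)) (h _ _ _ hf)⟩
    constructor
    · rintro ⟨j, -, hj⟩; exact ⟨_, hj⟩
    · rintro ⟨w, hw⟩
      obtain ⟨j, rfl⟩ := exists_iterate_nextStr w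
      exact ⟨j, Nat.zero_le _, hw⟩

end savitch

namespace Def

variable [Fintype G] [DecidableEq G] [Inhabited G] {ι : Type}

/-- Push `k` copies of stack `x` on stack `t`, with scratch stack `u`. -/
def copies (x t u : ℕ) : ℕ → Prog G
  | 0 => setCtl id 0
  | k + 1 => .seq (copy x t u) (copies x t u k)

theorem runs_copies {x t u N B : ℕ} (hxt : x ≠ t) (hxu : x ≠ u) (htu : t ≠ u) (k : ℕ) :
    ∀ (b : Bool) (m : Fin 3) (S : Stacks G) (n : ℕ), S x = List.replicate N default → S u = [] →
      S t = List.replicate n default → N ≤ B → k * N + n ≤ B →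
      Runs (fun _ => B) (copies x t u k) b m S b 0
        (update S t (List.replicate (k * N + n) default)) := by
  induction k with
  | zero =>
    intro b m S n hx hu ht _ _
    exact (runs_setCtl id 0).congr (by simp [← ht])
  | succ k ih =>
    intro b m S n hx hu ht hN hB
    have e : (k + 1) * N = k * N + N := Nat.succ_mul k N
    refine Runs.seq (runs_copy hxt hxu htu hu ?_ ?_ ?_) ((ih b m _ (N + n) ?_ ?_ ?_ hN ?_).congr ?_)
    · rw [hx, ht]; simp; omega
    · rw [hx]; simpa using hN
    · rw [hx]; simpa using hN
    · rw [update_of_ne hxt, hx]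
    · rw [update_of_ne htu.symm, hu]
    · rw [update_self, hx, ht, List.replicate_append_replicate]
    · omega
    · rw [update_idem, e, add_assoc]

/-- Savitch's theorem. There are at most `card G * N` frames of `O(N)` symbols each, which is where
quadratic space comes from. Two distinct letters are needed to delimit frames and to record phases.
-/
theorem tc [Nontrivial G] {R : ℕ → (ι → List G) → List G → List G → Prop} (i j : ι)
    (h : Def fun N (e : Option (Option ι) → List G) =>
      R N (fun i => e (some (some i))) (e (some none)) (e none)) :
    Def fun N e => TC N (R N e) (e i) (e j) := by
  obtain ⟨one, zero, h10⟩ := exists_pair_ne G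
  have h01 : zero ≠ one := h10.symm
  intro ρ d hρ hd
  -- The program for one step finds its arguments on the stacks `d` and `d + 1`. It must leave the
  -- stacks of the recursion alone, so its free space begins at `d + 8`.
  obtain ⟨p, c, hp⟩ := h (fun o => o.elim (d + 1) fun o => o.elim d ρ) (d + 8)
    (fun o => by
      rcases o with - | - | i
      · simp
      · simp
      · have := hρ i; simp only [Option.elim]; omega) (by omega)
  let g := Fintype.card G
  have hg : 0 < g := Fintype.card_pos
  refine ⟨.seq (copy (ρ i) (d + 0) (d + 8)) (.seq (copy (ρ j) (d + 1) (d + 8))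
    (.seq (copies 0 (d + 3) (d + 8) g) (.seq (.while (fun v => decide (v.mode ≠ 2))
      (savBody one zero d p)) (.seq (clear (d + 3)) (setCtl id 0))))), c + 2 * g + 4,
    fun N B S b m h₀ hι hS hB => ?_⟩
  have hB₁ : c * (N + 2) ^ 2 ≤ B := le_trans (Nat.mul_le_mul_right _ (by omega)) hB
  have hB₂ : (g * N) * (2 * N + 1) + 2 * N + 3 ≤ B := by nlinarith
  have hgN : g * N < B := by nlinarith
  have hb : SavBound d N (g * N) B S := ⟨hd, hB₂, h₀⟩
  have hS0 : S = above S d [[], [], [], [], [], [], [], [], []] := by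
    funext k
    by_cases hk : k < d
    · rw [above_lt hk]
    · obtain ⟨r, rfl⟩ := Nat.exists_eq_add_of_le (not_lt.1 hk)
      rw [above_add, hS _ (by omega)]
      rcases r with _ | _ | _ | _ | _ | _ | _ | _ | _ | r <;> rfl
  have hi := hρ i
  have hj := hρ j
  have li := hι i
  have lj := hι j
  set x := S (ρ i)
  set y := S (ρ j)
  have hSx : S (ρ i) = x := rfl
  have hSy : S (ρ j) = y := rfl
  have hinit : Runs (fun _ => B) (.seq (copy (ρ i) (d + 0) (d + 8)) (.seq (copy (ρ j) (d + 1) (d + 8))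
      (copies 0 (d + 3) (d + 8) g))) b m S b 0 (savState one zero d S x y [] (g * N) []) := by
    conv => enter [5]; rw [hS0]
    unfold savState
    refine (Runs.seq (runs_copy (by omega) (by omega) (by omega) ?_ ?_ ?_ ?_) (Runs.seq
      (runs_copy (by omega) (by omega) (by omega) ?_ ?_ ?_ ?_) (runs_copies (N := N) (by omega) (by omega)
        (by omega) g b m _ 0 ?_ ?_ ?_ ?_ ?_))).congr ?_ <;>
    first | omega | (simp only [above_add, update_above, above_lt hi, above_lt hj, above_lt hd, List.length_cons,
      List.length_nil, Nat.reduceAdd, Nat.reduceLT, List.set_cons_zero, List.set_cons_succ,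
      List.getD_cons_zero, List.getD_cons_succ, List.append_nil, List.flatMap_nil, List.map_nil, h₀, hSx, hSy,
      Nat.add_zero (g * N), List.replicate_zero] <;> omega)
  have hleaf : ∀ x y : List G, x.length ≤ N → y.length ≤ N → ∀ b fs, ∃ b',
      (b' = true ↔ x = y ∨ R N (fun i => S (ρ i)) x y) ∧
      Runs (fun _ => B) (savLeaf d p) b 0 (savState one zero d S x y [] 0 fs) b' 1
        (savState one zero d S [] [] [] 0 fs) := by
    intro x y hx hy b fs
    have e₁ : Runs (fun _ => B) (isEq (d + 0) (d + 1) (d + 8)) b 0 (savState one zero d S x y [] 0 fs)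
        (decide (x = y)) 0 (savState one zero d S x y [] 0 fs) := by
      have := runs_isEq (B := B) (b := b) (m := 0) (S := savState one zero d S x y [] 0 fs)
        (x := d + 0) (y := d + 1) (u := d + 8) (by omega) (by omega)
      unfold savState at this ⊢
      simp only [above_add, List.getD_cons_zero, List.getD_cons_succ, add_assoc, Nat.reduceAdd,
        List.getD_nil] at this
      exact this trivial trivial trivial (by omega) (by omega)
    by_cases hxy : x = y
    · simp only [hxy, decide_true] at e₁
      refine ⟨true, by simp [hxy], ?_⟩
      rw [hxy]
      exact e₁.seq (Runs.seq (Runs.ite_flag (runs_setCtl id 0)) (Runs.ite_flag (runs_savClear true)))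
    · simp only [hxy, decide_false] at e₁
      obtain ⟨b', hb', e⟩ := hp N B (savState one zero d S x y [] 0 fs) false 0
        (by unfold savState; rw [above_lt hd, h₀])
        (fun o => by
          unfold savState
          rcases o with - | - | i
          · simpa [above_add] using hy
          · simpa [above] using hx
          · simpa [above_lt (hρ i)] using hι i)
        (fun k hk => by
          obtain ⟨r, rfl⟩ := Nat.exists_eq_add_of_le hk
          unfold savState
          rw [add_assoc, above_add]
          rcases r with _ | r
          · rfl
          · rw [show 8 + (r + 1) = r + 9 by omega]; rfl) hB₁
      refine ⟨b', ?_, e₁.seq (Runs.seq (Runs.ite_flag e) (Runs.ite_flag ?_))⟩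
      · rw [hb']
        have e₂ : savState one zero d S x y [] 0 fs (d + 1) = y := by
          unfold savState; rw [above_add]; rfl
        have e₃ : savState one zero d S x y [] 0 fs d = x := by
          unfold savState; exact above_add 0
        have e₄ : ∀ i, savState one zero d S x y [] 0 fs (ρ i) = S (ρ i) := fun i => by
          unfold savState; exact above_lt (hρ i)
        simp only [Option.elim, e₂, e₃, e₄, hxy, false_or]
      · cases b'
        · exact runs_savClear false
        · exact runs_savClear true
  obtain ⟨b', hb', hloop⟩ := savitch_loop hb h01 hgN hleaf (g * N) x y [] b li lj
    (fun f hf => by simp at hf) (by simp)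
  refine ⟨b', ?_, ?_⟩
  · exact hb'.trans (tc_iff_sav li lj).symm
  · have hrun := hloop b' 2 _ (Runs.while_step (fun _ m => decide (m ≠ 2)) rfl runs_savBody_done
      (Runs.while_stop (fun _ m => decide (m ≠ 2)) rfl))
    have hend : Runs (fun _ => B) (.seq (clear (d + 3)) (setCtl id 0)) b' 2
        (savState one zero d S [] [] [] (g * N) []) b' 0 S := by
      refine (Runs.seq (runs_clear _) (runs_setCtl id 0)).congr ?_
      conv_rhs => rw [hS0]
      unfold savState
      simp only [update_above, List.length_cons, List.length_nil, Nat.reduceAdd, Nat.reduceLT,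
        List.set_cons_zero, List.set_cons_succ, List.flatMap_nil, List.map_nil]
    intro v hv hm
    obtain ⟨v₁, hf₁, hm₁, e₁⟩ := hinit v hv hm
    obtain ⟨v₂, hf₂, hm₂, e₂⟩ := (hrun.seq hend) v₁ hf₁ hm₁
    refine ⟨v₂, hf₂, hm₂, ?_⟩
    cases e₁ with
    | seq a₁ a₂ => cases a₂ with
      | seq a₂ a₃ => cases e₂ with
        | seq b₁ b₂ => exact .seq a₁ (.seq a₂ (.seq a₃ (.seq b₁ b₂)))

end Def

end StackProg

/-! ### Derived definable relations -/

namespace StackProg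

namespace Def

variable {G : Type} [Fintype G] [DecidableEq G] [Inhabited G] {ι κ : Type}
  {P Q : ℕ → (ι → List G) → Prop}

omit [DecidableEq G] in
theorem const (p : Prop) : Def fun (_ : ℕ) (_ : ι → List G) => p := by
  classical
  intro ρ d _ _
  exact ⟨setCtl (fun _ => decide p) 0, 0, fun N B S b m _ _ _ _ =>
    ⟨decide p, by simp, runs_setCtl _ _⟩⟩

theorem exMem {α : Type*} {s : Set α} (hs : s.Finite) {P : α → ℕ → (ι → List G) → Prop}
    (h : ∀ a ∈ s, Def (P a)) : Def fun N e => ∃ a ∈ s, P a N e := by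
  induction s, hs using Set.Finite.induction_on with
  | empty => exact (const False).congr fun N e _ => by simp
  | insert _ _ ih =>
    refine ((h _ (Set.mem_insert _ _)).or (ih fun a ha => h a (Set.mem_insert_of_mem _ ha))).congr
      fun N e _ => ?_
    simp

theorem allMem {α : Type*} {s : Set α} (hs : s.Finite) {P : α → ℕ → (ι → List G) → Prop}
    (h : ∀ a ∈ s, Def (P a)) : Def fun N e => ∀ a ∈ s, P a N e :=
  (exMem hs fun a ha => (h a ha).not).not.congr fun N e _ => by simp

theorem all {P : ℕ → (ι → List G) → List G → Prop}
    (h : Def fun N (e : Option ι → List G) => P N (fun i => e (some i)) (e none)) :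
    Def fun N e => ∀ x : List G, x.length ≤ N → P N e x :=
  (ex (P := fun N e x => ¬ P N e x) h.not).not.congr fun N e _ => by simp

theorem exFun [Finite κ] {P : ℕ → (ι ⊕ κ → List G) → Prop} (h : Def P) :
    Def fun N (e : ι → List G) => ∃ f : κ → List G, (∀ k, (f k).length ≤ N) ∧ P N (Sum.elim e f) := by
  revert P ι
  refine Finite.induction_empty_option (P := fun κ => ∀ {ι : Type} {P : ℕ → (ι ⊕ κ → List G) → Prop},
    Def P → Def fun N (e : ι → List G) =>
      ∃ f : κ → List G, (∀ k, (f k).length ≤ N) ∧ P N (Sum.elim e f)) ?_ ?_ ?_ κ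
  · intro α β g hα ι P h
    refine (hα (h.rename (Sum.map id g.symm))).congr fun N e _ => ?_
    constructor
    · rintro ⟨f, hf, hP⟩
      refine ⟨fun k => f (g.symm k), fun k => hf _, ?_⟩
      convert hP using 1
      funext i
      rcases i with i | i <;> simp
    · rintro ⟨f, hf, hP⟩
      refine ⟨fun k => f (g k), fun k => hf _, ?_⟩
      convert hP using 1
      funext i
      rcases i with i | i <;> simp
  · intro ι P h
    refine (h.rename (Sum.elim id PEmpty.elim)).congr fun N e _ => ?_
    have key : ∀ f : PEmpty → List G,
        (fun i => e (Sum.elim id PEmpty.elim i)) = (Sum.elim e f : ι ⊕ PEmpty → List G) := by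
      intro f; funext i; rcases i with i | ⟨⟨⟩⟩; rfl
    constructor
    · intro hP
      exact ⟨PEmpty.elim, fun k => k.elim, by rwa [← key]⟩
    · rintro ⟨f, -, hP⟩
      rwa [key f]
  · intro α _ hα ι P h
    let r : ι ⊕ Option α → Option ι ⊕ α
      | .inl i => .inl (some i)
      | .inr none => .inl none
      | .inr (some a) => .inr a
    have hD := ex (P := fun N (e : ι → List G) x => ∃ f : α → List G, (∀ k, (f k).length ≤ N) ∧
      P N fun i => (Sum.elim (fun o : Option ι => o.elim x e) f : Option ι ⊕ α → List G) (r i))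
      ((hα (h.rename r)).congr fun N e _ => by
        have : (fun o : Option ι => o.elim (e none) fun i => e (some i)) = e := by
          funext o; cases o <;> rfl
        simp only [this])
    refine hD.congr fun N e _ => ?_
    constructor
    · rintro ⟨x, hx, f, hf, hP⟩
      refine ⟨fun k => k.elim x f, fun k => by cases k; exacts [hx, hf _], ?_⟩
      convert hP using 1
      funext i
      rcases i with i | - | i <;> rfl
    · rintro ⟨f, hf, hP⟩
      refine ⟨f none, hf _, fun k => f (some k), fun k => hf _, ?_⟩
      convert hP using 1
      funext i
      rcases i with i | - | i <;> rfl

/-- The string denoted by a word over letters and variables. -/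
def _root_.StackProg.fill (w : List (G ⊕ ι)) (e : ι → List G) : List G :=
  w.flatMap (Sum.elim (fun a => [a]) e)

/-- The word is taken apart from the left with a quantified remainder. The pieces are parts of `e i`
and hence no longer than `N`, so bounded quantifiers lose nothing. -/
theorem word (w : List (G ⊕ ι)) (i : ι) : Def fun (_ : ℕ) (e : ι → List G) => e i = fill w e := by
  obtain ⟨n, hn⟩ : ∃ n, w.length = n := ⟨_, rfl⟩
  induction n generalizing ι with
  | zero =>
    obtain rfl := List.length_eq_zero_iff.1 hn
    refine (cat i i i).congr fun N e _ => ?_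
    simp [fill, List.flatMap_nil]
  | succ n ih =>
    obtain ⟨a, w, rfl⟩ := List.exists_cons_of_length_eq_add_one hn
    simp only [List.length_cons, Nat.add_right_cancel_iff] at hn
    let r : G ⊕ ι → G ⊕ Option ι := Sum.map id some
    have hr : ∀ e : Option ι → List G, fill (w.map r) e = fill w fun i => e (some i) := by
      intro e
      unfold fill
      rw [List.flatMap_map]
      congr 1
      funext x
      rcases x with x | x <;> rfl
    rcases a with a | j
    · have h := ex (P := fun N e x => (∃ y : List G, y.length ≤ N ∧ y = [a] ∧ e i = y ++ x) ∧
        x = fill w e) ((ex (P := fun N e y => y = [a] ∧ e (some i) = y ++ e none)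
          ((sing none a).and (cat (some (some i)) none (some none)))).and
          ((ih (w.map r) none (by simpa using hn)).congr fun N e _ => by rw [hr]))
      refine h.congr fun N e he => ?_
      have := he i
      constructor
      · rintro ⟨x, -, ⟨y, -, rfl, hi⟩, rfl⟩
        rw [hi]; rfl
      · intro hi
        have hl := congrArg List.length hi
        simp only [fill, List.flatMap_cons, Sum.elim_inl, List.length_append,
          List.length_cons, List.length_nil] at hl
        exact ⟨fill w e, by unfold fill; omega, ⟨[a], by simp; omega, rfl, hi⟩, rfl⟩
    · have h := ex (P := fun N e x => e i = e j ++ x ∧ x = fill w e)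
        ((cat (some i) (some j) none).and ((ih (w.map r) none (by simpa using hn)).congr fun N e _ => by rw [hr]))
      refine h.congr fun N e he => ?_
      have := he i
      constructor
      · rintro ⟨x, -, hi, rfl⟩
        rw [hi]; rfl
      · intro hi
        have hl := congrArg List.length hi
        simp only [fill, List.flatMap_cons, Sum.elim_inr, List.length_append] at hl
        exact ⟨fill w e, by unfold fill; omega, hi, rfl⟩

theorem eq (i j : ι) : Def fun (_ : ℕ) (e : ι → List G) => e i = e j :=
  (word [.inr j] i).congr fun N e _ => by simp [fill]

theorem mem (a : G) (i : ι) : Def fun (_ : ℕ) (e : ι → List G) => a ∈ e i := by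
  refine (ex (P := fun N (e : ι → List G) x => ∃ y : List G, y.length ≤ N ∧ e i = x ++ a :: y)
    (ex (P := fun N e y => e (some i) = e none ++ a :: y)
      ((word [.inr (some none), .inl a, .inr none] (some (some i))).congr fun N e _ => by
        simp [fill]))).congr fun N e he => ?_
  have := he i
  constructor
  · rintro ⟨x, -, y, -, h⟩
    simp [h]
  · intro h
    obtain ⟨x, y, h⟩ := List.append_of_mem h
    rw [h] at this
    simp only [List.length_append, List.length_cons] at this
    exact ⟨x, by omega, y, by omega, h⟩

theorem avoid (s : Set G) (i : ι) : Def fun (_ : ℕ) (e : ι → List G) => ∀ a ∈ e i, a ∉ s :=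
  (allMem s.toFinite fun a _ => (mem a i).not).congr fun N e _ => by grind

theorem startsIn (s : Set G) (i : ι) :
    Def fun (_ : ℕ) (e : ι → List G) => ∀ a ∈ (e i).head?, a ∈ s := by
  refine (allMem (sᶜ).toFinite fun a _ => (ex (P := fun N e x => e i = a :: x)
    ((word [.inl a, .inr none] (some i)).congr fun N e _ => by simp [fill])).not).congr
    fun N e he => ?_
  have := he i
  constructor
  · intro h a ha
    by_contra hs
    obtain ⟨x, hx⟩ := List.head?_eq_some_iff.1 ha
    rw [hx, List.length_cons] at this
    exact h a hs ⟨x, by omega, hx⟩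
  · rintro h a hs ⟨x, -, hx⟩
    exact hs (h a (by simp [hx]))

end Def

end StackProg

/-! ### Lazy traces and their abstraction up to large time gaps -/

namespace TimedMSR

variable {Sg : Alphabet} {A : Set (Rule Sg)} {CS : Set (CriticalPair Sg)} {S S' X Y : Config Sg}
  {r : Rule Sg} {G : ℕ}

theorem Config.ext' {S X : Config Sg} (h : S.time = X.time) (h' : S.facts = X.facts) : S = X := by
  cases S; cases X; cases h; cases h'; rfl

/-- A step under the lazy time sampling. -/
def LazyStep (A : Set (Rule Sg)) (S S' : Config Sg) : Prop :=
  (∃ r ∈ A, r.Rewrites S S') ∨ (Tick S S' ∧ ∀ r ∈ A, ¬ r.Applicable S)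

theorem lazyStep_of_trace {P : ℕ → Config Sg} (h : IsTrace A P) (h' : UsesLazySampling A P)
    (i : ℕ) : LazyStep A (P i) (P (i + 1)) := by
  rcases h i with ht | hr
  · exact .inr ⟨ht, h' i ht⟩
  · exact .inl hr

theorem trace_of_lazyStep {P : ℕ → Config Sg} (h : ∀ i, LazyStep A (P i) (P (i + 1))) :
    IsTrace A P ∧ UsesLazySampling A P := by
  refine ⟨fun i => ?_, fun i ht => ?_⟩
  · rcases h i with h | h
    exacts [.inr h, .inl h.1]
  · rcases h i with ⟨r, _, θ, τ, R, _, _, _, h', _⟩ | h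
    · have := ht.1; omega
    · exact h.2

theorem exists_lazyStep (A : Set (Rule Sg)) (S : Config Sg) : ∃ S', LazyStep A S S' := by
  by_cases h : ∃ r ∈ A, r.Applicable S
  · obtain ⟨r, hr, S', h⟩ := h
    exact ⟨S', .inl ⟨r, hr, h⟩⟩
  · push Not at h
    exact ⟨⟨S.time + 1, S.facts, S.ground⟩, .inr ⟨⟨rfl, rfl⟩, h⟩⟩

/-- Every finite trace under the lazy time sampling is the beginning of an infinite one. -/
theorem exists_trace_through {S₀ : Config Sg} (h : Relation.ReflTransGen (LazyStep A) S₀ S) :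
    ∃ P : ℕ → Config Sg, (∀ i, LazyStep A (P i) (P (i + 1))) ∧ P 0 = S₀ ∧ ∃ i, P i = S := by
  induction h using Relation.ReflTransGen.head_induction_on with
  | refl =>
    choose f hf using exists_lazyStep A
    exact ⟨fun i => f^[i] S, fun i => by
      simpa only [Function.iterate_succ_apply'] using hf _, rfl, 0, rfl⟩
  | @head a b hab _ ih =>
    obtain ⟨P, hP, rfl, i, hi⟩ := ih
    exact ⟨fun i => i.casesOn a P, fun i => by cases i; exacts [hab, hP _], rfl, i + 1, hi⟩

/-- The bound speaks of infinite traces, but a lazy step is always possible and so every finite lazy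
trace extends to an infinite one. -/
theorem IsFactSizeBound.size_le {S₀ : Config Sg} {k : ℕ} (hk : IsFactSizeBound A S₀ k)
    (h : Relation.ReflTransGen (LazyStep A) S₀ S) {F : Fact Sg × ℕ} (hF : F ∈ S.facts) :
    F.1.size ≤ k := by
  obtain ⟨P, hP, h0, i, rfl⟩ := exists_trace_through h
  obtain ⟨h₁, h₂⟩ := trace_of_lazyStep hP
  exact hk P h₁ h0 h₂ i F hF

/-! ### Progress -/

/-- The number of facts that are not in the future. -/
def Config.past (S : Config Sg) : ℕ := S.facts.countP (fun F => F.2 ≤ S.time)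

/-- The guards `T ≥ T'` put all consumed facts into the past or present. By balance equally many
facts are created, and one of them lies strictly in the future. -/
theorem Rule.Rewrites.past_lt (hA : IsProgressive A) (hr : r ∈ A) (h : r.Rewrites S S') :
    S'.past < S.past := by
  obtain ⟨θ, τ, R, ht, hg, h₁, h₂, h₃⟩ := h
  obtain ⟨⟨Q, hQ, hQ1⟩, hc⟩ := hA.2 r hr
  unfold Config.past
  rw [h₁, h₂, h₃]
  simp only [Multiset.countP_add]
  have e₁ : (inst θ τ r.consumed).countP (fun F => F.2 ≤ S.time) = r.consumed.card := by
    rw [Multiset.countP_eq_card.2, inst, Multiset.card_map]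
    intro F hF
    obtain ⟨F', hF', rfl⟩ := Multiset.mem_map.1 hF
    have := hg _ (hc F' hF')
    simp only [TimeConstraint.Holds, ht] at this
    simp only
    omega
  have e₂ : (r.created.map fun Q => (Q.1.subst θ, S.time + Q.2)).countP (fun F => F.2 ≤ S.time)
      < r.created.card := by
    rw [Multiset.countP_map]
    obtain ⟨R', hR'⟩ := Multiset.exists_cons_of_mem hQ
    rw [hR', Multiset.filter_cons_of_neg _ (by simp only; omega), Multiset.card_cons]
    exact Nat.lt_succ_of_le (Multiset.card_le_card (Multiset.filter_le _ _))
  rw [e₁, ← hA.1 r hr]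
  omega

theorem LazyStep.time_le (h : LazyStep A S S') : S.time ≤ S'.time := by
  rcases h with ⟨r, _, θ, τ, R, _, _, _, h', _⟩ | h
  · exact h'.ge
  · rw [h.1.1]; omega

/-- Rules lower `past` and leave the time unchanged, so after finitely many of them a tick must
follow. -/
theorem tendsto_time (hA : IsProgressive A) {P : ℕ → Config Sg}
    (h : ∀ i, LazyStep A (P i) (P (i + 1))) :
    Filter.Tendsto (fun i => (P i).time) Filter.atTop Filter.atTop := by
  have hmono : Monotone fun i => (P i).time := monotone_nat_of_le_succ fun i => (h i).time_le
  have key : ∀ n i, (P i).past ≤ n → ∃ j, (P i).time < (P j).time := by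
    intro n
    induction n with
    | zero =>
      intro i hi
      rcases h i with ⟨r, hr, h⟩ | h
      · have := h.past_lt hA hr; omega
      · exact ⟨i + 1, by rw [h.1.1]; omega⟩
    | succ n ih =>
      intro i hi
      rcases h i with ⟨r, hr, h'⟩ | h'
      · have := h'.past_lt hA hr
        obtain ⟨j, hj⟩ := ih (i + 1) (by omega)
        exact ⟨j, (h i).time_le.trans_lt hj⟩
      · exact ⟨i + 1, by rw [h'.1.1]; omega⟩
  refine Filter.tendsto_atTop_atTop_of_monotone hmono fun b => ?_
  induction b with
  | zero => exact ⟨0, Nat.zero_le _⟩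
  | succ b ih =>
    obtain ⟨i, hi⟩ := ih
    obtain ⟨j, hj⟩ := key _ i le_rfl
    exact ⟨j, by omega⟩

/-! ### Simulation up to time gaps -/

def Config.mapTime (g : ℕ → ℕ) (S : Config Sg) : Config Sg :=
  ⟨g S.time, S.facts.map fun F => (F.1, g F.2), fun F hF => by
    obtain ⟨F', hF', rfl⟩ := Multiset.mem_map.1 hF
    exact S.ground F' hF'⟩

/-- The times that are present in a configuration, or not before its global time. -/
def Config.Stamp (S : Config Sg) (t : ℕ) : Prop := S.time ≤ t ∨ ∃ F ∈ S.facts, F.2 = t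

/-- The map `g` preserves the differences of times of `S` that are smaller than `G`. -/
structure KeepsGaps (G : ℕ) (g : ℕ → ℕ) (S : Config Sg) : Prop where
  later : ∀ d, g (S.time + d) = g S.time + d
  near : ∀ a b, S.Stamp a → S.Stamp b → a ≤ b →
    g b + a = g a + b ∨ (a + G ≤ b ∧ g a + G ≤ g b)

/-- Equality up to large time gaps. -/
def Sim (G : ℕ) (S X : Config Sg) : Prop := ∃ g, KeepsGaps G g S ∧ X = S.mapTime g

theorem KeepsGaps.mono {g : ℕ → ℕ} (h : KeepsGaps G g S) (ht : S.time ≤ S'.time)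
    (hs : ∀ t, S'.Stamp t → S.Stamp t) : KeepsGaps G g S' := by
  refine ⟨fun d => ?_, fun a b ha hb => h.near a b (hs a ha) (hs b hb)⟩
  obtain ⟨e, he⟩ := Nat.exists_eq_add_of_le ht
  rw [he, add_assoc, h.later, h.later, add_assoc]

/-- A constraint whose offset is smaller than `G` in absolute value cannot tell apart two
differences that are both at least `G`. -/
theorem KeepsGaps.holds {g : ℕ → ℕ} (h : KeepsGaps G g S) {c : TimeConstraint} {τ : ℕ → ℕ}
    (h₁ : S.Stamp (τ c.lhs)) (h₂ : S.Stamp (τ c.rhs)) (hG : c.offset.natAbs < G) :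
    c.Holds τ → c.Holds fun v => g (τ v) := by
  rcases le_total (τ c.lhs) (τ c.rhs) with hle | hle
  · have := h.near _ _ h₁ h₂ hle
    unfold TimeConstraint.Holds
    cases c.cmp <;> intro hc <;> simp only at hc ⊢ <;> omega
  · have := h.near _ _ h₂ h₁ hle
    unfold TimeConstraint.Holds
    cases c.cmp <;> intro hc <;> simp only at hc ⊢ <;> omega

theorem KeepsGaps.le {g : ℕ → ℕ} (h : KeepsGaps G g S) {a b : ℕ} (ha : S.Stamp a) (hb : S.Stamp b)
    (hab : a ≤ b) : g a ≤ g b := by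
  rcases h.near a b ha hb hab with h | h <;> omega

theorem KeepsGaps.lt {g : ℕ → ℕ} (hG : 0 < G) (h : KeepsGaps G g S) {a b : ℕ} (ha : S.Stamp a)
    (hb : S.Stamp b) (hab : a < b) : g a < g b := by
  rcases h.near a b ha hb hab.le with h | h <;> omega

theorem KeepsGaps.inj {g : ℕ → ℕ} (hG : 0 < G) (h : KeepsGaps G g S) {a b : ℕ} (ha : S.Stamp a)
    (hb : S.Stamp b) (hab : g a = g b) : a = b := by
  rcases lt_trichotomy a b with h' | h' | h'
  · have := h.lt hG ha hb h'; omega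
  · exact h'
  · have := h.lt hG hb ha h'; omega

theorem Config.stamp_time (S : Config Sg) : S.Stamp S.time := .inl le_rfl

theorem KeepsGaps.stamp {g : ℕ → ℕ} (h : KeepsGaps G g S) {a : ℕ} (ha : S.Stamp a) :
    (S.mapTime g).Stamp (g a) := by
  rcases ha with ha | ⟨F, hF, rfl⟩
  · exact .inl (h.le S.stamp_time (.inl ha) ha)
  · exact .inr ⟨_, Multiset.mem_map_of_mem _ hF, rfl⟩

theorem KeepsGaps.exists_of_stamp {g : ℕ → ℕ} (h : KeepsGaps G g S) {b : ℕ}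
    (hb : (S.mapTime g).Stamp b) : ∃ a, S.Stamp a ∧ g a = b := by
  rcases hb with hb | ⟨F, hF, rfl⟩
  · obtain ⟨e, he⟩ := Nat.exists_eq_add_of_le hb
    exact ⟨S.time + e, .inl (Nat.le_add_right _ _), by rw [h.later, he]; rfl⟩
  · obtain ⟨F', hF', rfl⟩ := Multiset.mem_map.1 hF
    exact ⟨F'.2, .inr ⟨F', hF', rfl⟩, rfl⟩

theorem mapTime_congr {g g' : ℕ → ℕ} (h : ∀ a, S.Stamp a → g a = g' a) :
    S.mapTime g = S.mapTime g' :=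
  Config.ext' (h _ S.stamp_time) (Multiset.map_congr rfl fun F hF => by
    rw [h _ (.inr ⟨F, hF, rfl⟩)])

theorem mapTime_mapTime (g g' : ℕ → ℕ) : (S.mapTime g).mapTime g' = S.mapTime (g' ∘ g) :=
  Config.ext' rfl (by simp [Config.mapTime])

theorem mapTime_id : S.mapTime id = S := Config.ext' rfl (by simp [Config.mapTime])

theorem Sim.refl (S : Config Sg) : Sim G S S :=
  ⟨id, ⟨fun _ => rfl, fun a b _ _ _ => .inl (by simp [add_comm])⟩, mapTime_id.symm⟩

theorem Sim.trans (h : Sim G S X) (h' : Sim G X Y) : Sim G S Y := by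
  obtain ⟨g, hg, rfl⟩ := h
  obtain ⟨f, hf, rfl⟩ := h'
  refine ⟨f ∘ g, ⟨fun d => ?_, fun a b ha hb hab => ?_⟩, mapTime_mapTime g f⟩
  · simp only [Function.comp, hg.later]
    exact hf.later d
  · have h₁ := hg.near a b ha hb hab
    have h₂ := hf.near _ _ (hg.stamp ha) (hg.stamp hb) (hg.le ha hb hab)
    simp only [Function.comp]
    omega

/-- A map that keeps gaps is strictly increasing on the stamps and therefore invertible there. Off
the image the values of the inverse are irrelevant. -/
theorem Sim.symm (hG : 0 < G) (h : Sim G S X) : Sim G X S := by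
  classical
  obtain ⟨g, hg, rfl⟩ := h
  let f : ℕ → ℕ := fun b => if h : ∃ a, S.Stamp a ∧ g a = b then h.choose else 0
  have hf : ∀ a, S.Stamp a → f (g a) = a := by
    intro a ha
    have h : ∃ a', S.Stamp a' ∧ g a' = g a := ⟨a, ha, rfl⟩
    simp only [f, dif_pos h]
    exact hg.inj hG h.choose_spec.1 ha h.choose_spec.2
  refine ⟨f, ⟨fun d => ?_, fun a b ha hb hab => ?_⟩, ?_⟩
  · show f (g S.time + d) = f (g S.time) + d
    rw [← hg.later, hf _ (.inl (Nat.le_add_right _ _)), hf _ S.stamp_time]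
  · obtain ⟨a, ha', rfl⟩ := hg.exists_of_stamp ha
    obtain ⟨b, hb', rfl⟩ := hg.exists_of_stamp hb
    have hle : a ≤ b := by
      by_contra h
      have := hg.lt hG hb' ha' (not_le.1 h)
      omega
    have := hg.near a b ha' hb' hle
    rw [hf a ha', hf b hb']
    omega
  · rw [mapTime_mapTime, mapTime_congr (g := f ∘ g) (g' := id) hf, mapTime_id]

/-- All numbers of the rules are less than `G`. -/
def Rule.OffsetsLT (r : Rule Sg) (G : ℕ) : Prop := ∀ c ∈ r.guard, c.offset.natAbs < G

/-- The same instance is applied with its times moved by `g`. The created facts carry the times `T +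
D`, and from the global time on `g` is a translation, so they land where the rule puts them. -/
theorem Rule.Rewrites.sim (hG : r.OffsetsLT G) (h : r.Rewrites S S') (hX : Sim G S X) :
    ∃ X', r.Rewrites X X' ∧ Sim G S' X' := by
  obtain ⟨g, hg, rfl⟩ := hX
  obtain ⟨θ, τ, R, ht, hc, h₁, h₂, h₃⟩ := h
  have hstamp : ∀ v, v = r.time ∨ v ∈ (r.context + r.consumed).map Prod.snd → S.Stamp (τ v) := by
    rintro v (rfl | hv)
    · exact .inl ht.ge
    · obtain ⟨F, hF, rfl⟩ := Multiset.mem_map.1 hv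
      refine .inr ⟨(F.1.subst θ, τ F.2), ?_, rfl⟩
      rw [h₁, Multiset.mem_add]
      refine .inl ?_
      rw [inst, inst, ← Multiset.map_add]
      exact Multiset.mem_map_of_mem (fun F : Fact Sg × ℕ => (F.1.subst θ, τ F.2)) hF
  refine ⟨S'.mapTime g, ⟨θ, fun v => g (τ v), R.map fun F => (F.1, g F.2), ?_, fun c hcm => ?_, ?_, ?_,
    ?_⟩, g, hg.mono h₂.ge ?_, rfl⟩
  · simp [Config.mapTime, ht]
  · have := fun v hv => hstamp v (r.guard_vars c hcm v hv)
    exact hg.holds (this _ (.inl rfl)) (this _ (.inr rfl)) (hG c hcm) (hc c hcm)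
  · simp [Config.mapTime, h₁, inst]
  · simp [Config.mapTime, h₂]
  · simp [Config.mapTime, h₃, inst, hg.later]
  · rintro t (h | ⟨F, hF, rfl⟩)
    · exact .inl (h₂ ▸ h)
    · rw [h₃, Multiset.mem_add, Multiset.mem_add] at hF
      rcases hF with (hF | hF) | hF
      · exact .inr ⟨F, by rw [h₁]; simp [hF], rfl⟩
      · obtain ⟨Q, _, rfl⟩ := Multiset.mem_map.1 hF
        exact .inl (Nat.le_add_right _ _)
      · exact .inr ⟨F, by rw [h₁]; simp [hF], rfl⟩

theorem IsCritical.sim (hG : ∀ p ∈ CS, ∀ c ∈ p.guard, c.offset.natAbs < G) (h : IsCritical CS S)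
    (hX : Sim G S X) : IsCritical CS X := by
  obtain ⟨g, hg, rfl⟩ := hX
  obtain ⟨p, hp, θ, τ, hle, hc⟩ := h
  have hall : ∀ F ∈ S.all, S.Stamp F.2 := by
    intro F hF
    rcases Multiset.mem_cons.1 hF with rfl | hF
    · exact S.stamp_time
    · obtain ⟨F', hF', rfl⟩ := Multiset.mem_map.1 hF
      exact .inr ⟨F', hF', rfl⟩
  refine ⟨p, hp, θ, fun v => g (τ v), ?_, fun c hcm => ?_⟩
  · have := Multiset.map_le_map (f := fun F : Option (Fact Sg) × ℕ => (F.1, g F.2)) hle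
    simpa [Config.all, Config.mapTime, Function.comp_def] using this
  · have : ∀ v, v = c.lhs ∨ v = c.rhs → S.Stamp (τ v) := by
      intro v hv
      obtain ⟨F, hF, rfl⟩ := Multiset.mem_map.1 (p.guard_vars c hcm v hv)
      exact hall _ (Multiset.mem_of_le hle (Multiset.mem_map_of_mem
        (fun F : Option (Fact Sg) × ℕ => (F.1.map (Fact.subst θ), τ F.2)) hF))
    exact hg.holds (this _ (.inl rfl)) (this _ (.inr rfl)) (hG p hp c hcm) (hc c hcm)

theorem Tick.sim (h : Tick S S') (hX : Sim G S X) : ∃ X', Tick X X' ∧ Sim G S' X' := by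
  obtain ⟨g, hg, rfl⟩ := hX
  refine ⟨S'.mapTime g, ⟨?_, ?_⟩, g, hg.mono (by rw [h.1]; omega) ?_, rfl⟩
  · simp [Config.mapTime, h.1, hg.later]
  · simp [Config.mapTime, h.2]
  · rintro t (h' | ⟨F, hF, rfl⟩)
    · rw [h.1] at h'; exact .inl (by omega)
    · exact .inr ⟨F, h.2 ▸ hF, rfl⟩

/-- A lazy tick has the negative premise that no rule applies. It transfers because `Sim` is
symmetric. -/
theorem LazyStep.sim (hG₀ : 0 < G) (hG : ∀ r ∈ A, r.OffsetsLT G) (h : LazyStep A S S')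
    (hX : Sim G S X) : ∃ X', LazyStep A X X' ∧ Sim G S' X' := by
  rcases h with ⟨r, hr, h⟩ | ⟨h, h'⟩
  · obtain ⟨X', h₁, h₂⟩ := h.sim (hG r hr) hX
    exact ⟨X', .inl ⟨r, hr, h₁⟩, h₂⟩
  · obtain ⟨X', h₁, h₂⟩ := h.sim hX
    refine ⟨X', .inr ⟨h₁, fun r hr ⟨Y, hY⟩ => ?_⟩, h₂⟩
    obtain ⟨S'', hS'', _⟩ := hY.sim (hG r hr) (hX.symm hG₀)
    exact h' r hr ⟨_, hS''⟩

/-- The shortening of a gap that is larger than `G`. -/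
def Shift (G c : ℕ) (X Y : Config Sg) : Prop :=
  c + G ≤ X.time ∧ (∀ F ∈ X.facts, F.2 < c ∨ c + G ≤ F.2) ∧
    Y = X.mapTime fun t => if t < c then t else t - 1

/-- No stamp lies in the half-open interval from `c` to `c + G`. A difference across it is thus at
least `G + 1`, and still at least `G` after being lowered by one. -/
theorem Shift.sim (hG : 0 < G) {c : ℕ} (h : Shift G c X Y) : Sim G X Y := by
  obtain ⟨h₁, h₂, rfl⟩ := h
  have h₃ : ∀ a, X.Stamp a → a < c ∨ c + G ≤ a := by
    rintro a (ha | ⟨F, hF, rfl⟩)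
    · exact .inr (h₁.trans ha)
    · exact h₂ F hF
  refine ⟨_, ⟨fun d => ?_, fun a b ha hb hab => ?_⟩, rfl⟩
  · split_ifs <;> omega
  · have := h₃ a ha
    have := h₃ b hb
    split_ifs <;> omega

theorem Shift.time_lt (hG : 0 < G) {c : ℕ} (h : Shift G c X Y) : Y.time < X.time := by
  obtain ⟨h₁, h₂, rfl⟩ := h
  simp only [Config.mapTime]
  split_ifs <;> omega

/-- The steps of the abstract system, in which large time gaps are shortened. -/
def Edge (A : Set (Rule Sg)) (CS : Set (CriticalPair Sg)) (G : ℕ) (X Y : Config Sg) : Prop :=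
  ¬ IsCritical CS X ∧ ((∃ r ∈ A, r.Rewrites X Y) ∨
    (Tick X Y ∧ (∀ r ∈ A, ¬ r.Applicable X) ∧ ∀ c Z, ¬ Shift G c X Z) ∨ ∃ c, Shift G c X Y)

/-- There is an infinite path from `x`. -/
def Perpetual {α : Type*} (E : α → α → Prop) (x : α) : Prop :=
  ∃ W : Set α, x ∈ W ∧ ∀ y ∈ W, ∃ z ∈ W, E y z

theorem Perpetual.exists_path {α : Type*} {E : α → α → Prop} {x : α} (h : Perpetual E x) :
    ∃ P : ℕ → α, P 0 = x ∧ ∀ i, E (P i) (P (i + 1)) := by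
  obtain ⟨W, hx, hW⟩ := h
  choose f hf hE using fun y : W => hW y y.2
  let g : W → W := fun y => ⟨f y, hf y⟩
  refine ⟨fun i => (g^[i] ⟨x, hx⟩ : W), rfl, fun i => ?_⟩
  simp only [Function.iterate_succ_apply']
  exact hE _

/-- The configurations similar to members of a trace form a perpetual set: shorten a gap if
possible, and otherwise copy the lazy step. Conversely, a perpetual set is followed through its
shortenings, which lower the time and so must end, up to a genuine step, and that step is
transported back to the concrete configuration. Compliance is invariant under `Sim`, and the
divergence of time comes from progressiveness. -/
theorem realizable_iff (hA : IsProgressive A) (hG₀ : 0 < G) (hG : ∀ r ∈ A, r.OffsetsLT G)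
    (hCS : ∀ p ∈ CS, ∀ c ∈ p.guard, c.offset.natAbs < G) (S₀ : Config Sg) :
    Realizable A CS S₀ ↔ Perpetual (Edge A CS G) S₀ := by
  constructor
  · rintro ⟨P, h₁, rfl, h₂, h₃, -⟩
    refine ⟨{X | ∃ i, Sim G (P i) X}, ⟨0, Sim.refl _⟩, ?_⟩
    rintro X ⟨i, hX⟩
    have hcrit : ¬ IsCritical CS X := fun h => h₃ i (h.sim hCS (hX.symm hG₀))
    by_cases hs : ∃ c Z, Shift G c X Z
    · obtain ⟨c, Z, h⟩ := hs
      exact ⟨Z, ⟨i, hX.trans (h.sim hG₀)⟩, hcrit, .inr (.inr ⟨c, h⟩)⟩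
    · push Not at hs
      obtain ⟨Y, h, hY⟩ := (lazyStep_of_trace h₁ h₂ i).sim hG₀ hG hX
      refine ⟨Y, ⟨i + 1, hY⟩, hcrit, ?_⟩
      rcases h with h | h
      exacts [.inl h, .inr (.inl ⟨h.1, h.2, hs⟩)]
  · rintro ⟨W, h₀, hW⟩
    have key : ∀ n X S, X ∈ W → X.time ≤ n → Sim G S X →
        ∃ S', LazyStep A S S' ∧ ∃ Y ∈ W, Sim G S' Y := by
      intro n
      induction n with
      | zero =>
        intro X S hX hn hS
        obtain ⟨Y, hY, -, h | h | ⟨c, h⟩⟩ := hW X hX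
        · obtain ⟨S', h, hS'⟩ := LazyStep.sim hG₀ hG (.inl h) (hS.symm hG₀)
          exact ⟨S', h, Y, hY, hS'.symm hG₀⟩
        · obtain ⟨S', h, hS'⟩ := LazyStep.sim hG₀ hG (.inr ⟨h.1, h.2.1⟩) (hS.symm hG₀)
          exact ⟨S', h, Y, hY, hS'.symm hG₀⟩
        · have := h.time_lt hG₀; omega
      | succ n ih =>
        intro X S hX hn hS
        obtain ⟨Y, hY, -, h | h | ⟨c, h⟩⟩ := hW X hX
        · obtain ⟨S', h, hS'⟩ := LazyStep.sim hG₀ hG (.inl h) (hS.symm hG₀)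
          exact ⟨S', h, Y, hY, hS'.symm hG₀⟩
        · obtain ⟨S', h, hS'⟩ := LazyStep.sim hG₀ hG (.inr ⟨h.1, h.2.1⟩) (hS.symm hG₀)
          exact ⟨S', h, Y, hY, hS'.symm hG₀⟩
        · have := h.time_lt hG₀
          exact ih Y S hY (by omega) (hS.trans (h.sim hG₀))
    obtain ⟨P, h0, hP⟩ := Perpetual.exists_path (E := fun S S' => LazyStep A S S' ∧ ∃ Y ∈ W, Sim G S Y)
      (x := S₀) ⟨{S | ∃ X ∈ W, Sim G S X}, ⟨S₀, h₀, Sim.refl _⟩, fun S ⟨X, hX, hS⟩ =>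
        let ⟨S', h, hS'⟩ := key _ X S hX le_rfl hS
        ⟨S', hS', h, X, hX, hS⟩⟩
    obtain ⟨h₁, h₂⟩ := trace_of_lazyStep fun i => (hP i).1
    refine ⟨P, h₁, h0, h₂, fun i hi => ?_, tendsto_time hA fun i => (hP i).1⟩
    obtain ⟨Y, hY, hS⟩ := (hP i).2
    obtain ⟨_, _, h, _⟩ := hW Y hY
    exact h (hi.sim hCS hS)

/-! ### Bounds -/

theorem Edge.sim (hG₀ : 0 < G) (hG : ∀ r ∈ A, r.OffsetsLT G) (h : Edge A CS G X Y)
    (hS : Sim G S X) : ∃ S', Relation.ReflTransGen (LazyStep A) S S' ∧ Sim G S' Y := by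
  obtain ⟨-, h | h | ⟨c, h⟩⟩ := h
  · obtain ⟨S', h, hS'⟩ := LazyStep.sim hG₀ hG (.inl h) (hS.symm hG₀)
    exact ⟨S', .single h, hS'.symm hG₀⟩
  · obtain ⟨S', h, hS'⟩ := LazyStep.sim hG₀ hG (.inr ⟨h.1, h.2.1⟩) (hS.symm hG₀)
    exact ⟨S', .single h, hS'.symm hG₀⟩
  · exact ⟨S, .refl, hS.trans (h.sim hG₀)⟩

theorem exists_sim_of_reachable (hG₀ : 0 < G) (hG : ∀ r ∈ A, r.OffsetsLT G) {S₀ : Config Sg}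
    (h : Relation.ReflTransGen (Edge A CS G) S₀ X) :
    ∃ S, Relation.ReflTransGen (LazyStep A) S₀ S ∧ Sim G S X := by
  induction h with
  | refl => exact ⟨S₀, .refl, Sim.refl _⟩
  | tail _ h ih =>
    obtain ⟨S, h₁, hS⟩ := ih
    obtain ⟨S', h₂, hS'⟩ := h.sim hG₀ hG hS
    exact ⟨S', h₁.trans h₂, hS'⟩

/-- Abstractly reachable configurations differ from some genuinely reachable ones only in their
times, so `k` bounds their facts as well. -/
theorem IsFactSizeBound.size_le_of_edges (hG₀ : 0 < G) (hG : ∀ r ∈ A, r.OffsetsLT G)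
    {S₀ : Config Sg} {k : ℕ} (hk : IsFactSizeBound A S₀ k)
    (h : Relation.ReflTransGen (Edge A CS G) S₀ X) {F : Fact Sg × ℕ} (hF : F ∈ X.facts) :
    F.1.size ≤ k := by
  obtain ⟨S, h₁, g, -, rfl⟩ := exists_sim_of_reachable hG₀ hG h
  obtain ⟨F', hF', rfl⟩ := Multiset.mem_map.1 hF
  exact hk.size_le (F := F') h₁ hF'

/-- Pigeonhole. With `n` facts, consider the first `n + 1` blocks of length `G`. If the global time
lies beyond all of them, some block contains no timestamp, and the gap around it can be shortened.
-/
theorem time_lt_of_not_shift (h : ∀ c Z, ¬ Shift G c X Z) :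
    X.time < (X.facts.card + 1) * G := by
  classical
  by_contra hlt
  push Not at hlt
  have h₁ : ∀ j ∈ Finset.range (X.facts.card + 1), ∃ F ∈ X.facts, F.2 / G = j := by
    intro j hj
    have hj' : (j + 1) * G ≤ X.time :=
      (Nat.mul_le_mul_right G (by simpa using hj)).trans hlt
    by_contra hF
    push Not at hF
    refine h (j * G) _ ⟨by linarith [Nat.succ_mul j G], fun F hFX => ?_, rfl⟩
    have := hF F hFX
    by_contra hc
    push Not at hc
    exact this (Nat.div_eq_of_lt_le hc.1 (by linarith [Nat.succ_mul j G]))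
  have h₂ : Finset.range (X.facts.card + 1) ⊆ (X.facts.map fun F => F.2 / G).toFinset := by
    intro j hj
    obtain ⟨F, hF, rfl⟩ := h₁ j hj
    exact Multiset.mem_toFinset.2 (Multiset.mem_map_of_mem (fun F : Fact Sg × ℕ => F.2 / G) hF)
  have := (Finset.card_le_card h₂).trans (Multiset.toFinset_card_le _)
  simp at this

/-- Only ticks raise the global time, and a tick is allowed only when no gap can be shortened, that
is, below the bound of `time_lt_of_not_shift`. Created facts lie at most `G` after the global time.
-/
theorem bounds_of_reachable (hA : IsBalanced A) (hG₀ : 0 < G)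
    (hG : ∀ r ∈ A, ∀ Q ∈ r.created, Q.2 ≤ G) {S₀ : Config Sg} {D : ℕ} (hD : S₀.time ≤ D)
    (hD' : ∀ F ∈ S₀.facts, F.2 ≤ D) (h : Relation.ReflTransGen (Edge A CS G) S₀ X) :
    X.facts.card = S₀.facts.card ∧ X.time ≤ D + S₀.numFacts * G ∧
      ∀ F ∈ X.facts, F.2 ≤ D + S₀.numFacts * G + G := by
  induction h with
  | refl => exact ⟨rfl, by omega, fun F hF => by have := hD' F hF; omega⟩
  | @tail X Y _ h ih =>
    obtain ⟨i₁, i₂, i₃⟩ := ih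
    obtain ⟨-, ⟨r, hr, θ, τ, R, -, -, h₁, h₂, h₃⟩ | ⟨⟨h₁, h₂⟩, -, h₃⟩ | ⟨c, h₁, h₂, rfl⟩⟩ := h
    · refine ⟨?_, h₂ ▸ i₂, fun F hF => ?_⟩
      · rw [← i₁, h₁, h₃]
        simp [inst, hA r hr]
      · rw [h₃, Multiset.mem_add, Multiset.mem_add] at hF
        rcases hF with (hF | hF) | hF
        · exact i₃ F (by rw [h₁]; simp [hF])
        · obtain ⟨Q, hQ, rfl⟩ := Multiset.mem_map.1 hF
          have := hG r hr Q hQ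
          simp only
          omega
        · exact i₃ F (by rw [h₁]; simp [hF])
    · refine ⟨h₂ ▸ i₁, ?_, h₂ ▸ i₃⟩
      have := time_lt_of_not_shift h₃
      rw [i₁] at this
      rw [h₁, Config.numFacts]
      omega
    · refine ⟨by simpa [Config.mapTime] using i₁, ?_, fun F hF => ?_⟩
      · simp only [Config.mapTime]
        split_ifs <;> omega
      · obtain ⟨F', hF', rfl⟩ := Multiset.mem_map.1 hF
        have := i₃ F' hF'
        simp only
        split_ifs <;> omega

end TimedMSR

/-! ### Configurations as words -/

namespace TimedMSR

open StackProg

variable {Sg : Alphabet}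

/-- The letters of the words on which the decision procedure works. -/
inductive Letter (Sg : Alphabet) : Type
  -- `time` stands for the predicate `Time`, `mark` is the moving marker of the scan that shortens
  -- gaps, and `sort s` replaces a term already recognised to be of sort `s`.
  | sym (a : Sym Sg)
  | time
  | mark
  | sort (s : Sg.Srt)

instance : Finite (Sym Sg) := by
  have := Sg.finite_fn
  have := Sg.finite_pr
  refine Finite.of_injective (β := Sg.Fn ⊕ Sg.Pr ⊕ Bool) (fun
    | .fn f => .inl f
    | .pr P => .inr (.inl P)
    | .bit b => .inr (.inr b)) ?_
  intro a b
  cases a <;> cases b <;> simp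

instance : Finite (Letter Sg) := by
  have := Sg.finite_srt
  refine Finite.of_injective (β := Sym Sg ⊕ Sg.Srt ⊕ Bool) (fun
    | .sym a => .inl a
    | .sort s => .inr (.inl s)
    | .time => .inr (.inr true)
    | .mark => .inr (.inr false)) ?_
  intro a b
  cases a <;> cases b <;> simp

noncomputable instance : Fintype (Sym Sg) := Fintype.ofFinite _
noncomputable instance : Fintype (Letter Sg) := Fintype.ofFinite _
noncomputable instance : DecidableEq (Letter Sg) := Classical.decEq _
instance : Inhabited (Letter Sg) := ⟨.time⟩
instance : Nontrivial (Letter Sg) := ⟨.time, .mark, by simp⟩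

/-- Term variables and time variables. -/
abbrev Var (Sg : Alphabet) : Type := (Sg.Srt × ℕ) ⊕ ℕ

/-- Words over letters and variables. -/
abbrev Pat (Sg : Alphabet) : Type := List (Letter Sg ⊕ Var Sg)

theorem length_le_fill {V : Type} {G : Type} {w : List (G ⊕ V)} {e : V → List G} {v : V}
    (hv : .inr v ∈ w) : (e v).length ≤ (fill w e).length := by
  rw [fill, List.length_flatMap]
  exact List.single_le_sum (fun _ _ => Nat.zero_le _) _ (List.mem_map.2 ⟨_, hv, rfl⟩)

theorem fill_length_le {V : Type} {G : Type} {w : List (G ⊕ V)} {e : V → List G} {n : ℕ}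
    (h : ∀ v, .inr v ∈ w → (e v).length ≤ n) : (fill w e).length ≤ w.length * (n + 1) := by
  rw [fill, List.length_flatMap]
  refine (List.sum_le_card_nsmul _ (n + 1) ?_).trans (by simp)
  intro k hk
  obtain ⟨a, ha, rfl⟩ := List.mem_map.1 hk
  rcases a with a | v
  · simp
  · exact (h v ha).trans (Nat.le_succ n)

@[simp] theorem fill_append {V : Type} {G : Type} (w w' : List (G ⊕ V)) (e : V → List G) :
    fill (w ++ w') e = fill w e ++ fill w' e := List.flatMap_append

@[simp] theorem fill_cons {V : Type} {G : Type} (a : G ⊕ V) (w' : List (G ⊕ V)) (e : V → List G) :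
    fill (a :: w') e = a.elim (fun a => [a]) e ++ fill w' e := rfl

@[simp] theorem fill_nil {V : Type} {G : Type} (e : V → List G) :
    fill ([] : List (G ⊕ V)) e = [] := rfl

theorem fill_flatten {V : Type} {G : Type} (l : List (List (G ⊕ V))) (e : V → List G) :
    fill l.flatten e = (l.map fun w => fill w e).flatten := by
  induction l with
  | nil => rfl
  | cons a l ih => simp [ih]

/-! ### Terms -/

namespace Term

/-- The word of a term with variables. -/
def pat : {s : Sg.Srt} → Term Sg s → Pat Sg
  | _, var s x => [.inr (.inl (s, x))]
  | _, app f args => .inl (.sym (.fn f)) :: (List.ofFn fun i => (args i).pat).flatten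

/-- The word of a ground term. -/
def word {s : Sg.Srt} (t : Term Sg s) : List (Letter Sg) := t.encode.map .sym

theorem word_app (f : Sg.Fn) (args : (i : Fin (Sg.fnArity f)) → Term Sg (Sg.fnArg f i)) :
    (app f args).word = .sym (.fn f) :: (List.ofFn fun i => (args i).word).flatten := by
  simp only [word, encode, List.map_cons, List.map_flatten, List.map_ofFn, Function.comp_def]

theorem fill_pat {s : Sg.Srt} (t : Term Sg s) {θ : Subst Sg} {e : Var Sg → List (Letter Sg)}
    (h : ∀ s x, .inr (.inl (s, x)) ∈ t.pat → e (.inl (s, x)) = (θ s x).word) :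
    fill t.pat e = (t.subst θ).word := by
  induction t with
  | var s x => simp [pat, subst, h s x (by simp [pat])]
  | app f args ih =>
    simp only [pat, subst, word_app, fill_cons, Sum.elim_inl, List.cons_append, List.nil_append,
      fill_flatten, List.map_ofFn, Function.comp_def]
    congr 3
    funext i
    exact ih i fun s x hx => h s x (by
      simp only [pat, List.mem_cons, List.mem_flatten]
      exact .inr ⟨_, by simp, hx⟩)

theorem isGround_subst {s : Sg.Srt} (t : Term Sg s) {θ : Subst Sg} :
    (t.subst θ).IsGround ↔ ∀ s x, .inr (.inl (s, x)) ∈ t.pat → (θ s x).IsGround := by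
  induction t with
  | var s x => simp [pat, subst]
  | app f args ih =>
    simp only [pat, subst, IsGround, ih, List.mem_cons, List.mem_flatten, List.mem_ofFn]
    constructor
    · rintro h s x (h' | ⟨_, ⟨i, rfl⟩, hx⟩)
      · simp at h'
      · exact h i s x hx
    · intro h i s x hx
      exact h s x (.inr ⟨_, ⟨i, rfl⟩, hx⟩)

theorem subst_congr {s : Sg.Srt} (t : Term Sg s) {θ θ' : Subst Sg}
    (h : ∀ s x, .inr (.inl (s, x)) ∈ t.pat → θ s x = θ' s x) : t.subst θ = t.subst θ' := by
  induction t with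
  | var s x => exact h s x (by simp [pat])
  | app f args ih =>
    simp only [subst]
    congr 1
    funext i
    exact ih i fun s x hx => h s x (by
      simp only [pat, List.mem_cons, List.mem_flatten]
      exact .inr ⟨_, by simp, hx⟩)

theorem length_word {s : Sg.Srt} {t : Term Sg s} (h : t.IsGround) : t.word.length = t.size := by
  induction t with
  | var s x => exact h.elim
  | app f args ih =>
    simp only [word_app, size, List.length_cons, List.length_flatten, List.map_ofFn,
      Function.comp_def, List.sum_ofFn]
    rw [add_comm]
    congr 1
    exact Finset.sum_congr rfl fun i _ => ih i (h i)

theorem mem_word {s : Sg.Srt} {t : Term Sg s} {a : Letter Sg} (ha : a ∈ t.word) :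
    ∃ f, a = .sym (.fn f) := by
  induction t with
  | var s x => simp [word, encode] at ha
  | app f args ih =>
    rw [word_app, List.mem_cons, List.mem_flatten] at ha
    rcases ha with rfl | ⟨_, hl, ha⟩
    · exact ⟨f, rfl⟩
    · obtain ⟨i, rfl⟩ := (List.mem_ofFn' _ _).1 hl
      exact ih i ha

end Term

/-- Concatenations of uniquely readable words are uniquely readable: each component fixes itself and
the remainder on which the next one is read. -/
theorem flatten_ofFn_inj {α : Type*} {n : ℕ} {a b : Fin n → List α} {P : Fin n → Prop}
    (h : ∀ i u u', a i ++ u = b i ++ u' → P i ∧ u = u') (u u' : List α)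
    (hu : (List.ofFn a).flatten ++ u = (List.ofFn b).flatten ++ u') : (∀ i, P i) ∧ u = u' := by
  induction n with
  | zero => exact ⟨fun i => i.elim0, by simpa using hu⟩
  | succ n ih =>
    simp only [List.ofFn_succ, List.flatten_cons, List.append_assoc] at hu
    obtain ⟨h₁, h₂⟩ := h 0 _ _ hu
    obtain ⟨h₃, h₄⟩ := ih (a := fun i => a i.succ) (b := fun i => b i.succ)
      (P := fun i => P i.succ) (fun i => h i.succ) h₂
    exact ⟨Fin.cases h₁ h₃, h₄⟩

namespace Term

/-- Unique readability of prefix notation with fixed arities. The arbitrary remainders `u` and `u'`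
are what makes the induction over the arguments work. -/
theorem word_inj {s s' : Sg.Srt} (t : Term Sg s) (t' : Term Sg s') (h : t.IsGround)
    (h' : t'.IsGround) (u u' : List (Letter Sg)) (hu : t.word ++ u = t'.word ++ u') :
    (⟨s, t⟩ : Σ s, Term Sg s) = ⟨s', t'⟩ ∧ u = u' := by
  induction t generalizing s' t' u u' with
  | var s x => exact h.elim
  | app f args ih =>
    cases t' with
    | var s x => exact h'.elim
    | app f' args' =>
      simp only [word_app, List.cons_append, List.cons.injEq, Letter.sym.injEq, Sym.fn.injEq] at hu
      obtain ⟨rfl, hu⟩ := hu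
      obtain ⟨h₁, h₂⟩ := flatten_ofFn_inj (P := fun i => args i = args' i) (fun i u u' hi => by
        obtain ⟨h₁, h₂⟩ := ih i (args' i) (h i) (h' i) u u' hi
        simp only [Sigma.mk.injEq, heq_eq_eq, true_and] at h₁
        exact ⟨h₁, h₂⟩) u u' hu
      obtain rfl : args = args' := funext h₁
      exact ⟨rfl, h₂⟩

end Term

/-! ### Records -/

/-- A fact, where `none` stands for `Time`, with its timestamp. -/
abbrev Rec (Sg : Alphabet) : Type := Option (Fact Sg) × ℕ

def num (n : ℕ) : List (Letter Sg) := (Nat.bits n).map fun b => .sym (.bit b)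

/-- The word of a fact with variables. -/
def factPat : Option (Fact Sg) → Pat Sg
  | none => [.inl .time]
  | some F => .inl (.sym (.pr F.pred)) :: (List.ofFn fun i => (F.args i).pat).flatten

/-- The word of a ground fact. -/
def factWord : Option (Fact Sg) → List (Letter Sg)
  | none => [.time]
  | some F => F.encode.map .sym

theorem factWord_some (F : Fact Sg) : factWord (some F) =
    .sym (.pr F.pred) :: (List.ofFn fun i => (F.args i).word).flatten := by
  simp only [factWord, Fact.encode, Term.word, List.map_cons, List.map_flatten, List.map_ofFn,
    Function.comp_def]

def Ground (o : Option (Fact Sg)) : Prop := ∀ F ∈ o, F.IsGround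

theorem fill_factPat (o : Option (Fact Sg)) {θ : Subst Sg} {e : Var Sg → List (Letter Sg)}
    (h : ∀ s x, .inr (.inl (s, x)) ∈ factPat o → e (.inl (s, x)) = (θ s x).word) :
    fill (factPat o) e = factWord (o.map (Fact.subst θ)) := by
  rcases o with - | F
  · rfl
  · simp only [factPat, Option.map_some, factWord_some, Fact.subst, fill_cons, Sum.elim_inl,
      List.cons_append, List.nil_append, fill_flatten, List.map_ofFn, Function.comp_def]
    congr 3
    funext i
    exact (F.args i).fill_pat fun s x hx => h s x (by
      simp only [factPat, List.mem_cons, List.mem_flatten]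
      exact .inr ⟨_, by simp, hx⟩)

theorem ground_subst (o : Option (Fact Sg)) {θ : Subst Sg} : Ground (o.map (Fact.subst θ)) ↔
    ∀ s x, .inr (.inl (s, x)) ∈ factPat o → (θ s x).IsGround := by
  rcases o with - | F
  · simp [Ground, factPat]
  · simp only [Ground, Option.map_some, Option.mem_some_iff, forall_eq', Fact.IsGround, Fact.subst,
      Term.isGround_subst, factPat, List.mem_cons, List.mem_flatten, List.mem_ofFn]
    constructor
    · rintro h s x (h' | ⟨_, ⟨i, rfl⟩, hx⟩)
      · simp at h'
      · exact h i s x hx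
    · intro h i s x hx
      exact h s x (.inr ⟨_, ⟨i, rfl⟩, hx⟩)

theorem fact_subst_congr (o : Option (Fact Sg)) {θ θ' : Subst Sg}
    (h : ∀ s x, .inr (.inl (s, x)) ∈ factPat o → θ s x = θ' s x) :
    o.map (Fact.subst θ) = o.map (Fact.subst θ') := by
  rcases o with - | F
  · rfl
  · simp only [Option.map_some, Fact.subst, Option.some.injEq]
    congr 1
    funext i
    exact (F.args i).subst_congr fun s x hx => h s x (by
      simp only [factPat, List.mem_cons, List.mem_flatten]
      exact .inr ⟨_, by simp, hx⟩)

theorem length_factWord {F : Fact Sg} (h : F.IsGround) : (factWord (some F)).length = F.size := by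
  simp only [factWord_some, Fact.size, List.length_cons, List.length_flatten, List.map_ofFn,
    Function.comp_def, List.sum_ofFn]
  rw [add_comm]
  congr 1
  exact Finset.sum_congr rfl fun i _ => Term.length_word (h i)

/-- The letters with which records begin. -/
def heads : Set (Letter Sg) := {a | a = .time ∨ ∃ P, a = .sym (.pr P)}

def bitLetters : Set (Letter Sg) := {a | ∃ b, a = .sym (.bit b)}

def fnLetters : Set (Letter Sg) := {a | ∃ f, a = .sym (.fn f)}

theorem factWord_eq (o : Option (Fact Sg)) :
    ∃ h b, factWord o = h :: b ∧ h ∈ heads ∧ (∀ a ∈ b, a ∈ fnLetters) := by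
  rcases o with - | F
  · exact ⟨_, [], rfl, .inl rfl, by simp⟩
  · refine ⟨_, _, factWord_some F, .inr ⟨_, rfl⟩, fun a ha => ?_⟩
    rw [List.mem_flatten] at ha
    obtain ⟨_, hl, ha⟩ := ha
    obtain ⟨i, rfl⟩ := (List.mem_ofFn' _ _).1 hl
    exact Term.mem_word ha

theorem factWord_inj {o o' : Option (Fact Sg)} (ho : Ground o) (ho' : Ground o')
    (h : factWord o = factWord o') : o = o' := by
  rcases o with - | ⟨P, args⟩ <;> rcases o' with - | ⟨P', args'⟩
  · rfl
  · rw [factWord_some] at h; simp [factWord] at h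
  · rw [factWord_some] at h; simp [factWord] at h
  · simp only [factWord_some, List.cons.injEq, Letter.sym.injEq, Sym.pr.injEq] at h
    obtain ⟨rfl, h⟩ := h
    obtain ⟨h₁, -⟩ := flatten_ofFn_inj (P := fun i => args i = args' i) (fun i u u' hi => by
      obtain ⟨h₁, h₂⟩ := (args i).word_inj (args' i) (ho _ rfl i) (ho' _ rfl i) u u' hi
      simp only [Sigma.mk.injEq, heq_eq_eq, true_and] at h₁
      exact ⟨h₁, h₂⟩) [] [] (by simpa using h)
    obtain rfl : args = args' := funext h₁
    rfl

theorem mem_num {n : ℕ} {a : Letter Sg} (h : a ∈ (num n : List (Letter Sg))) : a ∈ bitLetters := by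
  obtain ⟨b, -, rfl⟩ := List.mem_map.1 h
  exact ⟨b, rfl⟩

theorem bits_injective : Function.Injective Nat.bits := by
  intro n m h
  have := congrArg (fun l => Nat.ofDigits 2 (l.map fun b : Bool => cond b 1 0)) h
  simpa [← Nat.digits_two_eq_bits, Nat.ofDigits_digits] using this

theorem num_injective : Function.Injective (num : ℕ → List (Letter Sg)) :=
  fun _ _ h => bits_injective ((List.map_injective_iff.2 fun a b h => by simpa using h) h)

/-- The cut is forced: it lies just before the first letter in `s`, or at the end if there is none.
-/
theorem split_unique {α : Type*} {s : Set α} : ∀ {b b' v v' : List α}, (∀ a ∈ b, a ∉ s) →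
    (∀ a ∈ b', a ∉ s) → (∀ a ∈ v.head?, a ∈ s) → (∀ a ∈ v'.head?, a ∈ s) →
    b ++ v = b' ++ v' → b = b' ∧ v = v'
  | [], [], _, _, _, _, _, _, h => ⟨rfl, h⟩
  | [], c :: b', v, v', _, h₂, h₃, _, h => by
    rw [List.nil_append] at h
    subst h
    exact absurd (h₃ c (by simp)) (h₂ c (by simp))
  | c :: b, [], v, v', h₁, _, _, h₄, h => by
    rw [List.nil_append] at h
    subst h
    exact absurd (h₄ c (by simp)) (h₁ c (by simp))
  | c :: b, c' :: b', v, v', h₁, h₂, h₃, h₄, h => by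
    simp only [List.cons_append, List.cons.injEq] at h
    obtain ⟨rfl, h⟩ := h
    obtain ⟨rfl, rfl⟩ := split_unique (fun a ha => h₁ a (by simp [ha]))
      (fun a ha => h₂ a (by simp [ha])) h₃ h₄ h
    exact ⟨rfl, rfl⟩

/-- The word of a record. -/
def recWord (p : Rec Sg) : List (Letter Sg) := factWord p.1 ++ num p.2

theorem recWord_split {p : Rec Sg} {c n : List (Letter Sg)} (hc : ∀ a ∈ c, a ∉ bitLetters)
    (hn : ∀ a ∈ n, a ∈ bitLetters) (h : recWord p = c ++ n) : factWord p.1 = c ∧ num p.2 = n := by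
  obtain ⟨h', b, hb, hh, hbf⟩ := factWord_eq p.1
  refine split_unique ?_ hc (fun a ha => ?_) (fun a ha => hn a (List.mem_of_mem_head? ha)) h
  · rw [hb]
    rintro a (ha | ⟨_, ha⟩) ⟨b, rfl⟩
    · rcases hh with hh | ⟨P, hh⟩ <;> simp at hh
    · obtain ⟨f, hf⟩ := hbf _ (by assumption)
      simp at hf
  · exact mem_num (List.mem_of_mem_head? ha)

theorem factWord_not_bit {o : Option (Fact Sg)} : ∀ a ∈ factWord o, a ∉ bitLetters := by
  obtain ⟨h', b, hb, hh, hbf⟩ := factWord_eq o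
  rw [hb]
  intro a ha
  rcases List.mem_cons.1 ha with rfl | ha
  · rintro ⟨b, rfl⟩
    rcases hh with hh | ⟨P, hh⟩ <;> simp at hh
  · rintro ⟨b, rfl⟩
    obtain ⟨f, hf⟩ := hbf _ ha
    simp at hf

theorem recWord_inj {p q : Rec Sg} (hp : Ground p.1) (hq : Ground q.1)
    (h : recWord p = recWord q) : p = q := by
  obtain ⟨h₁, h₂⟩ := recWord_split factWord_not_bit (fun a => mem_num) h
  exact Prod.ext (factWord_inj hp hq h₁) (num_injective h₂)

theorem recWord_eq (p : Rec Sg) : ∃ h b, recWord p = h :: b ∧ h ∈ heads ∧ ∀ a ∈ b, a ∉ heads := by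
  obtain ⟨h, b, hb, hh, hbf⟩ := factWord_eq p.1
  refine ⟨h, b ++ num p.2, by rw [recWord, hb]; rfl, hh, fun a ha => ?_⟩
  rcases List.mem_append.1 ha with ha | ha
  · obtain ⟨f, rfl⟩ := hbf a ha
    rintro (h | ⟨P, h⟩) <;> simp at h
  · obtain ⟨f, rfl⟩ := mem_num ha
    rintro (h | ⟨P, h⟩) <;> simp at h

def flat (L : List (Rec Sg)) : List (Letter Sg) := L.flatMap recWord

@[simp] theorem flat_nil : flat ([] : List (Rec Sg)) = [] := rfl

@[simp] theorem flat_cons (p : Rec Sg) (L : List (Rec Sg)) : flat (p :: L) = recWord p ++ flat L :=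
  rfl

@[simp] theorem flat_append (L L' : List (Rec Sg)) : flat (L ++ L') = flat L ++ flat L' :=
  List.flatMap_append

theorem flat_head (L : List (Rec Sg)) : ∀ a ∈ (flat L).head?, a ∈ heads := by
  rcases L with - | ⟨p, L⟩
  · simp
  · obtain ⟨h, b, hb, hh, -⟩ := recWord_eq p
    simp [hb, hh]

/-- A word looks like a record. -/
def RecLike (r : List (Letter Sg)) : Prop := ∃ h b, r = h :: b ∧ h ∈ heads ∧ ∀ a ∈ b, a ∉ heads

/-- Heads occur only at the beginning of records. So a factor that starts with a head, contains no
other, and is followed by a head or by the end is exactly one of the listed records. -/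
theorem flat_eq_append {L : List (Rec Sg)} {u r v : List (Letter Sg)} (hr : RecLike r)
    (hv : ∀ a ∈ v.head?, a ∈ heads) (h : flat L = u ++ (r ++ v)) :
    ∃ L₁ p L₂, L = L₁ ++ p :: L₂ ∧ u = flat L₁ ∧ r = recWord p ∧ v = flat L₂ := by
  induction L generalizing u with
  | nil =>
    obtain ⟨a, b, rfl, -⟩ := hr
    simp at h
  | cons p L ih =>
    obtain ⟨a', b', hp, ha', hb'⟩ := recWord_eq p
    obtain ⟨a, b, rfl, ha, hb⟩ := hr
    rcases u with - | ⟨c, u⟩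
    · simp only [flat_cons, hp, List.cons_append, List.nil_append, List.cons.injEq] at h
      obtain ⟨rfl, h⟩ := h
      obtain ⟨rfl, rfl⟩ := split_unique hb' hb (flat_head L) hv h
      exact ⟨[], p, L, rfl, rfl, hp.symm, rfl⟩
    · simp only [flat_cons, hp, List.cons_append, List.cons.injEq] at h
      obtain ⟨rfl, h⟩ := h
      rcases List.append_eq_append_iff.1 h with ⟨u', rfl, h'⟩ | ⟨u', rfl, h'⟩
      · obtain ⟨L₁, q, L₂, rfl, rfl, h₁, h₂⟩ := ih h'
        exact ⟨p :: L₁, q, L₂, rfl, by simp [hp], h₁, h₂⟩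
      · rcases u' with - | ⟨c, u'⟩
        · obtain ⟨L₁, q, L₂, rfl, h₀, h₁, h₂⟩ := ih (u := []) (by simpa using h'.symm)
          exact ⟨p :: L₁, q, L₂, rfl, by simp [hp, ← h₀], h₁, h₂⟩
        · simp only [List.cons_append, List.cons.injEq] at h'
          obtain ⟨rfl, -⟩ := h'
          exact absurd ha (hb' _ (by simp))

/-- The word `x` lists the ground records of `M`. -/
def Codes (x : List (Letter Sg)) (M : Multiset (Rec Sg)) : Prop :=
  ∃ L : List (Rec Sg), (L : Multiset (Rec Sg)) = M ∧ (∀ p ∈ L, Ground p.1) ∧ flat L = x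

/-- The length of the words for a multiset of records. -/
def recLen (M : Multiset (Rec Sg)) : ℕ := (M.map fun p => (recWord p).length).sum

/-- The length does not depend on the order of the list, so space requirements can be stated for
configurations. -/
theorem Codes.length_eq {x : List (Letter Sg)} {M : Multiset (Rec Sg)} (h : Codes x M) :
    x.length = recLen M := by
  obtain ⟨L, rfl, -, rfl⟩ := h
  simp [flat, recLen, List.length_flatMap]

theorem Codes.ground {x : List (Letter Sg)} {M : Multiset (Rec Sg)} (h : Codes x M) {p : Rec Sg}
    (hp : p ∈ M) : Ground p.1 := by
  obtain ⟨L, rfl, h, rfl⟩ := h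
  exact h p (by simpa using hp)

theorem exists_codes {M : Multiset (Rec Sg)} (h : ∀ p ∈ M, Ground p.1) : ∃ x, Codes x M :=
  ⟨flat M.toList, M.toList, by simp, fun p hp => h p (by simpa using hp), rfl⟩

theorem Codes.cons {x : List (Letter Sg)} {M : Multiset (Rec Sg)} {p : Rec Sg} (h : Codes x M)
    (hp : Ground p.1) : Codes (recWord p ++ x) (p ::ₘ M) := by
  obtain ⟨L, rfl, h, rfl⟩ := h
  exact ⟨p :: L, rfl, by simpa using ⟨hp, fun a b => h (a, b)⟩, rfl⟩

theorem Codes.remove {u r v : List (Letter Sg)} {M : Multiset (Rec Sg)} (h : Codes (u ++ (r ++ v)) M)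
    (hr : RecLike r) (hv : ∀ a ∈ v.head?, a ∈ heads) :
    ∃ p M', M = p ::ₘ M' ∧ r = recWord p ∧ Codes (u ++ v) M' := by
  obtain ⟨L, rfl, h, hL⟩ := h
  obtain ⟨L₁, p, L₂, rfl, rfl, rfl, rfl⟩ := flat_eq_append hr hv hL
  refine ⟨p, (L₁ ++ L₂ : List (Rec Sg)), ?_, rfl, L₁ ++ L₂, rfl, fun q hq => h q ?_, by simp⟩
  · rw [Multiset.cons_coe, Multiset.coe_eq_coe]
    exact List.perm_middle
  · simp only [List.mem_append, List.mem_cons] at hq ⊢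
    tauto

theorem Codes.exists_remove {x : List (Letter Sg)} {M : Multiset (Rec Sg)} {p : Rec Sg}
    (h : Codes x (p ::ₘ M)) : ∃ u v, x = u ++ (recWord p ++ v) ∧ (∀ a ∈ v.head?, a ∈ heads) ∧
      Codes (u ++ v) M := by
  obtain ⟨L, hL, h, rfl⟩ := h
  have hp : p ∈ L := by
    rw [← Multiset.mem_coe, hL]; exact Multiset.mem_cons_self p M
  obtain ⟨L₁, L₂, rfl⟩ := List.append_of_mem hp
  refine ⟨flat L₁, flat L₂, by simp, flat_head L₂, L₁ ++ L₂, ?_, fun q hq => h q ?_, by simp⟩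
  · rw [← Multiset.cons_inj_right p, ← hL, Multiset.cons_coe, Multiset.coe_eq_coe]
    exact List.perm_middle.symm
  · simp only [List.mem_append, List.mem_cons] at hq ⊢
    tauto

end TimedMSR

namespace TimedMSR

open StackProg

variable {Sg : Alphabet} {ι : Type}

/-! ### Binary numbers -/

/-- The least significant bit comes first. The leading ones turn into zeros, and the carry then
either meets a zero or lengthens the numeral. -/
theorem bits_succ (n : ℕ) :
    (∃ k u, Nat.bits n = List.replicate k true ++ false :: u ∧
      Nat.bits (n + 1) = List.replicate k false ++ true :: u) ∨
    ∃ k, Nat.bits n = List.replicate k true ∧ Nat.bits (n + 1) = List.replicate k false ++ [true] := by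
  induction n using Nat.strong_induction_on with
  | _ n ih =>
    rcases Nat.eq_zero_or_pos n with rfl | hn
    · exact .inr ⟨0, by simp, by simp⟩
    obtain ⟨m, rfl | rfl⟩ := Nat.even_or_odd' n
    · exact .inl ⟨0, m.bits, by simp [Nat.bit0_bits m (by omega)], by simp⟩
    · have e : 2 * m + 1 + 1 = 2 * (m + 1) := by ring
      rw [e, Nat.bit0_bits (m + 1) (by omega), Nat.bit1_bits]
      rcases ih m (by omega) with ⟨k, u, h₁, h₂⟩ | ⟨k, h₁, h₂⟩
      · exact .inl ⟨k + 1, u, by rw [h₁]; rfl, by rw [h₂]; rfl⟩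
      · exact .inr ⟨k + 1, by rw [h₁]; rfl, by rw [h₂]; rfl⟩

def bitOne : Letter Sg := .sym (.bit true)
def bitZero : Letter Sg := .sym (.bit false)

theorem num_succ (n : ℕ) :
    (∃ k u, (num n : List (Letter Sg)) = List.replicate k bitOne ++ bitZero :: u ∧
      (num (n + 1) : List (Letter Sg)) = List.replicate k bitZero ++ bitOne :: u) ∨
    ∃ k, (num n : List (Letter Sg)) = List.replicate k bitOne ∧
      (num (n + 1) : List (Letter Sg)) = List.replicate k bitZero ++ [bitOne] := by
  rcases bits_succ n with ⟨k, u, h₁, h₂⟩ | ⟨k, h₁, h₂⟩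
  · refine .inl ⟨k, u.map fun b => .sym (.bit b), ?_, ?_⟩ <;>
      simp [num, h₁, h₂, bitOne, bitZero]
  · exact .inr ⟨k, by simp [num, h₁, bitOne], by simp [num, h₂, bitOne, bitZero]⟩

theorem bitOne_ne : (bitOne : Letter Sg) ≠ bitZero := by simp [bitOne, bitZero]

theorem length_num_mono {n m : ℕ} (h : n ≤ m) :
    (num n : List (Letter Sg)).length ≤ (num m : List (Letter Sg)).length := by
  simp only [num, List.length_map, Nat.size_eq_bits_len]
  exact Nat.size_le_size h

theorem length_num_succ (n : ℕ) :
    (num (n + 1) : List (Letter Sg)).length ≤ (num n : List (Letter Sg)).length + 1 := by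
  rcases num_succ (Sg := Sg) n with ⟨k, u, h₁, h₂⟩ | ⟨k, h₁, h₂⟩ <;> rw [h₁, h₂] <;> simp

theorem length_num_add (n d : ℕ) :
    (num (n + d) : List (Letter Sg)).length ≤ (num n : List (Letter Sg)).length + d := by
  induction d with
  | zero => simp
  | succ d ih => exact (length_num_succ (n + d)).trans (by omega)

/-- Binary increment. -/
def incF (N : ℕ) (x y : List (Letter Sg)) : Prop :=
  ∃ a : List (Letter Sg), a.length ≤ N ∧ ∃ b : List (Letter Sg), b.length ≤ N ∧
    (a.length ≤ b.length ∧ b.length ≤ a.length) ∧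
    ((∀ c ∈ a, c ∉ ({bitOne}ᶜ : Set (Letter Sg))) ∧ ∀ c ∈ b, c ∉ ({bitZero}ᶜ : Set (Letter Sg))) ∧
    ((∃ u : List (Letter Sg), u.length ≤ N ∧ x = a ++ bitZero :: u ∧ y = b ++ bitOne :: u) ∨
      (x = a ∧ y = b ++ [bitOne]))

theorem def_incF (i j : ι) : Def fun N (e : ι → List (Letter Sg)) => incF N (e i) (e j) := by
  refine Def.ex (Def.ex (((Def.lenLe _ _).and (Def.lenLe _ _)).and (((Def.avoid _ _).and
    (Def.avoid _ _)).and (Def.or (Def.ex (Def.and ?_ ?_)) (Def.and (Def.eq _ _) ?_)))))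
  · exact (Def.word [.inr (some (some none)), .inl bitZero, .inr none] (some (some (some i)))).congr fun N e _ => by simp
  · exact (Def.word [.inr (some none), .inl bitOne, .inr none] (some (some (some j)))).congr fun N e _ => by simp
  · exact (Def.word [.inr none, .inl bitOne] (some (some j))).congr fun N e _ => by simp

theorem eq_replicate_of_forall {α : Type*} {a : List α} {c : α} (h : ∀ d ∈ a, d ∉ ({c}ᶜ : Set α)) :
    a = List.replicate a.length c :=
  List.eq_replicate_iff.2 ⟨rfl, fun d hd => by simpa using h d hd⟩

theorem incF_num {N n : ℕ} {y : List (Letter Sg)} (h : incF N (num n) y) : y = num (n + 1) := by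
  obtain ⟨a, -, b, -, ⟨hl, hl'⟩, ⟨ha, hb⟩, h⟩ := h
  have hb' := eq_replicate_of_forall hb
  have hab : b.length = a.length := le_antisymm hl' hl
  rw [hab] at hb'
  rcases num_succ (Sg := Sg) n with ⟨k, u, h₁, h₂⟩ | ⟨k, h₁, h₂⟩
  · rcases h with ⟨u', -, hx, rfl⟩ | ⟨hx, rfl⟩
    · rw [h₁] at hx
      obtain ⟨e₁, e₂⟩ := split_unique (s := ({bitOne}ᶜ : Set (Letter Sg)))
        (by simp [List.mem_replicate]) ha (by simp [bitOne_ne.symm]) (by simp [bitOne_ne.symm]) hx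
      have : a.length = k := by rw [← e₁]; simp
      rw [h₂, hb', this]
      simpa using e₂.symm
    · rw [h₁] at hx
      have := ha bitZero (by rw [← hx]; simp)
      simp [bitOne_ne.symm] at this
  · rcases h with ⟨u', -, hx, rfl⟩ | ⟨hx, rfl⟩
    · rw [h₁] at hx
      have : bitZero ∈ List.replicate k (bitOne : Letter Sg) := by rw [hx]; simp
      exact absurd (List.eq_of_mem_replicate this) bitOne_ne.symm
    · have : a.length = k := by rw [← hx, h₁]; simp
      rw [h₂, hb', this]

theorem incF_succ {N n : ℕ} (h : (num (n + 1) : List (Letter Sg)).length ≤ N) :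
    incF N (num n : List (Letter Sg)) (num (n + 1)) := by
  rcases num_succ (Sg := Sg) n with ⟨k, u, h₁, h₂⟩ | ⟨k, h₁, h₂⟩ <;> rw [h₂] at h <;>
    simp only [List.length_append, List.length_replicate, List.length_cons] at h
  · exact ⟨_, by simp; omega, List.replicate k bitZero, by simp; omega, by simp,
      by simp [List.mem_replicate], .inl ⟨u, by omega, h₁, h₂⟩⟩
  · exact ⟨_, by simp; omega, List.replicate k bitZero, by simp; omega, by simp,
      by simp [List.mem_replicate], .inr ⟨h₁, h₂⟩⟩

/-- Comparison of binary numbers. -/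
def leF (N : ℕ) (x y : List (Letter Sg)) : Prop := TC N (incF N) x y

theorem def_leF (i j : ι) : Def fun N (e : ι → List (Letter Sg)) => leF N (e i) (e j) :=
  Def.tc (R := fun N _ => incF N) i j (def_incF _ _)

theorem leF_num {N n : ℕ} {y : List (Letter Sg)} (h : leF N (num n) y) : ∃ m, n ≤ m ∧ y = num m := by
  induction h with
  | refl => exact ⟨n, le_rfl, rfl⟩
  | tail _ h ih =>
    obtain ⟨m, hm, rfl⟩ := ih
    exact ⟨m + 1, by omega, incF_num h.2.2⟩

theorem leF_of_le {N n m : ℕ} (hnm : n ≤ m) (h : (num m : List (Letter Sg)).length ≤ N) :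
    leF N (num n : List (Letter Sg)) (num m) := by
  induction m, hnm using Nat.le_induction with
  | base => exact .refl
  | succ m _ ih =>
    have := length_num_mono (Sg := Sg) (Nat.le_succ m)
    exact (ih (this.trans h)).tail ⟨this.trans h, h, incF_succ h⟩

theorem leF_num_iff {N n m : ℕ} (h : (num m : List (Letter Sg)).length ≤ N) :
    leF N (num n : List (Letter Sg)) (num m) ↔ n ≤ m := by
  refine ⟨fun h' => ?_, fun h' => leF_of_le h' h⟩
  obtain ⟨m', h₁, h₂⟩ := leF_num h'
  rwa [num_injective h₂]

/-- The word is a binary number. -/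
def numF (N : ℕ) (x : List (Letter Sg)) : Prop :=
  ∃ z : List (Letter Sg), z.length ≤ N ∧ z = [] ∧ leF N z x

theorem def_numF (i : ι) : Def fun N (e : ι → List (Letter Sg)) => numF N (e i) :=
  Def.ex (((Def.word [] none).congr fun N e _ => by simp).and (def_leF _ _))

theorem numF_iff {N : ℕ} {x : List (Letter Sg)} (h : x.length ≤ N) : numF N x ↔ ∃ n, x = num n := by
  constructor
  · rintro ⟨_, -, rfl, h⟩
    obtain ⟨m, -, h⟩ := leF_num (n := 0) (by simpa [num] using h)
    exact ⟨m, h⟩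
  · rintro ⟨n, rfl⟩
    refine ⟨[], by simp, rfl, ?_⟩
    have := leF_of_le (Nat.zero_le n) h
    simpa [num] using this

/-- Addition of a constant. -/
def plusF : ℕ → ℕ → List (Letter Sg) → List (Letter Sg) → Prop
  | 0, _, x, y => y = x
  | d + 1, N, x, y => ∃ z : List (Letter Sg), z.length ≤ N ∧ plusF d N x z ∧ incF N z y

theorem def_plusF (d : ℕ) (i j : ι) :
    Def fun N (e : ι → List (Letter Sg)) => plusF d N (e i) (e j) := by
  induction d generalizing ι with
  | zero => exact Def.eq _ _
  | succ d ih => exact Def.ex ((ih _ _).and (def_incF _ _))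

theorem plusF_num {d N n : ℕ} {y : List (Letter Sg)} (h : plusF d N (num n) y) :
    y = num (n + d) := by
  induction d generalizing y with
  | zero => exact h
  | succ d ih =>
    obtain ⟨z, -, h₁, h₂⟩ := h
    rw [ih h₁] at h₂
    exact incF_num h₂

theorem plusF_add {d N n : ℕ} (h : (num (n + d) : List (Letter Sg)).length ≤ N) :
    plusF d N (num n : List (Letter Sg)) (num (n + d)) := by
  induction d with
  | zero => rfl
  | succ d ih =>
    have := (length_num_mono (Sg := Sg) (Nat.le_succ (n + d))).trans h
    exact ⟨_, this, ih this, incF_succ h⟩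

/-! ### Recognition of terms -/

/-- Contraction of a function symbol applied to sorts. -/
def redF (N : ℕ) (x y : List (Letter Sg)) : Prop :=
  ∃ f ∈ (Set.univ : Set Sg.Fn), ∃ u : List (Letter Sg), u.length ≤ N ∧
    ∃ v : List (Letter Sg), v.length ≤ N ∧
      x = u ++ (.sym (.fn f) :: List.ofFn fun i => Letter.sort (Sg.fnArg f i)) ++ v ∧
      y = u ++ [.sort (Sg.fnRes f)] ++ v

theorem fill_map_inl {V G : Type} (w : List G) (e : V → List G) : fill (w.map .inl) e = w := by
  induction w with
  | nil => rfl
  | cons a w ih => simp [ih]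

theorem def_redF (i j : ι) : Def fun N (e : ι → List (Letter Sg)) => redF N (e i) (e j) := by
  have := Sg.finite_fn
  refine Def.exMem Set.finite_univ fun f _ => Def.ex (Def.ex (Def.and ?_ ?_))
  · exact (Def.word ([.inr (some none)] ++ (.inl (.sym (.fn f)) ::
      (List.ofFn fun i => Letter.sort (Sg.fnArg f i)).map .inl) ++ [.inr none]) (some (some i))).congr
      fun N e _ => by simp [fill_map_inl, -List.map_ofFn]
  · exact (Def.word [.inr (some none), .inl (.sort (Sg.fnRes f)), .inr none] (some (some j))).congr
      fun N e _ => by simp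

/-- The word is a ground term of sort `s`. -/
def termF (s : Sg.Srt) (N : ℕ) (x : List (Letter Sg)) : Prop :=
  (∀ a ∈ x, a ∉ (fnLetters : Set (Letter Sg))ᶜ) ∧
    ∃ z : List (Letter Sg), z.length ≤ N ∧ z = [.sort s] ∧ TC N (redF N) x z

theorem def_termF (s : Sg.Srt) (i : ι) :
    Def fun N (e : ι → List (Letter Sg)) => termF s N (e i) :=
  (Def.avoid _ _).and (Def.ex (((Def.word [.inl (.sort s)] none).congr fun N e _ => by simp).and
    (Def.tc (R := fun N _ => redF N) _ _ (def_redF _ _))))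

/-- A letter stands for a word: a sort for any ground term of that sort, any other letter for
itself. -/
def Stands : Letter Sg → List (Letter Sg) → Prop
  | .sort s, x => ∃ t : Term Sg s, t.IsGround ∧ x = t.word
  | a, x => x = [a]

/-- A word whose sorts stand for ground terms. -/
def Expands : List (Letter Sg) → List (Letter Sg) → Prop
  | [], x => x = []
  | a :: z, x => ∃ p x', Stands a p ∧ x = p ++ x' ∧ Expands z x'

theorem expands_append {u v x : List (Letter Sg)} :
    Expands (u ++ v) x ↔ ∃ y z, x = y ++ z ∧ Expands u y ∧ Expands v z := by
  induction u generalizing x with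
  | nil => simp [Expands]
  | cons a u ih =>
    simp only [List.cons_append, Expands, ih]
    constructor
    · rintro ⟨p, _, ha, rfl, y, z, rfl, h₁, h₂⟩
      exact ⟨p ++ y, z, by simp, ⟨p, y, ha, rfl, h₁⟩, h₂⟩
    · rintro ⟨_, z, rfl, ⟨p, y, ha, rfl, h₁⟩, h₂⟩
      exact ⟨p, y ++ z, ha, by simp, y, z, rfl, h₁, h₂⟩

theorem expands_ofFn {n : ℕ} {g : Fin n → Letter Sg} {x : List (Letter Sg)}
    (h : Expands (List.ofFn g) x) :
    ∃ p : Fin n → List (Letter Sg), (∀ i, Stands (g i) (p i)) ∧ x = (List.ofFn p).flatten := by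
  induction n generalizing x with
  | zero => exact ⟨fun _ => [], fun i => i.elim0, by simpa [Expands] using h⟩
  | succ n ih =>
    rw [List.ofFn_succ] at h
    obtain ⟨p, x', h₁, rfl, h₂⟩ := h
    obtain ⟨q, hq, rfl⟩ := ih h₂
    exact ⟨Fin.cons p q, Fin.cases h₁ hq, by simp [List.ofFn_succ]⟩

theorem expands_self {x : List (Letter Sg)} (h : ∀ a ∈ x, a ∉ (fnLetters : Set (Letter Sg))ᶜ) :
    Expands x x := by
  induction x with
  | nil => rfl
  | cons a x ih =>
    refine ⟨[a], x, ?_, rfl, ih fun b hb => h b (by simp [hb])⟩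
    have := h a (by simp)
    simp only [Set.mem_compl_iff, not_not] at this
    obtain ⟨f, rfl⟩ := this
    rfl

/-- The terms for which the sorts of the arguments stand become the arguments of a single term, for
which the sort of the result stands. -/
theorem Expands.red {N : ℕ} {x y X : List (Letter Sg)} (h : Expands x X) (hr : redF N x y) :
    Expands y X := by
  obtain ⟨f, -, u, -, v, -, rfl, rfl⟩ := hr
  rw [expands_append] at h
  obtain ⟨A, V, rfl, h, hV⟩ := h
  rw [expands_append] at h
  obtain ⟨U, B, rfl, hU, p, x', hp, rfl, hB⟩ := h
  obtain ⟨q, hq, rfl⟩ := expands_ofFn hB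
  choose t ht₁ ht₂ using hq
  rw [expands_append]
  obtain rfl : p = [.sym (.fn f)] := hp
  obtain rfl : q = fun i => (t i).word := funext ht₂
  exact ⟨_, V, rfl, expands_append.2 ⟨U, _, rfl, hU, _, [], ⟨.app f t, ht₁, rfl⟩,
    by simp [Term.word_app], rfl⟩, hV⟩

/-- Every word of the reduction expands to the original word. The last one is a single sort, and so
the original word is a term of this sort. -/
theorem termF_sound {s : Sg.Srt} {N : ℕ} {x : List (Letter Sg)} (h : termF s N x) :
    ∃ t : Term Sg s, t.IsGround ∧ x = t.word := by
  obtain ⟨hx, z, -, rfl, h⟩ := h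
  have key : ∀ y, TC N (redF N) x y → Expands y x := by
    intro y hy
    induction hy with
    | refl => exact expands_self hx
    | tail _ h ih => exact ih.red h.2.2
  obtain ⟨_, _, ⟨t, ht, rfl⟩, hx, rfl⟩ := key _ h
  exact ⟨t, ht, by simpa using hx⟩

theorem _root_.StackProg.TC.length_le {G : Type} {N : ℕ} {r : List G → List G → Prop} {x y : List G} (h : TC N r x y)
    (hx : x.length ≤ N) : y.length ≤ N := by
  induction h with
  | refl => exact hx
  | tail _ h _ => exact h.2.1

/-- The arguments are contracted from left to right, and the context `u` collects the sorts already
obtained. -/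
theorem tc_flatten {N n : ℕ} {a : Fin n → List (Letter Sg)} {b : Fin n → Letter Sg}
    (h : ∀ i (u v : List (Letter Sg)), (u ++ a i ++ v).length ≤ N →
      TC N (redF N) (u ++ a i ++ v) (u ++ [b i] ++ v)) (u v : List (Letter Sg))
    (hl : (u ++ (List.ofFn a).flatten ++ v).length ≤ N) :
    TC N (redF N) (u ++ (List.ofFn a).flatten ++ v) (u ++ List.ofFn b ++ v) := by
  induction n generalizing u with
  | zero => simpa using .refl
  | succ n ih =>
    simp only [List.ofFn_succ, List.flatten_cons] at hl ⊢
    have h₁ := h 0 u ((List.ofFn fun i => a (Fin.succ i)).flatten ++ v) (by simpa using hl)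
    have h₂ := ih (a := fun i => a i.succ) (b := fun i => b i.succ) (fun i => h i.succ) (u ++ [b 0])
      (by simpa using TC.length_le h₁ (by simpa using hl))
    simp only [List.append_assoc, List.cons_append, List.nil_append] at h₁ h₂ ⊢
    exact h₁.trans h₂

theorem tc_word {N : ℕ} {s : Sg.Srt} (t : Term Sg s) (ht : t.IsGround) (u v : List (Letter Sg))
    (hl : (u ++ t.word ++ v).length ≤ N) :
    TC N (redF N) (u ++ t.word ++ v) (u ++ [.sort s] ++ v) := by
  induction t generalizing u v with
  | var s x => exact ht.elim
  | app f args ih =>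
    have h₁ := tc_flatten (a := fun i => (args i).word) (b := fun i => .sort (Sg.fnArg f i))
      (fun i => ih i (ht i)) (u ++ [.sym (.fn f)]) v (by simpa [Term.word_app] using hl)
    have h₂ := TC.length_le h₁ (by simpa [Term.word_app] using hl)
    rw [Term.word_app]
    simp only [List.append_assoc, List.cons_append, List.nil_append] at h₁ ⊢
    refine h₁.tail ⟨by simpa using h₂, ?_, f, trivial, u, ?_, v, ?_, by simp, by simp⟩
    all_goals simp at h₂ ⊢; omega

theorem termF_iff {s : Sg.Srt} {N : ℕ} {x : List (Letter Sg)} (hN : x.length ≤ N) :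
    termF s N x ↔ ∃ t : Term Sg s, t.IsGround ∧ x = t.word := by
  refine ⟨termF_sound, ?_⟩
  rintro ⟨t, ht, rfl⟩
  have h := tc_word t ht [] [] (N := N) (by simpa using hN)
  have h' := TC.length_le h (by simpa using hN)
  refine ⟨fun a ha => ?_, _, by simpa using h', rfl, by simpa using h⟩
  exact fun h => h (Term.mem_word ha)

end TimedMSR

/-! ### Matching and rewriting of records as definable relations -/

namespace TimedMSR

open StackProg

variable {Sg : Alphabet} {ι : Type}

/-- A fact with variables (`none` stands for `Time`) at the time `T + D`, where `T` is a time
variable. -/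
structure Item (Sg : Alphabet) where
  fact : Option (Fact Sg)
  tvar : ℕ
  shift : ℕ

namespace Item

def inst (θ : Subst Sg) (τ : ℕ → ℕ) (p : Item Sg) : Rec Sg :=
  (p.fact.map (Fact.subst θ), τ p.tvar + p.shift)

/-- The word of the item, up to its shift. -/
def pat (p : Item Sg) : Pat Sg := factPat p.fact ++ [.inr (.inr p.tvar)]

end Item

/-- The string environment `e` represents the substitutions `θ` and `τ` on the variables in `V`. -/
def Represents (V : Set (Var Sg)) (e : Var Sg → List (Letter Sg)) (θ : Subst Sg) (τ : ℕ → ℕ) : Prop :=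
  (∀ s x, .inl (s, x) ∈ V → (θ s x).IsGround ∧ e (.inl (s, x)) = (θ s x).word) ∧
    ∀ t, .inr t ∈ V → e (.inr t) = num (τ t)

def vars (l : List (Item Sg)) : Set (Var Sg) := {v | ∃ p ∈ l, .inr v ∈ p.pat}

theorem vars_cons (p : Item Sg) (l : List (Item Sg)) : vars (p :: l) = {v | .inr v ∈ p.pat} ∪ vars l := by
  ext v
  simp [vars]

theorem finite_vars (l : List (Item Sg)) : (vars l).Finite := by
  induction l with
  | nil => simp [vars]
  | cons p l ih =>
    rw [vars_cons]
    refine Set.Finite.union ?_ ih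
    exact Set.Finite.preimage Sum.inr_injective.injOn p.pat.finite_toSet

theorem Represents.mono {V V' : Set (Var Sg)} {e : Var Sg → List (Letter Sg)} {θ : Subst Sg}
    {τ : ℕ → ℕ} (h : Represents V e θ τ) (hV : V' ⊆ V) : Represents V' e θ τ :=
  ⟨fun s x hx => h.1 s x (hV hx), fun t ht => h.2 t (hV ht)⟩

section
variable {N : ℕ} {p : Item Sg} {l : List (Item Sg)} {e : Var Sg → List (Letter Sg)} {θ : Subst Sg}
  {τ : ℕ → ℕ}

theorem Represents.fill (h : Represents {v | .inr v ∈ p.pat} e θ τ) :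
    fill (factPat p.fact) e = factWord (p.inst θ τ).1 :=
  fill_factPat _ fun s x hx => (h.1 s x (by simp [Item.pat, hx])).2

theorem Represents.tvar (h : Represents {v | .inr v ∈ p.pat} e θ τ) : e (.inr p.tvar) = num (τ p.tvar) :=
  h.2 _ (by simp [Item.pat])

theorem Represents.ground (h : Represents {v | .inr v ∈ p.pat} e θ τ) : Ground (p.inst θ τ).1 :=
  (ground_subst _).2 fun s x hx => (h.1 s x (by simp [Item.pat, hx])).1

/-- The word is the record of an instance of the item. -/
def recF (p : Item Sg) (N : ℕ) (e : Var Sg → List (Letter Sg)) (r : List (Letter Sg)) : Prop :=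
  ∃ n : List (Letter Sg), n.length ≤ N ∧ plusF p.shift N (e (.inr p.tvar)) n ∧
    r = fill (factPat p.fact) e ++ n

theorem fill_map {V W G : Type} (w : List (G ⊕ V)) (f : V → W) (e : W → List G) :
    fill (w.map (Sum.map id f)) e = fill w fun v => e (f v) := by
  induction w with
  | nil => rfl
  | cons a w ih => rcases a with a | v <;> simp [ih]

theorem def_recF (p : Item Sg) (a : Var Sg → ι) (i : ι) :
    Def fun N (e : ι → List (Letter Sg)) => recF p N (fun v => e (a v)) (e i) :=
  Def.ex ((def_plusF _ _ _).and ((Def.word ((factPat p.fact).map (Sum.map id fun v => some (a v)) ++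
    [.inr none]) (some i)).congr fun N e _ => by simp [fill_map]))

theorem recF_sound {r : List (Letter Sg)} (h : Represents {v | .inr v ∈ p.pat} e θ τ)
    (hr : recF p N e r) : r = recWord (p.inst θ τ) := by
  obtain ⟨n, -, h₁, rfl⟩ := hr
  rw [h.tvar] at h₁
  rw [h.fill, plusF_num h₁]
  rfl

theorem recF_complete (h : Represents {v | .inr v ∈ p.pat} e θ τ)
    (hN : (recWord (p.inst θ τ)).length ≤ N) : recF p N e (recWord (p.inst θ τ)) := by
  rw [recWord, List.length_append] at hN
  refine ⟨num (τ p.tvar + p.shift), by simp only [Item.inst] at hN; omega, ?_, by rw [h.fill]; rfl⟩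
  rw [h.tvar]
  exact plusF_add (by simp only [Item.inst] at hN; omega)

/-- Removal of an instance of the item. -/
def removeF (p : Item Sg) (N : ℕ) (e : Var Sg → List (Letter Sg)) (x y : List (Letter Sg)) : Prop :=
  ∃ u : List (Letter Sg), u.length ≤ N ∧ ∃ r : List (Letter Sg), r.length ≤ N ∧
    ∃ v : List (Letter Sg), v.length ≤ N ∧ recF p N e r ∧ (∀ a ∈ v.head?, a ∈ heads) ∧
      x = u ++ (r ++ v) ∧ y = u ++ v

theorem def_removeF (p : Item Sg) (a : Var Sg → ι) (i j : ι) :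
    Def fun N (e : ι → List (Letter Sg)) => removeF p N (fun v => e (a v)) (e i) (e j) := by
  refine Def.ex (Def.ex (Def.ex ((def_recF p (fun v => some (some (some (a v)))) _).and
    ((Def.startsIn _ _).and (Def.and ?_ ?_)))))
  · exact (Def.word [.inr (some (some none)), .inr (some none), .inr none]
      (some (some (some i)))).congr fun N e _ => by simp
  · exact Def.cat _ _ _

theorem removeF_sound {x y : List (Letter Sg)} {M : Multiset (Rec Sg)} (hx : Codes x M)
    (h : Represents {v | .inr v ∈ p.pat} e θ τ) (hr : removeF p N e x y) :
    ∃ M', M = p.inst θ τ ::ₘ M' ∧ Codes y M' := by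
  obtain ⟨u, -, r, -, v, -, hr, hv, rfl, rfl⟩ := hr
  obtain rfl := recF_sound h hr
  obtain ⟨q, M', rfl, hq, hM'⟩ := hx.remove (recWord_eq _) hv
  rw [recWord_inj h.ground (hx.ground (Multiset.mem_cons_self _ _)) hq]
  exact ⟨M', rfl, hM'⟩

theorem removeF_complete {x : List (Letter Sg)} {M : Multiset (Rec Sg)}
    (hx : Codes x (p.inst θ τ ::ₘ M)) (hN : x.length ≤ N)
    (h : Represents {v | .inr v ∈ p.pat} e θ τ) : ∃ y, removeF p N e x y ∧ Codes y M := by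
  obtain ⟨u, v, rfl, hv, hM⟩ := hx.exists_remove
  simp only [List.length_append] at hN
  exact ⟨u ++ v, ⟨u, by omega, _, by omega, v, by omega, recF_complete h (by omega), hv, rfl, rfl⟩, hM⟩

/-- Removal of instances of the items. -/
def matchF : List (Item Sg) → ℕ → (Var Sg → List (Letter Sg)) → List (Letter Sg) →
    List (Letter Sg) → Prop
  | [], _, _, x, y => y = x
  | p :: l, N, e, x, y => ∃ z : List (Letter Sg), z.length ≤ N ∧ removeF p N e x z ∧ matchF l N e z y

theorem def_matchF (l : List (Item Sg)) (a : Var Sg → ι) (i j : ι) :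
    Def fun N (e : ι → List (Letter Sg)) => matchF l N (fun v => e (a v)) (e i) (e j) := by
  induction l generalizing ι with
  | nil => exact Def.eq _ _
  | cons p l ih => exact Def.ex ((def_removeF p (fun v => some (a v)) _ _).and
      (ih (fun v => some (a v)) _ _))

def insts (θ : Subst Sg) (τ : ℕ → ℕ) (l : List (Item Sg)) : Multiset (Rec Sg) :=
  (l.map (Item.inst θ τ) : List (Rec Sg))

theorem insts_cons : insts θ τ (p :: l) = p.inst θ τ ::ₘ insts θ τ l := rfl

theorem matchF_sound {x y : List (Letter Sg)} {M : Multiset (Rec Sg)} (hx : Codes x M)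
    (h : Represents (vars l) e θ τ) (hr : matchF l N e x y) :
    ∃ M', M = insts θ τ l + M' ∧ Codes y M' := by
  induction l generalizing x M with
  | nil => exact ⟨M, by simp [insts], hr ▸ hx⟩
  | cons p l ih =>
    rw [vars_cons] at h
    obtain ⟨z, -, h₁, h₂⟩ := hr
    obtain ⟨M₁, rfl, hz⟩ := removeF_sound hx (h.mono Set.subset_union_left) h₁
    obtain ⟨M₂, rfl, hy⟩ := ih hz (h.mono Set.subset_union_right) h₂
    exact ⟨M₂, by rw [insts_cons, Multiset.cons_add], hy⟩

theorem recLen_cons (q : Rec Sg) (M : Multiset (Rec Sg)) :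
    recLen (q ::ₘ M) = (recWord q).length + recLen M := by simp [recLen]

theorem recLen_add (M M' : Multiset (Rec Sg)) : recLen (M + M') = recLen M + recLen M' := by
  simp [recLen]

theorem matchF_complete {x : List (Letter Sg)} {M : Multiset (Rec Sg)}
    (hx : Codes x (insts θ τ l + M)) (hN : x.length ≤ N) (h : Represents (vars l) e θ τ) :
    ∃ y, matchF l N e x y ∧ Codes y M := by
  induction l generalizing x with
  | nil => exact ⟨x, rfl, by simpa [insts] using hx⟩
  | cons p l ih =>
    rw [vars_cons] at h
    rw [insts_cons, Multiset.cons_add] at hx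
    obtain ⟨z, h₁, hz⟩ := removeF_complete hx hN (h.mono Set.subset_union_left)
    have hlz : z.length ≤ N := by
      rw [hx.length_eq, recLen_cons] at hN
      rw [hz.length_eq]
      omega
    obtain ⟨y, h₂, hy⟩ := ih hz hlz (h.mono Set.subset_union_right)
    exact ⟨y, ⟨z, hlz, h₁, h₂⟩, hy⟩

/-- Insertion of instances of the items. -/
def insertF : List (Item Sg) → ℕ → (Var Sg → List (Letter Sg)) → List (Letter Sg) →
    List (Letter Sg) → Prop
  | [], _, _, x, y => y = x
  | p :: l, N, e, x, y => ∃ z : List (Letter Sg), z.length ≤ N ∧ insertF l N e x z ∧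
      ∃ r : List (Letter Sg), r.length ≤ N ∧ recF p N e r ∧ y = r ++ z

theorem def_insertF (l : List (Item Sg)) (a : Var Sg → ι) (i j : ι) :
    Def fun N (e : ι → List (Letter Sg)) => insertF l N (fun v => e (a v)) (e i) (e j) := by
  induction l generalizing ι with
  | nil => exact Def.eq _ _
  | cons p l ih => exact Def.ex ((ih (fun v => some (a v)) _ _).and
      (Def.ex ((def_recF p (fun v => some (some (a v))) _).and (Def.cat _ _ _))))

theorem insertF_sound {x y : List (Letter Sg)} {M : Multiset (Rec Sg)} (hx : Codes x M)
    (h : Represents (vars l) e θ τ) (hr : insertF l N e x y) : Codes y (insts θ τ l + M) := by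
  induction l generalizing y with
  | nil => obtain rfl : y = x := hr; simpa [insts] using hx
  | cons p l ih =>
    rw [vars_cons] at h
    obtain ⟨z, -, h₁, r, -, h₂, rfl⟩ := hr
    obtain rfl := recF_sound (h.mono Set.subset_union_left) h₂
    rw [insts_cons, Multiset.cons_add]
    exact (ih (h.mono Set.subset_union_right) h₁).cons (h.mono Set.subset_union_left).ground

theorem insertF_complete {x : List (Letter Sg)} {M : Multiset (Rec Sg)} (hx : Codes x M)
    (h : Represents (vars l) e θ τ) (hN : recLen (insts θ τ l + M) ≤ N) :
    ∃ y, insertF l N e x y := by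
  induction l with
  | nil => exact ⟨x, rfl⟩
  | cons p l ih =>
    rw [vars_cons] at h
    rw [insts_cons, Multiset.cons_add, recLen_cons] at hN
    obtain ⟨z, hz⟩ := ih (h.mono Set.subset_union_right) (by omega)
    have := (insertF_sound hx (h.mono Set.subset_union_right) hz).length_eq
    exact ⟨_, z, by omega, hz, _, by omega, recF_complete (h.mono Set.subset_union_left) (by omega),
      rfl⟩

end

/-! ### Time constraints -/

/-- Only natural numbers are represented, so the negative part of the offset is added on the left
and the positive part on the right. -/
def guardF (c : TimeConstraint) (N : ℕ) (x y : List (Letter Sg)) : Prop :=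
  ∃ p : List (Letter Sg), p.length ≤ N ∧ ∃ q : List (Letter Sg), q.length ≤ N ∧
    (plusF (-c.offset).toNat N x p ∧ plusF c.offset.toNat N y q) ∧
    match c.cmp with
    | .gt => leF N q p ∧ ¬ p = q
    | .eq => p = q
    | .ge => leF N q p

theorem def_guardF (c : TimeConstraint) (i j : ι) :
    Def fun N (e : ι → List (Letter Sg)) => guardF c N (e i) (e j) := by
  refine Def.ex (Def.ex (((def_plusF _ _ _).and (def_plusF _ _ _)).and ?_))
  rcases c.cmp with - | - | -
  · exact (def_leF _ _).and (Def.eq _ _).not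
  · exact Def.eq _ _
  · exact def_leF _ _

theorem guardF_num {c : TimeConstraint} {N : ℕ} {τ : ℕ → ℕ}
    (h₁ : (num (τ c.lhs) : List (Letter Sg)).length + c.offset.natAbs ≤ N)
    (h₂ : (num (τ c.rhs) : List (Letter Sg)).length + c.offset.natAbs ≤ N) :
    guardF c N (num (τ c.lhs) : List (Letter Sg)) (num (τ c.rhs)) ↔ c.Holds τ := by
  have l₁ := length_num_add (Sg := Sg) (τ c.lhs) (-c.offset).toNat
  have l₂ := length_num_add (Sg := Sg) (τ c.rhs) c.offset.toNat
  have key : guardF c N (num (τ c.lhs) : List (Letter Sg)) (num (τ c.rhs)) ↔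
      match c.cmp with
      | .gt => τ c.rhs + c.offset.toNat ≤ τ c.lhs + (-c.offset).toNat ∧
          ¬ τ c.lhs + (-c.offset).toNat = τ c.rhs + c.offset.toNat
      | .eq => τ c.lhs + (-c.offset).toNat = τ c.rhs + c.offset.toNat
      | .ge => τ c.rhs + c.offset.toNat ≤ τ c.lhs + (-c.offset).toNat := by
    constructor
    · rintro ⟨p, hp, q, hq, ⟨e₁, e₂⟩, h⟩
      obtain rfl := plusF_num e₁
      obtain rfl := plusF_num e₂
      revert h
      cases c.cmp <;> simp only [leF_num_iff hp, num_injective.eq_iff, imp_self]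
    · intro h
      refine ⟨_, by omega, _, by omega, ⟨plusF_add (by omega), plusF_add (by omega)⟩, ?_⟩
      have hp : (num (τ c.lhs + (-c.offset).toNat) : List (Letter Sg)).length ≤ N := by omega
      revert h
      cases c.cmp <;> simp only [leF_num_iff hp, num_injective.eq_iff, imp_self]
  rw [key, TimeConstraint.Holds]
  cases c.cmp <;> simp only <;> omega

/-! ### Rewriting -/

/-- Rewriting of multisets of records. -/
def Rew (lhs rhs : List (Item Sg)) (guard : Finset TimeConstraint) (M M' : Multiset (Rec Sg)) :
    Prop :=
  ∃ (θ : Subst Sg) (τ : ℕ → ℕ) (R : Multiset (Rec Sg)), (∀ c ∈ guard, c.Holds τ) ∧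
    M = insts θ τ lhs + R ∧ M' = insts θ τ rhs + R ∧ ∀ p ∈ M', Ground p.1

open Classical in
/-- A map from all variables to the variables in `V`, and one more. -/
noncomputable def toOption (V : Set (Var Sg)) (v : Var Sg) : Option V := if h : v ∈ V then some ⟨v, h⟩ else none

theorem toOption_of_mem {V : Set (Var Sg)} {v : Var Sg} (h : v ∈ V) : toOption V v = some ⟨v, h⟩ :=
  dif_pos h

/-- The string is a value of the variable. -/
def valueF (v : Var Sg) (N : ℕ) (x : List (Letter Sg)) : Prop :=
  match v with
  | .inl (s, _) => termF s N x
  | .inr _ => numF N x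

theorem def_valueF (v : Var Sg) (i : ι) :
    Def fun N (e : ι → List (Letter Sg)) => valueF v N (e i) := by
  rcases v with ⟨s, x⟩ | t
  · exact def_termF _ _
  · exact def_numF _

/-- The values of the variables of both sides are guessed as words, including those that occur only
on the right. The additional index `none` takes up the variables that occur on neither side, so that
`f` can be read at every variable. -/
def rewF (lhs rhs : List (Item Sg)) (guard : Finset TimeConstraint) (N : ℕ)
    (x y : List (Letter Sg)) : Prop :=
  ∃ f : Option (vars (lhs ++ rhs)) → List (Letter Sg), (∀ k, (f k).length ≤ N) ∧
    (∀ v ∈ vars (lhs ++ rhs), valueF v N (f (toOption _ v))) ∧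
    (∀ c ∈ (guard : Set TimeConstraint),
      guardF c N (f (toOption _ (.inr c.lhs))) (f (toOption _ (.inr c.rhs)))) ∧
    ∃ z : List (Letter Sg), z.length ≤ N ∧ matchF lhs N (fun v => f (toOption _ v)) x z ∧
      insertF rhs N (fun v => f (toOption _ v)) z y

theorem def_rewF (lhs rhs : List (Item Sg)) (guard : Finset TimeConstraint) (i j : ι) :
    Def fun N (e : ι → List (Letter Sg)) => rewF lhs rhs guard N (e i) (e j) := by
  have : Finite (vars (lhs ++ rhs)) := finite_vars _
  have h : Def fun N (e : ι ⊕ Option (vars (lhs ++ rhs)) → List (Letter Sg)) =>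
      (∀ v ∈ vars (lhs ++ rhs), valueF v N (e (.inr (toOption _ v)))) ∧
      (∀ c ∈ (guard : Set TimeConstraint),
        guardF c N (e (.inr (toOption _ (.inr c.lhs)))) (e (.inr (toOption _ (.inr c.rhs))))) ∧
      ∃ z : List (Letter Sg), z.length ≤ N ∧
        matchF lhs N (fun v => e (.inr (toOption _ v))) (e (.inl i)) z ∧
        insertF rhs N (fun v => e (.inr (toOption _ v))) z (e (.inl j)) :=
    (Def.allMem (finite_vars _) fun v _ => def_valueF v _).and
      ((Def.allMem guard.finite_toSet fun c _ => def_guardF c _ _).and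
        (Def.ex ((def_matchF lhs (fun v => some (Sum.inr (toOption _ v))) (some (Sum.inl i)) none).and
          (def_insertF rhs (fun v => some (Sum.inr (toOption _ v))) none (some (Sum.inl j))))))
  exact (Def.exFun h).congr fun N e _ => by simp only [Sum.elim_inl, Sum.elim_inr]; rfl

theorem insts_congr {θ θ' : Subst Sg} {τ τ' : ℕ → ℕ} {l : List (Item Sg)}
    (h : ∀ s x, .inl (s, x) ∈ vars l → θ s x = θ' s x) (h' : ∀ t, .inr t ∈ vars l → τ t = τ' t) :
    insts θ τ l = insts θ' τ' l := by
  unfold insts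
  congr 1
  refine List.map_congr_left fun p hp => ?_
  unfold Item.inst
  rw [h' _ ⟨p, hp, by simp [Item.pat]⟩, fact_subst_congr p.fact fun s x hx =>
    h s x ⟨p, hp, by simp [Item.pat, hx]⟩]

section
variable {lhs rhs : List (Item Sg)} {guard : Finset TimeConstraint}

/-- Every variable of the guard occurs as a time on the left, so its value is part of the word. The
margin `K` leaves room for the sums with offsets that the guards compute. -/
theorem rewF_sound {N K : ℕ} {x y : List (Letter Sg)} {M : Multiset (Rec Sg)} (hx : Codes x M)
    (hg : ∀ c ∈ guard, ∀ v, v = c.lhs ∨ v = c.rhs → ∃ p ∈ lhs, p.tvar = v)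
    (hK : ∀ c ∈ guard, c.offset.natAbs ≤ K) (hN : recLen M + K ≤ N)
    (h : rewF lhs rhs guard N x y) : ∃ M', Rew lhs rhs guard M M' ∧ Codes y M' := by
  classical
  obtain ⟨f, hf, h₁, h₂, z, hz, h₃, h₄⟩ := h
  have hv : ∀ s x, .inl (s, x) ∈ vars (lhs ++ rhs) →
      ∃ t : Term Sg s, t.IsGround ∧ f (toOption _ (.inl (s, x))) = t.word := fun s x hx =>
    termF_sound (h₁ _ hx)
  have ht : ∀ t, .inr t ∈ vars (lhs ++ rhs) →
      ∃ n, f (toOption (vars (lhs ++ rhs)) (.inr t)) = num n := fun t ht =>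
    (numF_iff (hf _)).1 (h₁ _ ht)
  -- Variables outside both sides receive arbitrary values.
  let θ : Subst Sg := fun s x => if h : .inl (s, x) ∈ vars (lhs ++ rhs) then (hv s x h).choose
    else .var s x
  let τ : ℕ → ℕ := fun t => if h : .inr t ∈ vars (lhs ++ rhs) then (ht t h).choose else 0
  have hR : Represents (vars (lhs ++ rhs)) (fun v => f (toOption _ v)) θ τ := by
    refine ⟨fun s x hx => ?_, fun t h => ?_⟩
    · simp only [θ, dif_pos hx]
      exact (hv s x hx).choose_spec
    · simp only [τ, dif_pos h]
      exact (ht t h).choose_spec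
  have hl : vars lhs ⊆ vars (lhs ++ rhs) := fun v ⟨p, hp, h⟩ => ⟨p, by simp [hp], h⟩
  have hr : vars rhs ⊆ vars (lhs ++ rhs) := fun v ⟨p, hp, h⟩ => ⟨p, by simp [hp], h⟩
  obtain ⟨R, rfl, hz⟩ := matchF_sound hx (hR.mono hl) h₃
  have hy := insertF_sound hz (hR.mono hr) h₄
  refine ⟨_, ⟨θ, τ, R, fun c hc => ?_, rfl, rfl, fun p hp => hy.ground hp⟩, hy⟩
  have hb : ∀ v, v = c.lhs ∨ v = c.rhs → f (toOption (vars (lhs ++ rhs)) (.inr v)) = num (τ v) ∧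
      (num (τ v) : List (Letter Sg)).length + c.offset.natAbs ≤ N := by
    intro v hv
    obtain ⟨p, hp, rfl⟩ := hg c hc v hv
    refine ⟨hR.2 _ (hl ⟨p, hp, by simp [Item.pat]⟩), ?_⟩
    have h₁ : (recWord (p.inst θ τ)).length ≤ recLen (insts θ τ lhs) := by
      refine Multiset.single_le_sum (fun _ _ => Nat.zero_le _) _ ?_
      exact Multiset.mem_map_of_mem (fun q => (recWord q).length)
        (by simpa [insts] using ⟨p, hp, rfl⟩)
    have h₂ := length_num_mono (Sg := Sg) (Nat.le_add_right (τ p.tvar) p.shift)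
    rw [recLen_add] at hN
    simp only [recWord, Item.inst, List.length_append] at h₁
    have := hK c hc
    omega
  have := h₂ c hc
  rw [(hb _ (.inl rfl)).1, (hb _ (.inr rfl)).1] at this
  exact (guardF_num (hb _ (.inl rfl)).2 (hb _ (.inr rfl)).2).1 this

theorem length_le_of_mem_vars {θ : Subst Sg} {τ : ℕ → ℕ} {l : List (Item Sg)} {v : Var Sg}
    (hv : v ∈ vars l) :
    (v.elim (fun a => (θ a.1 a.2).word) fun t => num (τ t)).length ≤ recLen (insts θ τ l) := by
  obtain ⟨p, hp, h⟩ := hv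
  have h₁ : (recWord (p.inst θ τ)).length ≤ recLen (insts θ τ l) := by
    refine Multiset.single_le_sum (fun _ _ => Nat.zero_le _) _ ?_
    exact Multiset.mem_map_of_mem (fun q => (recWord q).length)
      (by simpa [insts] using ⟨p, hp, rfl⟩)
  refine le_trans ?_ h₁
  rw [recWord, List.length_append]
  rcases List.mem_append.1 h with h | h
  · have h₂ := length_le_fill (e := fun v : Var Sg =>
      v.elim (fun a => (θ a.1 a.2).word) fun t => num (τ t)) h
    rw [fill_factPat (θ := θ) _ fun s x _ => rfl] at h₂
    exact h₂.trans (Nat.le_add_right _ _)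
  · obtain rfl : v = .inr p.tvar := by simpa using h
    exact (length_num_mono (Nat.le_add_right _ _)).trans (Nat.le_add_left _ _)

theorem rewF_complete {N K : ℕ} {x : List (Letter Sg)} {M M' : Multiset (Rec Sg)} (hx : Codes x M)
    (hg : ∀ c ∈ guard, ∀ v, v = c.lhs ∨ v = c.rhs → ∃ p ∈ lhs, p.tvar = v)
    (hK : ∀ c ∈ guard, c.offset.natAbs ≤ K) (hN : recLen M + K ≤ N) (hM' : recLen M' ≤ N)
    (h : Rew lhs rhs guard M M') : ∃ y, rewF lhs rhs guard N x y ∧ Codes y M' := by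
  obtain ⟨θ, τ, R, h₁, rfl, rfl, hgr⟩ := h
  let val : Var Sg → List (Letter Sg) := fun v => v.elim (fun a => (θ a.1 a.2).word) fun t => num (τ t)
  let f : Option (vars (lhs ++ rhs)) → List (Letter Sg) := fun k => k.elim [] fun v => val v
  have hfv : ∀ v ∈ vars (lhs ++ rhs), f (toOption _ v) = val v := fun v hv => by
    rw [toOption_of_mem hv]; rfl
  have hgl : ∀ p ∈ lhs, Ground (p.inst θ τ).1 := fun p hp =>
    hx.ground (by simp only [insts, Multiset.mem_add]; exact .inl (by simpa using ⟨p, hp, rfl⟩))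
  have hgr' : ∀ p ∈ rhs, Ground (p.inst θ τ).1 := fun p hp =>
    hgr _ (by simp only [insts, Multiset.mem_add]; exact .inl (by simpa using ⟨p, hp, rfl⟩))
  have hR : Represents (vars (lhs ++ rhs)) (fun v => f (toOption _ v)) θ τ := by
    refine ⟨fun s x hx => ⟨?_, hfv _ hx⟩, fun t ht => hfv _ ht⟩
    obtain ⟨p, hp, h⟩ := hx
    have h : .inr (.inl (s, x)) ∈ factPat p.fact := by simpa [Item.pat] using h
    rcases List.mem_append.1 hp with hp | hp
    · exact (ground_subst _).1 (hgl p hp) s x h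
    · exact (ground_subst _).1 (hgr' p hp) s x h
  have hl : vars lhs ⊆ vars (lhs ++ rhs) := fun v ⟨p, hp, h⟩ => ⟨p, by simp [hp], h⟩
  have hr : vars rhs ⊆ vars (lhs ++ rhs) := fun v ⟨p, hp, h⟩ => ⟨p, by simp [hp], h⟩
  have hN' := hN
  rw [recLen_add] at hN hM'
  have hlen : ∀ v ∈ vars (lhs ++ rhs), (val v).length ≤ N := by
    rintro v ⟨p, hp, h⟩
    rcases List.mem_append.1 hp with hp | hp
    · exact (length_le_of_mem_vars (θ := θ) (τ := τ) (l := lhs) ⟨p, hp, h⟩).trans (by omega)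
    · exact (length_le_of_mem_vars (θ := θ) (τ := τ) (l := rhs) ⟨p, hp, h⟩).trans (by omega)
  obtain ⟨z, hz, hzR⟩ := matchF_complete (N := N) hx (by rw [hx.length_eq]; omega) (hR.mono hl)
  obtain ⟨y, hy⟩ := insertF_complete (N := N) hzR (hR.mono hr) (by rw [recLen_add]; omega)
  refine ⟨y, ⟨f, ?_, fun v hv => ?_, fun c hc => ?_, z, by rw [hzR.length_eq]; omega, hz, hy⟩,
    insertF_sound hzR (hR.mono hr) hy⟩
  · rintro (- | v)
    · exact Nat.zero_le _
    · exact hlen v v.2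
  · rw [hfv v hv]
    rcases v with ⟨s, x⟩ | t
    · exact (termF_iff (hlen _ hv)).2 ⟨θ s x, (hR.1 s x hv).1, rfl⟩
    · exact (numF_iff (hlen _ hv)).2 ⟨τ t, rfl⟩
  · have hb : ∀ v, v = c.lhs ∨ v = c.rhs → f (toOption (vars (lhs ++ rhs)) (.inr v)) = num (τ v) ∧
        (num (τ v) : List (Letter Sg)).length + c.offset.natAbs ≤ N := by
      intro v hv
      obtain ⟨p, hp, rfl⟩ := hg c hc v hv
      have hm : .inr p.tvar ∈ vars lhs := ⟨p, hp, by simp [Item.pat]⟩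
      refine ⟨hfv _ (hl hm), ?_⟩
      have h₂ : (num (τ p.tvar) : List (Letter Sg)).length ≤ _ :=
        length_le_of_mem_vars (θ := θ) (τ := τ) hm
      have := hK c hc
      omega
    rw [(hb _ (.inl rfl)).1, (hb _ (.inr rfl)).1]
    exact (guardF_num (hb _ (.inl rfl)).2 (hb _ (.inr rfl)).2).2 (h₁ c hc)

end

end TimedMSR

namespace TimedMSR

open StackProg

variable {Sg : Alphabet} {ι : Type}

/-! ### Rules, ticks and critical configurations as rewriting of records -/

def embed (F : Fact Sg × ℕ) : Rec Sg := (some F.1, F.2)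

theorem config_all (S : Config Sg) : S.all = (none, S.time) ::ₘ S.facts.map embed := rfl

theorem ground_all {S : Config Sg} {p : Rec Sg} (hp : p ∈ S.all) : Ground p.1 := by
  rcases Multiset.mem_cons.1 hp with rfl | hp
  · simp [Ground]
  · obtain ⟨F, hF, rfl⟩ := Multiset.mem_map.1 hp
    simpa [Ground] using S.ground F hF

theorem map_embed_eq_add {s t : Multiset (Fact Sg × ℕ)} {R : Multiset (Rec Sg)}
    (h : s.map embed = t.map embed + R) : ∃ R', s = t + R' ∧ R = R'.map embed := by
  let proj : Rec Sg → Option (Fact Sg × ℕ) := fun p => p.1.map fun F => (F, p.2)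
  have hp : ∀ s : Multiset (Fact Sg × ℕ), (s.map embed).filterMap proj = s := fun s => by
    rw [Multiset.filterMap_map]
    have : proj ∘ embed = some := by funext F; rfl
    rw [this, Multiset.filterMap_some]
  have hR : ∀ p ∈ R, ∃ F, p = embed F := fun p hpR => by
    have : p ∈ s.map embed := h ▸ Multiset.mem_add.2 (.inr hpR)
    obtain ⟨F, -, rfl⟩ := Multiset.mem_map.1 this
    exact ⟨F, rfl⟩
  have hR' : ∃ R' : Multiset (Fact Sg × ℕ), R = R'.map embed := by
    clear h
    induction R using Multiset.induction_on with
    | empty => exact ⟨0, rfl⟩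
    | cons p R ih =>
      obtain ⟨F, rfl⟩ := hR p (Multiset.mem_cons_self _ _)
      obtain ⟨R', rfl⟩ := ih fun q hq => hR q (Multiset.mem_cons_of_mem hq)
      exact ⟨F ::ₘ R', by simp⟩
  obtain ⟨R', rfl⟩ := hR'
  refine ⟨R', ?_, rfl⟩
  rw [← Multiset.map_add] at h
  rw [← hp s, h, hp]

theorem time_cons_inj {s : Multiset (Fact Sg × ℕ)} {R : Multiset (Rec Sg)} {t t' : ℕ}
    (h : ((none, t) : Rec Sg) ::ₘ s.map embed = (none, t') ::ₘ R) : t' = t ∧ s.map embed = R := by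
  rcases Multiset.cons_eq_cons.1 h with ⟨h₁, h₂⟩ | ⟨-, R', h₁, -⟩
  · exact ⟨by simpa using h₁.symm, h₂⟩
  · have : ((none, t') : Rec Sg) ∈ s.map embed := by rw [h₁]; simp
    simp [embed] at this

namespace Rule

/-- The items of a multiset of facts with time variables. -/
noncomputable def items (W : Multiset (Fact Sg × ℕ)) : List (Item Sg) :=
  W.toList.map fun F => ⟨some F.1, F.2, 0⟩

noncomputable def lhs (r : Rule Sg) : List (Item Sg) := ⟨none, r.time, 0⟩ :: items (r.context + r.consumed)

noncomputable def rhs (r : Rule Sg) : List (Item Sg) :=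
  ⟨none, r.time, 0⟩ :: (items r.context ++ r.created.toList.map fun Q => ⟨some Q.1, r.time, Q.2⟩)

end Rule

theorem insts_append (θ : Subst Sg) (τ : ℕ → ℕ) (l l' : List (Item Sg)) :
    insts θ τ (l ++ l') = insts θ τ l + insts θ τ l' := by simp [insts]

theorem insts_map_toList {α : Type*} (θ : Subst Sg) (τ : ℕ → ℕ) (W : Multiset α) (f : α → Item Sg) :
    insts θ τ (W.toList.map f) = W.map fun a => (f a).inst θ τ := by
  rw [insts, List.map_map, ← Multiset.map_coe, Multiset.coe_toList]
  rfl

theorem insts_items (θ : Subst Sg) (τ : ℕ → ℕ) (W : Multiset (Fact Sg × ℕ)) :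
    insts θ τ (Rule.items W) = (inst θ τ W).map embed := by
  rw [Rule.items, insts_map_toList, inst, Multiset.map_map]
  rfl

theorem insts_rhs (r : Rule Sg) (θ : Subst Sg) (τ : ℕ → ℕ) :
    insts θ τ r.rhs = (none, τ r.time) ::ₘ
      (inst θ τ r.context + r.created.map fun Q => (Q.1.subst θ, τ r.time + Q.2)).map embed := by
  rw [Rule.rhs, insts_cons, insts_append, insts_items, insts_map_toList, Multiset.map_add,
    Multiset.map_map]
  rfl

theorem insts_lhs (r : Rule Sg) (θ : Subst Sg) (τ : ℕ → ℕ) :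
    insts θ τ r.lhs = (none, τ r.time) ::ₘ (inst θ τ r.context + inst θ τ r.consumed).map embed := by
  rw [Rule.lhs, insts_cons, insts_items, inst, Multiset.map_add]
  rfl

theorem rew_rule_iff {r : Rule Sg} {S : Config Sg} {M : Multiset (Rec Sg)} :
    Rew r.lhs r.rhs r.guard S.all M ↔ ∃ S', r.Rewrites S S' ∧ M = S'.all := by
  constructor
  · rintro ⟨θ, τ, R, hg, h₁, h₂, h₃⟩
    rw [insts_lhs, config_all, Multiset.cons_add] at h₁
    obtain ⟨ht, h₁⟩ := time_cons_inj h₁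
    obtain ⟨R', h₄, rfl⟩ := map_embed_eq_add h₁
    rw [insts_rhs, Multiset.cons_add, ← Multiset.map_add, ht] at h₂
    refine ⟨⟨S.time, inst θ τ r.context + (r.created.map fun Q => (Q.1.subst θ, S.time + Q.2)) + R',
      fun F hF => ?_⟩, ⟨θ, τ, R', ht, hg, h₄, rfl, rfl⟩, h₂⟩
    refine h₃ (embed F) ?_ F.1 rfl
    rw [h₂]
    exact Multiset.mem_cons_of_mem (Multiset.mem_map_of_mem _ hF)
  · rintro ⟨S', ⟨θ, τ, R, ht, hg, h₁, h₂, h₃⟩, rfl⟩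
    refine ⟨θ, τ, R.map embed, hg, ?_, ?_, fun p hp => ground_all hp⟩
    · rw [insts_lhs, config_all, Multiset.cons_add, ← Multiset.map_add, ht, h₁]
    · rw [insts_rhs, config_all, Multiset.cons_add, ← Multiset.map_add, ht, h₂, h₃]

theorem rew_tick_iff {S : Config Sg} {M : Multiset (Rec Sg)} :
    Rew [⟨none, 0, 0⟩] [⟨none, 0, 1⟩] ∅ S.all M ↔ ∃ S', Tick S S' ∧ M = S'.all := by
  constructor
  · rintro ⟨θ, τ, R, hg, h₁, h₂, h₃⟩
    rw [insts_cons, config_all, Multiset.cons_add] at h₁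
    obtain ⟨ht, h₁⟩ := time_cons_inj h₁
    refine ⟨⟨S.time + 1, S.facts, S.ground⟩, ⟨rfl, rfl⟩, ?_⟩
    simp only [add_zero] at ht
    rw [h₂, config_all, insts_cons, h₁]
    simp [insts, Item.inst, ht]
  · rintro ⟨S', ⟨h₁, h₂⟩, rfl⟩
    refine ⟨.var, fun _ => S.time, S.facts.map embed, by simp, ?_, ?_, fun p hp => ground_all hp⟩
    · simp [config_all, insts, Item.inst]
    · simp [config_all, insts, Item.inst, h₁, h₂]

noncomputable def CriticalPair.lhs (p : CriticalPair Sg) : List (Item Sg) :=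
  p.facts.toList.map fun F => ⟨F.1, F.2, 0⟩

/-- Containment of the pattern is rewriting to an empty right-hand side: what remains is the
complement. -/
theorem isCritical_iff {CS : Set (CriticalPair Sg)} {S : Config Sg} :
    IsCritical CS S ↔ ∃ p ∈ CS, ∃ M, Rew p.lhs [] p.guard S.all M := by
  have key : ∀ (p : CriticalPair Sg) θ τ, insts θ τ p.lhs =
      p.facts.map fun F => (F.1.map (Fact.subst θ), τ F.2) := fun p θ τ => by
    rw [CriticalPair.lhs, insts_map_toList]
    rfl
  constructor
  · rintro ⟨p, hp, θ, τ, hle, hg⟩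
    obtain ⟨R, hR⟩ := Multiset.le_iff_exists_add.1 hle
    exact ⟨p, hp, R, θ, τ, R, hg, by rw [key, hR], by simp [insts], fun q hq =>
      ground_all (hR ▸ Multiset.mem_add.2 (.inr hq))⟩
  · rintro ⟨p, hp, M, θ, τ, R, hg, hR, -, -⟩
    exact ⟨p, hp, θ, τ, by rw [hR, key]; exact Multiset.le_add_right _ _, hg⟩

theorem Rule.guard_tvar (r : Rule Sg) : ∀ c ∈ r.guard, ∀ v, v = c.lhs ∨ v = c.rhs →
    ∃ p ∈ r.lhs, p.tvar = v := by
  intro c hc v hv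
  rcases r.guard_vars c hc v hv with rfl | h
  · exact ⟨_, List.mem_cons_self, rfl⟩
  · obtain ⟨F, hF, rfl⟩ := Multiset.mem_map.1 h
    exact ⟨⟨some F.1, F.2, 0⟩, List.mem_cons_of_mem _ (List.mem_map.2 ⟨F, by simpa using hF, rfl⟩), rfl⟩

theorem CriticalPair.guard_tvar (p : CriticalPair Sg) : ∀ c ∈ p.guard, ∀ v, v = c.lhs ∨ v = c.rhs →
    ∃ q ∈ p.lhs, q.tvar = v := by
  intro c hc v hv
  obtain ⟨F, hF, rfl⟩ := Multiset.mem_map.1 (p.guard_vars c hc v hv)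
  exact ⟨⟨F.1, F.2, 0⟩, List.mem_map.2 ⟨F, by simpa using hF, rfl⟩, rfl⟩

/-! ### Shortening of gaps -/

/-- The marker moves over a record, whose timestamp is shifted. -/
def scanF (G N : ℕ) (c x y : List (Letter Sg)) : Prop :=
  ∃ h ∈ (heads : Set (Letter Sg)), ∃ u : List (Letter Sg), u.length ≤ N ∧
    ∃ b : List (Letter Sg), b.length ≤ N ∧ ∃ n : List (Letter Sg), n.length ≤ N ∧
    ∃ n' : List (Letter Sg), n'.length ≤ N ∧ ∃ v : List (Letter Sg), v.length ≤ N ∧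
      (((∀ a ∈ u, a ∉ ({.mark} : Set (Letter Sg))) ∧ (∀ a ∈ b, a ∉ (fnLetters : Set (Letter Sg))ᶜ) ∧
        (∀ a ∈ v.head?, a ∈ heads)) ∧
      (numF N n ∧ numF N n') ∧
      (x = u ++ .mark :: h :: (b ++ (n ++ v)) ∧ y = u ++ h :: (b ++ (n' ++ .mark :: v)))) ∧
      -- The timestamp either is below `c` and stays, which is forbidden for `Time`, or is at least
      -- `c + G` and drops by one.
      ((¬ leF N c n ∧ n' = n ∧ h ≠ .time) ∨
        (incF N n' n ∧ ∃ m : List (Letter Sg), m.length ≤ N ∧ plusF G N c m ∧ leF N m n))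

theorem def_scanF (G : ℕ) (c i j : ι) :
    Def fun N (e : ι → List (Letter Sg)) => scanF G N (e c) (e i) (e j) := by
  refine Def.exMem (Set.toFinite _) fun h _ => Def.ex (Def.ex (Def.ex (Def.ex (Def.ex
    ((((Def.avoid _ _).and ((Def.avoid _ _).and (Def.startsIn _ _))).and (((def_numF _).and
    (def_numF _)).and (Def.and ?_ ?_))).and (((def_leF _ _).not.and ((Def.eq _ _).and
    (Def.const _))).or ((def_incF _ _).and (Def.ex ((def_plusF _ _ _).and (def_leF _ _))))))))))
  · exact (Def.word [.inr (some (some (some (some none)))), .inl .mark, .inl h,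
      .inr (some (some (some none))), .inr (some (some none)), .inr none]
      (some (some (some (some (some i)))))).congr fun N e _ => by simp
  · exact (Def.word [.inr (some (some (some (some none)))), .inl h,
      .inr (some (some (some none))), .inr (some none), .inl .mark, .inr none]
      (some (some (some (some (some j)))))).congr fun N e _ => by simp

/-- All records have to be changed with the same `c`. A marker travels through the word by
transitive closure and treats one record at each step. Since `y` contains no marker, `y ++ [.mark]`
is attained only after the last record. -/
def shiftF (G N : ℕ) (x y : List (Letter Sg)) : Prop :=
  ∃ c : List (Letter Sg), c.length ≤ N ∧ numF N c ∧ (∀ a ∈ y, a ∉ ({.mark} : Set (Letter Sg))) ∧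
    ∃ x' : List (Letter Sg), x'.length ≤ N ∧ ∃ y' : List (Letter Sg), y'.length ≤ N ∧
      (x' = .mark :: x ∧ y' = y ++ [.mark]) ∧ TC N (scanF G N c) x' y'

theorem def_shiftF (G : ℕ) (i j : ι) :
    Def fun N (e : ι → List (Letter Sg)) => shiftF G N (e i) (e j) := by
  refine Def.ex ((def_numF _).and ((Def.avoid _ _).and (Def.ex (Def.ex ((Def.and ?_ ?_).and
    (Def.tc (R := fun N (e : Option (Option (Option ι)) → List (Letter Sg)) =>
      scanF G N (e (some (some none)))) _ _ (def_scanF G _ _ _)))))))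
  · exact (Def.word [.inl .mark, .inr (some (some (some i)))] (some none)).congr fun N e _ => by simp
  · exact (Def.word [.inr (some (some (some j))), .inl .mark] none).congr fun N e _ => by simp

def shiftRec (c : ℕ) (p : Rec Sg) : Rec Sg := (p.1, if p.2 < c then p.2 else p.2 - 1)

def Shiftable (G c : ℕ) (p : Rec Sg) : Prop := (p.2 < c ∧ p.1 ≠ none) ∨ c + G ≤ p.2

theorem mark_not_mem_flat (L : List (Rec Sg)) : ∀ a ∈ flat L, a ∉ ({.mark} : Set (Letter Sg)) := by
  rintro a ha rfl
  obtain ⟨p, -, ha⟩ := List.mem_flatMap.1 ha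
  rcases List.mem_append.1 ha with ha | ha
  · obtain ⟨h, b, hb, hh, hbf⟩ := factWord_eq p.1
    rw [hb] at ha
    rcases List.mem_cons.1 ha with rfl | ha
    · rcases hh with hh | ⟨P, hh⟩ <;> simp at hh
    · obtain ⟨f, hf⟩ := hbf _ ha
      simp at hf
  · obtain ⟨b, hb⟩ := mem_num ha
    simp at hb

theorem eq_nil_of_flat {L : List (Rec Sg)} (h : flat L = []) : L = [] := by
  rcases L with - | ⟨p, L⟩
  · rfl
  · obtain ⟨a, b, hb, -⟩ := recWord_eq p
    simp [hb] at h

theorem length_flat_shift_le (c : ℕ) (L : List (Rec Sg)) :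
    (flat (L.map (shiftRec c))).length ≤ (flat L).length := by
  induction L with
  | nil => simp
  | cons p L ih =>
    have := length_num_mono (Sg := Sg) (show (shiftRec c p).2 ≤ p.2 by
      simp only [shiftRec]; split_ifs <;> omega)
    simp only [List.map_cons, flat_cons, recWord, List.length_append]
    have : (shiftRec c p).1 = p.1 := rfl
    rw [this]
    omega

/-- The invariant of the scan: the records left of the marker have been tested and shifted, those
right of it are unchanged. -/
theorem scanF_sound {G N c : ℕ} {L : List (Rec Sg)} {x y : List (Letter Sg)}
    (hL : ∃ L₁ L₂, L = L₁ ++ L₂ ∧ (∀ p ∈ L₁, Shiftable G c p) ∧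
      x = flat (L₁.map (shiftRec c)) ++ .mark :: flat L₂)
    (h : scanF G N (num c) x y) :
    ∃ L₁ L₂, L = L₁ ++ L₂ ∧ (∀ p ∈ L₁, Shiftable G c p) ∧
      y = flat (L₁.map (shiftRec c)) ++ .mark :: flat L₂ := by
  obtain ⟨L₁, L₂, rfl, hS, rfl⟩ := hL
  obtain ⟨h, hh, u, -, b, -, n, hn, n', hn', v, -, ⟨⟨hu, hb, hv⟩, ⟨hnn, hnn'⟩, hx, rfl⟩, hcase⟩ := h
  obtain ⟨e₁, e₂⟩ := split_unique (mark_not_mem_flat _) hu (by simp) (by simp) hx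
  simp only [List.cons.injEq, true_and] at e₂
  have hbf : ∀ a ∈ b, ∃ f, a = .sym (.fn f) := fun a ha => by simpa [fnLetters] using hb a ha
  obtain ⟨k, rfl⟩ := (numF_iff hn).1 hnn
  obtain ⟨k', rfl⟩ := (numF_iff hn').1 hnn'
  have hr : RecLike (h :: (b ++ num k)) := by
    refine ⟨h, _, rfl, hh, fun a ha => ?_⟩
    rcases List.mem_append.1 ha with ha | ha
    · obtain ⟨f, rfl⟩ := hbf a ha
      rintro (h | ⟨P, h⟩) <;> simp at h
    · obtain ⟨f, rfl⟩ := mem_num ha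
      rintro (h | ⟨P, h⟩) <;> simp at h
  obtain ⟨L₃, p, L₄, rfl, h₃, hp, rfl⟩ := flat_eq_append (u := []) hr hv (by rw [e₂]; simp)
  obtain rfl := eq_nil_of_flat h₃.symm
  obtain ⟨hp₁, hp₂⟩ := recWord_split (p := p) (c := h :: b) (n := num k) (by
    intro a ha
    rcases List.mem_cons.1 ha with rfl | ha
    · rintro ⟨b, rfl⟩
      rcases hh with hh | ⟨P, hh⟩ <;> simp at hh
    · obtain ⟨f, rfl⟩ := hbf a ha
      simp [bitLetters]) (fun a ha => mem_num ha) hp.symm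
  obtain rfl := num_injective hp₂
  have key : Shiftable G c p ∧ k' = (shiftRec c p).2 := by
    rcases hcase with ⟨h₁, h₂, h₃⟩ | ⟨h₁, m, -, h₂, h₃⟩
    · rw [leF_num_iff hn] at h₁
      refine ⟨.inl ⟨by omega, fun h0 => h₃ ?_⟩, ?_⟩
      · rw [h0] at hp₁
        simp only [factWord, List.cons.injEq] at hp₁
        exact hp₁.1.symm
      · simp only [shiftRec, if_pos (not_le.1 h₁)]
        exact num_injective h₂
    · have h₁ := num_injective (incF_num h₁)
      obtain rfl := plusF_num h₂
      rw [leF_num_iff hn] at h₃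
      refine ⟨.inr h₃, ?_⟩
      simp only [shiftRec, if_neg (show ¬ p.2 < c by omega)]
      omega
  refine ⟨L₁ ++ [p], L₄, by simp, ?_, ?_⟩
  · intro q hq
    rcases List.mem_append.1 hq with hq | hq
    · exact hS q hq
    · rw [List.mem_singleton.1 hq]; exact key.1
  · have : recWord (shiftRec c p) = h :: (b ++ num k') := by
      rw [recWord, ← key.2, show (shiftRec c p).1 = p.1 from rfl, hp₁]
      rfl
    simp [this, e₁]

theorem scanF_complete {G N c : ℕ} {L₁ L₂ : List (Rec Sg)} {p : Rec Sg} (hG : 0 < G)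
    (hp : Shiftable G c p)
    (hN : (flat (L₁.map (shiftRec c)) ++ .mark :: flat (p :: L₂)).length ≤ N) :
    scanF G N (num c) (flat (L₁.map (shiftRec c)) ++ .mark :: flat (p :: L₂))
      (flat ((L₁ ++ [p]).map (shiftRec c)) ++ .mark :: flat L₂) := by
  obtain ⟨h, b, hb, hh, hbf⟩ := factWord_eq p.1
  have hle := length_num_mono (Sg := Sg) (show (shiftRec c p).2 ≤ p.2 by
    simp only [shiftRec]; split_ifs <;> omega)
  have e : recWord (shiftRec c p) = h :: (b ++ num (shiftRec c p).2) := by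
    rw [recWord, show (shiftRec c p).1 = p.1 from rfl, hb]
    rfl
  simp only [flat_cons, recWord, hb, List.length_append, List.length_cons] at hN
  refine ⟨h, hh, flat (L₁.map (shiftRec c)), by omega, b, by omega, num p.2, by omega,
    num (shiftRec c p).2, by omega, flat L₂, by omega, ⟨⟨mark_not_mem_flat _, fun a ha h => ?_,
    flat_head _⟩, ⟨?_, ?_⟩, ?_, ?_⟩, ?_⟩
  · exact h (hbf a ha)
  · exact (numF_iff (by omega)).2 ⟨_, rfl⟩
  · exact (numF_iff (by omega)).2 ⟨_, rfl⟩
  · simp [recWord, hb]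
  · simp [e]
  · rcases hp with ⟨h₁, h₂⟩ | h₁
    · refine .inl ⟨?_, ?_, ?_⟩
      · rw [leF_num_iff (by omega)]; omega
      · simp only [shiftRec, if_pos h₁]
      · rintro rfl
        rcases ho : p.1 with - | F
        · exact h₂ ho
        · rw [ho, factWord_some] at hb
          simp at hb
    · have h₂ : (shiftRec c p).2 + 1 = p.2 := by
        simp only [shiftRec, if_neg (show ¬ p.2 < c by omega)]
        omega
      have h₃ := length_num_mono (Sg := Sg) h₁
      refine .inr ⟨?_, num (c + G), by omega, plusF_add (by omega), ?_⟩
      · have := incF_succ (Sg := Sg) (N := N) (n := (shiftRec c p).2) (by rw [h₂]; omega)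
        rwa [h₂] at this
      · rw [leF_num_iff (by omega)]
        exact h₁

theorem all_mapTime (S : Config Sg) (c : ℕ) :
    (S.mapTime fun t => if t < c then t else t - 1).all = S.all.map (shiftRec c) := by
  simp only [config_all, Config.mapTime, Multiset.map_cons, Multiset.map_map]
  rfl

theorem shift_iff {G c : ℕ} {S S' : Config Sg} : Shift G c S S' ↔
    (∀ p ∈ S.all, Shiftable G c p) ∧ S' = S.mapTime fun t => if t < c then t else t - 1 := by
  rw [Shift, ← and_assoc]
  refine and_congr_left fun _ => ?_
  rw [config_all]
  simp only [Multiset.mem_cons, Multiset.mem_map, forall_eq_or_imp, Shiftable, embed,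
    forall_exists_index, and_imp, forall_apply_eq_imp_iff₂]
  simp

theorem shiftF_sound {G N : ℕ} {x y : List (Letter Sg)} {S : Config Sg} (hx : Codes x S.all)
    (h : shiftF G N x y) : ∃ S', (∃ c, Shift G c S S') ∧ Codes y S'.all := by
  obtain ⟨c, hc, hcn, hy, _, -, _, -, ⟨rfl, rfl⟩, h⟩ := h
  obtain ⟨c, rfl⟩ := (numF_iff hc).1 hcn
  obtain ⟨L, hL, hg, rfl⟩ := hx
  have key : ∀ z, TC N (scanF G N (num c)) (.mark :: flat L) z →
      ∃ L₁ L₂, L = L₁ ++ L₂ ∧ (∀ p ∈ L₁, Shiftable G c p) ∧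
        z = flat (L₁.map (shiftRec c)) ++ .mark :: flat L₂ := by
    intro z hz
    induction hz with
    | refl => exact ⟨[], L, rfl, by simp, rfl⟩
    | tail _ h ih => exact scanF_sound ih h.2.2
  obtain ⟨L₁, L₂, rfl, hS, hz⟩ := key _ h
  obtain ⟨rfl, h₂⟩ := split_unique hy (mark_not_mem_flat _) (by simp) (by simp) hz
  simp only [List.cons.injEq, true_and] at h₂
  obtain rfl := eq_nil_of_flat h₂.symm
  rw [List.append_nil] at hL hg
  refine ⟨_, ⟨c, shift_iff.2 ⟨fun p hp => hS p ?_, rfl⟩⟩, L₁.map (shiftRec c), ?_, ?_, rfl⟩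
  · simpa [← hL] using hp
  · rw [all_mapTime, ← hL, Multiset.map_coe]
  · intro q hq
    obtain ⟨p, hp, rfl⟩ := List.mem_map.1 hq
    exact hg p hp

theorem shiftF_complete {G N c : ℕ} {x : List (Letter Sg)} {S S' : Config Sg} (hG : 0 < G)
    (hx : Codes x S.all) (hN : recLen S.all + 1 ≤ N) (h : Shift G c S S') :
    ∃ y, shiftF G N x y ∧ Codes y S'.all := by
  have hlen := hx.length_eq
  obtain ⟨L, hL, hg, rfl⟩ := hx
  have hc : (num c : List (Letter Sg)).length ≤ N := by
    have h₁ := length_num_mono (Sg := Sg) ((Nat.le_add_right c G).trans h.1)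
    rw [config_all, recLen_cons, recWord, List.length_append] at hN
    simp only at hN
    omega
  rw [shift_iff] at h
  obtain ⟨h, rfl⟩ := h
  have hS : ∀ p ∈ L, Shiftable G c p := fun p hp => h p (by rw [← hL]; simpa using hp)
  have key : ∀ L₁ L₂ : List (Rec Sg), L = L₁ ++ L₂ → TC N (scanF G N (num c)) (.mark :: flat L)
      (flat (L₁.map (shiftRec c)) ++ .mark :: flat L₂) := by
    intro L₁
    induction L₁ using List.reverseRecOn with
    | nil => rintro L₂ rfl; exact .refl
    | append_singleton L₁ p ih =>
      rintro L₂ rfl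
      have l₁ := length_flat_shift_le c L₁
      have l₂ := length_flat_shift_le c [p]
      simp only [flat_append, List.length_append, flat_cons, flat_nil, List.length_nil,
        List.map_cons, List.map_nil, add_zero] at hlen l₂
      refine (ih (p :: L₂) (by simp)).tail ⟨?_, ?_, scanF_complete hG (hS p (by simp)) ?_⟩ <;>
        simp <;> omega
  have h₁ := key L [] (by simp)
  have h₂ := length_flat_shift_le c L
  refine ⟨flat (L.map (shiftRec c)), ⟨num c, hc, (numF_iff hc).2 ⟨c, rfl⟩, mark_not_mem_flat _,
    _, ?_, _, ?_, ⟨rfl, rfl⟩, h₁⟩, L.map (shiftRec c), ?_, ?_, rfl⟩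
  · simp; omega
  · simp; omega
  · rw [all_mapTime, ← hL, Multiset.map_coe]
  · intro q hq
    obtain ⟨p, hp, rfl⟩ := List.mem_map.1 hq
    exact hg p hp

/-! ### Edges -/

def edgeF (A : Set (Rule Sg)) (CS : Set (CriticalPair Sg)) (G N : ℕ) (x y : List (Letter Sg)) : Prop :=
  (¬ ∃ p ∈ CS, ∃ z : List (Letter Sg), z.length ≤ N ∧ rewF p.lhs [] p.guard N x z) ∧
    ((∃ r ∈ A, rewF r.lhs r.rhs r.guard N x y) ∨
      (rewF [⟨none, 0, 0⟩] [⟨none, 0, 1⟩] ∅ N x y ∧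
        (¬ ∃ r ∈ A, ∃ z : List (Letter Sg), z.length ≤ N ∧ rewF r.lhs r.rhs r.guard N x z) ∧
        ¬ ∃ z : List (Letter Sg), z.length ≤ N ∧ shiftF G N x z) ∨ shiftF G N x y)

theorem def_edgeF {A : Set (Rule Sg)} {CS : Set (CriticalPair Sg)} (hA : A.Finite) (hCS : CS.Finite)
    (G : ℕ) (i j : ι) : Def fun N (e : ι → List (Letter Sg)) => edgeF A CS G N (e i) (e j) :=
  (Def.exMem hCS fun _ _ => Def.ex (def_rewF _ _ _ _ _)).not.and
    ((Def.exMem hA fun _ _ => def_rewF _ _ _ _ _).or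
      (((def_rewF _ _ _ _ _).and ((Def.exMem hA fun _ _ => Def.ex (def_rewF _ _ _ _ _)).not.and
        (Def.ex (def_shiftF _ _ _)).not)).or (def_shiftF _ _ _)))

section
variable {A : Set (Rule Sg)} {CS : Set (CriticalPair Sg)} {G N : ℕ} {x : List (Letter Sg)}
  {X : Config Sg}

/-- The space `N` suffices for computing the successors of `X`. -/
structure Roomy (A : Set (Rule Sg)) (CS : Set (CriticalPair Sg)) (G N : ℕ) (X : Config Sg) : Prop where
  le : recLen X.all + G ≤ N
  -- For a noncritical `X` the successor is reached by an `Edge`, and along edges the bound on the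
  -- size of facts is available.
  rule : ¬ IsCritical CS X → ∀ r ∈ A, ∀ Y, r.Rewrites X Y → recLen Y.all ≤ N
  tick : ∀ Y, Tick X Y → recLen Y.all ≤ N

theorem crit_iff (hCS : ∀ p ∈ CS, ∀ c ∈ p.guard, c.offset.natAbs < G) (hx : Codes x X.all)
    (hN : recLen X.all + G ≤ N) :
    (∃ p ∈ CS, ∃ z : List (Letter Sg), z.length ≤ N ∧ rewF p.lhs [] p.guard N x z) ↔
      IsCritical CS X := by
  rw [isCritical_iff]
  refine exists_congr fun p => and_congr_right fun hp => ?_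
  constructor
  · rintro ⟨z, -, hz⟩
    obtain ⟨M, hM, -⟩ := rewF_sound hx p.guard_tvar (fun c hc => (hCS p hp c hc).le) hN hz
    exact ⟨M, hM⟩
  · rintro ⟨M, hM⟩
    have hl : recLen M ≤ N := by
      obtain ⟨θ, τ, R, -, h, rfl, -⟩ := hM
      rw [h, recLen_add] at hN
      simp only [insts, List.map_nil, Multiset.coe_nil, zero_add]
      omega
    obtain ⟨z, hz, hzM⟩ := rewF_complete hx p.guard_tvar (fun c hc => (hCS p hp c hc).le) hN hl hM
    exact ⟨z, hzM.length_eq ▸ hl, hz⟩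

theorem shiftable_iff (hG : 0 < G) (hx : Codes x X.all) (hN : recLen X.all + G ≤ N) :
    (∃ z : List (Letter Sg), z.length ≤ N ∧ shiftF G N x z) ↔ ∃ c Z, Shift G c X Z := by
  constructor
  · rintro ⟨z, -, hz⟩
    obtain ⟨S', ⟨c, h⟩, -⟩ := shiftF_sound hx hz
    exact ⟨c, S', h⟩
  · rintro ⟨c, Z, h⟩
    obtain ⟨y, hy, hyZ⟩ := shiftF_complete (N := N) hG hx (by omega) h
    refine ⟨y, ?_, hy⟩
    obtain ⟨c, -, -, -, x', hx', y', hy', ⟨rfl, rfl⟩, -⟩ := hy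
    simp at hy'
    omega

theorem applicable_iff (hG : ∀ r ∈ A, r.OffsetsLT G) (hx : Codes x X.all) (hN : Roomy A CS G N X)
    (hc : ¬ IsCritical CS X) :
    (∃ r ∈ A, ∃ z : List (Letter Sg), z.length ≤ N ∧ rewF r.lhs r.rhs r.guard N x z) ↔
      ∃ r ∈ A, r.Applicable X := by
  refine exists_congr fun r => and_congr_right fun hr => ?_
  constructor
  · rintro ⟨z, -, hz⟩
    obtain ⟨M, hM, -⟩ := rewF_sound hx r.guard_tvar (fun c hc => (hG r hr c hc).le) hN.le hz
    obtain ⟨Y, h, -⟩ := rew_rule_iff.1 hM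
    exact ⟨Y, h⟩
  · rintro ⟨Y, h⟩
    have hl := hN.rule hc r hr Y h
    obtain ⟨z, hz, hzM⟩ := rewF_complete hx r.guard_tvar (fun c hc => (hG r hr c hc).le) hN.le hl
      (rew_rule_iff.2 ⟨Y, h, rfl⟩)
    exact ⟨z, hzM.length_eq ▸ hl, hz⟩

theorem edgeF_sound (hG₀ : 0 < G) (hG : ∀ r ∈ A, r.OffsetsLT G)
    (hCS : ∀ p ∈ CS, ∀ c ∈ p.guard, c.offset.natAbs < G) (hx : Codes x X.all)
    (hN : Roomy A CS G N X) {y : List (Letter Sg)} (h : edgeF A CS G N x y) :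
    ∃ Y, Edge A CS G X Y ∧ Codes y Y.all := by
  obtain ⟨hc, h⟩ := h
  rw [crit_iff hCS hx hN.le] at hc
  rcases h with ⟨r, hr, h⟩ | ⟨h, ha, hs⟩ | h
  · obtain ⟨M, hM, hy⟩ := rewF_sound hx r.guard_tvar (fun c hc => (hG r hr c hc).le) hN.le h
    obtain ⟨Y, h, rfl⟩ := rew_rule_iff.1 hM
    exact ⟨Y, ⟨hc, .inl ⟨r, hr, h⟩⟩, hy⟩
  · obtain ⟨M, hM, hy⟩ := rewF_sound (K := 0) hx (by simp) (by simp) (by have := hN.le; omega) h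
    obtain ⟨Y, h, rfl⟩ := rew_tick_iff.1 hM
    rw [applicable_iff hG hx hN hc] at ha
    rw [shiftable_iff hG₀ hx hN.le] at hs
    push Not at ha hs
    exact ⟨Y, ⟨hc, .inr (.inl ⟨h, ha, hs⟩)⟩, hy⟩
  · obtain ⟨Y, h, hy⟩ := shiftF_sound hx h
    exact ⟨Y, ⟨hc, .inr (.inr h)⟩, hy⟩

theorem edgeF_complete (hG₀ : 0 < G) (hG : ∀ r ∈ A, r.OffsetsLT G)
    (hCS : ∀ p ∈ CS, ∀ c ∈ p.guard, c.offset.natAbs < G) (hx : Codes x X.all)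
    (hN : Roomy A CS G N X) {Y : Config Sg} (h : Edge A CS G X Y) :
    ∃ y, edgeF A CS G N x y ∧ Codes y Y.all := by
  obtain ⟨hc, h⟩ := h
  have hc' := hc
  rw [← crit_iff hCS hx hN.le] at hc'
  rcases h with ⟨r, hr, h⟩ | ⟨h, ha, hs⟩ | ⟨c, h⟩
  · obtain ⟨y, hy, hyM⟩ := rewF_complete hx r.guard_tvar (fun c hc => (hG r hr c hc).le) hN.le
      (hN.rule hc r hr Y h) (rew_rule_iff.2 ⟨Y, h, rfl⟩)
    exact ⟨y, ⟨hc', .inl ⟨r, hr, hy⟩⟩, hyM⟩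
  · obtain ⟨y, hy, hyM⟩ := rewF_complete (K := 0) (N := N) hx (by simp) (by simp)
      (by have := hN.le; omega) (hN.tick Y h) (rew_tick_iff.2 ⟨Y, h, rfl⟩)
    refine ⟨y, ⟨hc', .inr (.inl ⟨hy, ?_, ?_⟩)⟩, hyM⟩
    · rw [applicable_iff hG hx hN hc]
      push Not
      exact ha
    · rw [shiftable_iff hG₀ hx hN.le]
      push Not
      exact hs
  · obtain ⟨y, hy, hyM⟩ := shiftF_complete (N := N) hG₀ hx (by have := hN.le; omega) h
    exact ⟨y, ⟨hc', .inr (.inr hy)⟩, hyM⟩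

end

end TimedMSR

namespace TimedMSR

open StackProg Relation

variable {Sg : Alphabet} {ι : Type} {A : Set (Rule Sg)} {CS : Set (CriticalPair Sg)} {G N : ℕ}

/-! ### Infinite paths as cycles -/

/-- Every word that is reachable from `w` leaves enough space. -/
def adequateF (A : Set (Rule Sg)) (CS : Set (CriticalPair Sg)) (G c N : ℕ) (w : List (Letter Sg)) :
    Prop :=
  ∀ x : List (Letter Sg), x.length ≤ N → TC N (edgeF A CS G N) w x →
    ∃ z : List (Letter Sg), z.length ≤ N ∧
      -- Room for `c` copies of `x` and `c` further letters means `c * x.length + c ≤ N`.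
      z = fill (List.replicate c (.inr ()) ++ List.replicate c (.inl .time)) fun _ : Unit => x

/-- A cycle is reachable from `w`. -/
def cycleF (A : Set (Rule Sg)) (CS : Set (CriticalPair Sg)) (G N : ℕ) (w : List (Letter Sg)) : Prop :=
  ∃ x : List (Letter Sg), x.length ≤ N ∧ TC N (edgeF A CS G N) w x ∧
    ∃ y : List (Letter Sg), y.length ≤ N ∧ edgeF A CS G N x y ∧ TC N (edgeF A CS G N) y x

theorem def_tc_edgeF (hA : A.Finite) (hCS : CS.Finite) (i j : ι) :
    Def fun N (e : ι → List (Letter Sg)) => TC N (edgeF A CS G N) (e i) (e j) :=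
  Def.tc (R := fun N _ => edgeF A CS G N) i j (def_edgeF hA hCS G _ _)

theorem def_adequateF (hA : A.Finite) (hCS : CS.Finite) (c : ℕ) (i : ι) :
    Def fun N (e : ι → List (Letter Sg)) => adequateF A CS G c N (e i) := by
  refine Def.all ((def_tc_edgeF hA hCS _ _).imp (Def.ex ?_))
  refine (Def.word ((List.replicate c (Sum.inr ()) ++ List.replicate c (Sum.inl Letter.time)).map
    (Sum.map id fun _ : Unit => some none)) none).congr fun N e _ => ?_
  rw [fill_map]

theorem def_cycleF (hA : A.Finite) (hCS : CS.Finite) (i : ι) :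
    Def fun N (e : ι → List (Letter Sg)) => cycleF A CS G N (e i) :=
  Def.ex ((def_tc_edgeF hA hCS _ _).and (Def.ex ((def_edgeF hA hCS G _ _).and
    (def_tc_edgeF hA hCS _ _))))

theorem length_fill_replicate {V : Type} (c : ℕ) (x : List V) (a : V) :
    (fill (List.replicate c (.inr ()) ++ List.replicate c (.inl a)) fun _ : Unit => x).length
      = c * x.length + c := by
  rw [fill_append, List.length_append]
  congr 1
  · induction c with
    | zero => simp
    | succ c ih => rw [List.replicate_succ, fill_cons, List.length_append, ih, Sum.elim_inr]; ring
  · induction c with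
    | zero => simp
    | succ c ih => rw [List.replicate_succ, fill_cons, List.length_append, ih, Sum.elim_inl]
                   simp [add_comm]

theorem adequateF_iff {c : ℕ} {w : List (Letter Sg)} (hw : w.length ≤ N) :
    adequateF A CS G c N w ↔ ∀ x, TC N (edgeF A CS G N) w x → c * x.length + c ≤ N := by
  constructor
  · intro h x hx
    obtain ⟨z, hz, rfl⟩ := h x (TC.length_le hx hw) hx
    rwa [length_fill_replicate] at hz
  · intro h x _ hx
    exact ⟨_, by rw [length_fill_replicate]; exact h x hx, rfl⟩

theorem Edge.recLen_le {X Y : Config Sg} (hN : Roomy A CS G N X) (h : Edge A CS G X Y) (hG : 0 < G) :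
    recLen Y.all ≤ N := by
  obtain ⟨hc, ⟨r, hr, h⟩ | ⟨h, -⟩ | ⟨c, h⟩⟩ := h
  · exact hN.rule hc r hr Y h
  · exact hN.tick Y h
  · obtain ⟨x, hx⟩ := exists_codes (M := X.all) fun p hp => ground_all hp
    obtain ⟨y, ⟨c, -, -, -, x', hx', y', hy', ⟨rfl, rfl⟩, -⟩, hyY⟩ :=
      shiftF_complete (N := N) hG hx (by have := hN.le; omega) h
    rw [← hyY.length_eq]
    simp at hy'
    omega

section
variable {S₀ : Config Sg} {w : List (Letter Sg)} (hG₀ : 0 < G) (hG : ∀ r ∈ A, r.OffsetsLT G)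
  (hCS : ∀ p ∈ CS, ∀ c ∈ p.guard, c.offset.natAbs < G) (hw : Codes w S₀.all) (hwN : w.length ≤ N)
  (hN : ∀ x X, TC N (edgeF A CS G N) w x → ReflTransGen (Edge A CS G) S₀ X → Codes x X.all →
    Roomy A CS G N X)

include hG₀ hG hCS hw hN in
theorem exists_config_of_tc {x : List (Letter Sg)} (h : TC N (edgeF A CS G N) w x) :
    ∃ X, ReflTransGen (Edge A CS G) S₀ X ∧ Codes x X.all := by
  induction h with
  | refl => exact ⟨S₀, .refl, hw⟩
  | tail h₁ h₂ ih =>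
    obtain ⟨X, hX, hx⟩ := ih
    obtain ⟨Y, hE, hY⟩ := edgeF_sound hG₀ hG hCS hx (hN _ X h₁ hX hx) h₂.2.2
    exact ⟨Y, hX.tail hE, hY⟩

-- There are finitely many words of length at most `N`, so an infinite path of words repeats one,
-- and a cycle can be traversed forever. The path is chosen among words and not among
-- configurations, because a configuration has several codes and the code of a successor depends on
-- the chosen code of its predecessor. The hypothesis on room makes edges of words and edges of
-- configurations correspond.
include hG₀ hG hCS hw hwN hN in
theorem cycleF_iff : cycleF A CS G N w ↔ Perpetual (Edge A CS G) S₀ := by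
  constructor
  · rintro ⟨x, hx, hwx, y, hy, hxy, hyx⟩
    refine ⟨{X | ∃ z, ReflTransGen (Edge A CS G) S₀ X ∧ Codes z X.all ∧ TC N (edgeF A CS G N) w z ∧
      TC N (edgeF A CS G N) z x}, ⟨w, .refl, hw, .refl, hwx⟩, ?_⟩
    rintro X ⟨z, hX, hz, hwz, hzx⟩
    have hr := hN z X hwz hX hz
    obtain ⟨z', h₁, h₂, h₃⟩ : ∃ z', edgeF A CS G N z z' ∧ z'.length ≤ N ∧
        TC N (edgeF A CS G N) z' x := by
      rcases ReflTransGen.cases_head hzx with rfl | ⟨z', h₁, h₂⟩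
      · exact ⟨y, hxy, hy, hyx⟩
      · exact ⟨z', h₁.2.2, h₁.2.1, h₂⟩
    obtain ⟨Y, hE, hY⟩ := edgeF_sound hG₀ hG hCS hz hr h₁
    exact ⟨Y, ⟨z', hX.tail hE, hY, hwz.tail ⟨TC.length_le hwz hwN, h₂, h₁⟩, h₃⟩, hE⟩
  · rintro ⟨W, h₀, hW⟩
    obtain ⟨P, hP0, hP⟩ := Perpetual.exists_path
      (E := fun x y => x.length ≤ N ∧ y.length ≤ N ∧ edgeF A CS G N x y) (x := w)
      ⟨{z | ∃ X ∈ W, ReflTransGen (Edge A CS G) S₀ X ∧ Codes z X.all ∧ TC N (edgeF A CS G N) w z},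
        ⟨S₀, h₀, .refl, hw, .refl⟩, by
        rintro z ⟨X, hX, hr, hz, hwz⟩
        have hroom := hN z X hwz hr hz
        obtain ⟨Y, hY, hE⟩ := hW X hX
        obtain ⟨y, h₁, hy⟩ := edgeF_complete hG₀ hG hCS hz hroom hE
        have hl : y.length ≤ N := hy.length_eq ▸ hE.recLen_le hroom hG₀
        have hst := And.intro (TC.length_le hwz hwN) (And.intro hl h₁)
        exact ⟨y, ⟨Y, hY, hr.tail hE, hy, hwz.tail hst⟩, hst⟩⟩
    have hchain : ∀ i d, TC N (edgeF A CS G N) (P i) (P (i + d)) := by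
      intro i d
      induction d with
      | zero => exact .refl
      | succ d ih => exact ih.tail (hP _)
    have hfin : {z : List (Letter Sg) | z.length ≤ N}.Finite := List.finite_length_le _ N
    have : ∃ i j, i < j ∧ P i = P j := by
      have := hfin.to_subtype
      obtain ⟨i, j, hij, h⟩ := Finite.exists_ne_map_eq_of_infinite
        (fun i => (⟨P i, (hP i).1⟩ : {z : List (Letter Sg) | z.length ≤ N}))
      have h : P i = P j := by simpa using h
      rcases Nat.lt_or_gt_of_ne hij with h' | h'
      exacts [⟨i, j, h', h⟩, ⟨j, i, h', h.symm⟩]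
    obtain ⟨i, j, hij, h⟩ := this
    obtain ⟨d, rfl⟩ := Nat.exists_eq_add_of_lt hij
    refine ⟨P i, (hP i).1, ?_, P (i + 1), (hP i).2.1, (hP i).2.2, ?_⟩
    · have := hchain 0 i
      rwa [zero_add, hP0] at this
    · have := hchain (i + 1) d
      rwa [show i + 1 + d = i + d + 1 by ring, ← h] at this

end

/-! ### The size of successors -/

/-- A dichotomy for each of the finitely many sorts. It will control the variables that occur only
on the right of a rule. -/
theorem exists_sort_bound (Sg : Alphabet) : ∃ C : ℕ, ∀ s : Sg.Srt,
    (∀ n : ℕ, ∃ t : Term Sg s, t.IsGround ∧ n ≤ t.word.length) ∨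
      ∀ t : Term Sg s, t.IsGround → t.word.length ≤ C := by
  have := Sg.finite_srt
  have h : ∀ s : Sg.Srt, ∃ C : ℕ, (∀ n : ℕ, ∃ t : Term Sg s, t.IsGround ∧ n ≤ t.word.length) ∨
      ∀ t : Term Sg s, t.IsGround → t.word.length ≤ C := by
    intro s
    by_cases h : ∀ n : ℕ, ∃ t : Term Sg s, t.IsGround ∧ n ≤ t.word.length
    · exact ⟨0, .inl h⟩
    · push Not at h
      obtain ⟨n, hn⟩ := h
      exact ⟨n, .inr fun t ht => (hn t ht).le⟩
  choose f hf using h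
  obtain ⟨C, hC⟩ := (Set.finite_range f).bddAbove
  exact ⟨C, fun s => (hf s).imp id fun h t ht => (h t ht).trans (hC ⟨s, rfl⟩)⟩

theorem recLen_insts_le {θ : Subst Sg} {τ : ℕ → ℕ} {l : List (Item Sg)} {n : ℕ}
    (h : ∀ v ∈ vars l, (v.elim (fun a => (θ a.1 a.2).word) fun t => num (τ t)).length ≤ n) :
    recLen (insts θ τ l) ≤ (l.map fun p => p.pat.length).sum * (n + 1) + (l.map Item.shift).sum := by
  induction l with
  | nil => simp [insts, recLen]
  | cons p l ih =>
    rw [vars_cons] at h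
    have h₁ := ih fun v hv => h v (.inr hv)
    have h₂ := fill_length_le (w := factPat p.fact)
      (e := fun v : Var Sg => v.elim (fun a => (θ a.1 a.2).word) fun t => num (τ t)) (n := n)
      fun v hv => h v (.inl (by simp [Item.pat, hv]))
    rw [fill_factPat (θ := θ) _ fun s x _ => rfl] at h₂
    have h₃ := h (.inr p.tvar) (.inl (by simp [Item.pat]))
    have h₄ := length_num_add (Sg := Sg) (τ p.tvar) p.shift
    simp only [Sum.elim_inr] at h₃
    rw [insts_cons, recLen_cons]
    simp only [recWord, Item.inst, List.length_append, List.map_cons, List.sum_cons, Item.pat,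
      List.length_cons, List.length_nil] at h₁ ⊢
    nlinarith

theorem mem_insts {θ : Subst Sg} {τ : ℕ → ℕ} {l : List (Item Sg)} {p : Item Sg} (hp : p ∈ l) :
    p.inst θ τ ∈ insts θ τ l := by
  simpa [insts] using ⟨p, hp, rfl⟩

/-- Created facts carry times `T + D`, where `T` is the global time, so the right-hand side
introduces no time variables. -/
theorem Rule.tvar_rhs (r : Rule Sg) {t : ℕ} (h : .inr t ∈ vars r.rhs) : .inr t ∈ vars r.lhs := by
  obtain ⟨p, hp, h⟩ := h
  have hnf : ∀ o : Option (Fact Sg), (.inr (.inr t) : Letter Sg ⊕ Var Sg) ∉ factPat o := by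
    have ht : ∀ {s : Sg.Srt} (u : Term Sg s), (.inr (.inr t) : Letter Sg ⊕ Var Sg) ∉ u.pat := by
      intro s u
      induction u with
      | var s x => simp [Term.pat]
      | app f args ih => simpa [Term.pat, List.mem_flatten, List.mem_ofFn] using ih
    intro o
    rcases o with - | F
    · simp [factPat]
    · simpa [factPat, List.mem_flatten, List.mem_ofFn] using fun i => ht (F.args i)
  obtain rfl : t = p.tvar := by simpa [Item.pat, hnf] using h
  simp only [Rule.rhs, Rule.items, List.mem_cons, List.mem_append, List.mem_map,
    Multiset.mem_toList] at hp
  rcases hp with rfl | ⟨F, hF, rfl⟩ | ⟨Q, hQ, rfl⟩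
  · exact ⟨_, List.mem_cons_self, by simp [Item.pat]⟩
  · exact ⟨⟨some F.1, F.2, 0⟩, List.mem_cons_of_mem _ (List.mem_map.2 ⟨F, by simp [hF], rfl⟩),
      by simp [Item.pat]⟩
  · exact ⟨_, List.mem_cons_self, by simp [Item.pat]⟩

/-- A variable that occurs only on the right may take any ground value. If its sort had arbitrarily
long terms, exchanging its value for one longer than `k` would give another successor, with a fact
larger than `k`. So its value has length at most `C`. The values of all other variables are parts of
the word of `X`. -/
theorem Rule.Rewrites.recLen_le {r : Rule Sg} {X Y : Config Sg} {C k : ℕ}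
    (hC : ∀ s : Sg.Srt, (∀ n : ℕ, ∃ t : Term Sg s, t.IsGround ∧ n ≤ t.word.length) ∨
      ∀ t : Term Sg s, t.IsGround → t.word.length ≤ C)
    (hk : ∀ Y', r.Rewrites X Y' → ∀ F ∈ Y'.facts, F.1.size ≤ k) (h : r.Rewrites X Y) :
    recLen Y.all ≤ (r.rhs.map fun p => p.pat.length).sum * (recLen X.all + C + 1) +
      (r.rhs.map Item.shift).sum + recLen X.all := by
  classical
  obtain ⟨θ, τ, R, hg, h₁, h₂, h₃⟩ := rew_rule_iff.2 ⟨Y, h, rfl⟩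
  have hXR : recLen X.all = recLen (insts θ τ r.lhs) + recLen R := by rw [h₁, recLen_add]
  rw [h₂, recLen_add]
  refine add_le_add (recLen_insts_le fun v hv => ?_) (by omega)
  by_cases hvl : v ∈ vars r.lhs
  · have := length_le_of_mem_vars (θ := θ) (τ := τ) hvl
    omega
  · rcases v with ⟨s, x⟩ | t
    · obtain ⟨p, hp, hpv⟩ := hv
      have hpv : .inr (.inl (s, x)) ∈ factPat p.fact := by simpa [Item.pat] using hpv
      have hgr : ∀ p ∈ r.rhs, Ground (p.inst θ τ).1 := fun p hp =>
        h₃ _ (h₂ ▸ Multiset.mem_add.2 (.inl (mem_insts hp)))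
      have hsx := (ground_subst _).1 (hgr p hp) s x hpv
      rcases hC s with hu | hb
      · exfalso
        obtain ⟨t, ht, hkt⟩ := hu (k + 1)
        -- This is `θ` with the overlong term `t` as the value of the one variable `x` of sort `s`.
        let θ' : Subst Sg := fun s' y => if hh : s = s' ∧ x = y then hh.1 ▸ t else θ s' y
        have hθ' : θ' s x = t := by simp [θ']
        have hne : ∀ s' y, (Sum.inl (s', y) : Var Sg) ≠ .inl (s, x) → θ' s' y = θ s' y := by
          intro s' y hne
          have : ¬ (s = s' ∧ x = y) := by rintro ⟨rfl, rfl⟩; exact hne rfl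
          simp only [θ', dif_neg this]
        have hgθ' : ∀ s' y, (θ s' y).IsGround → (θ' s' y).IsGround := by
          intro s' y hy
          by_cases hh : s = s' ∧ x = y
          · obtain ⟨rfl, rfl⟩ := hh
            rwa [hθ']
          · simpa only [θ', dif_neg hh] using hy
        have hl : insts θ' τ r.lhs = insts θ τ r.lhs := insts_congr (fun s' y hy =>
          hne s' y fun e => hvl (e ▸ hy)) fun _ _ => rfl
        have hgr' : ∀ p ∈ r.rhs, Ground (p.inst θ' τ).1 := fun p hp =>
          (ground_subst _).2 fun s' y hy => hgθ' s' y ((ground_subst _).1 (hgr p hp) s' y hy)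
        obtain ⟨Y', hY', hM⟩ := (rew_rule_iff (S := X) (r := r) (M := insts θ' τ r.rhs + R)).1
          ⟨θ', τ, R, hg, by rw [hl, h₁], rfl, fun q hq => by
            rcases Multiset.mem_add.1 hq with hq | hq
            · obtain ⟨p, hp, rfl⟩ : ∃ p ∈ r.rhs, p.inst θ' τ = q := by simpa [insts] using hq
              exact hgr' p hp
            · exact ground_all (h₁ ▸ Multiset.mem_add.2 (.inr hq))⟩
        have hmem : p.inst θ' τ ∈ Y'.all := hM ▸ Multiset.mem_add.2 (.inl (mem_insts hp))
        obtain ⟨F, hF⟩ : ∃ F, p.fact = some F := by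
          rcases ho : p.fact with - | F
          · rw [ho] at hpv; simp [factPat] at hpv
          · exact ⟨F, rfl⟩
        have hlen := length_le_fill
          (e := fun v : Var Sg => v.elim (fun a => (θ' a.1 a.2).word) fun t => num (τ t)) hpv
        rw [fill_factPat (θ := θ') _ fun s x _ => rfl, hF, Option.map_some, length_factWord (by
          simpa [Ground, Item.inst, hF] using hgr' p hp)] at hlen
        simp only [Sum.elim_inl, hθ'] at hlen
        rw [config_all, Multiset.mem_cons, Item.inst, hF] at hmem
        simp only [Option.map_some, Prod.mk.injEq, reduceCtorEq, false_and, Multiset.mem_map,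
          embed, Option.some.injEq, false_or] at hmem
        obtain ⟨F', hF', e, -⟩ := hmem
        have := hk Y' hY' F' hF'
        rw [e] at this
        omega
      · have := hb _ hsx
        simp only [Sum.elim_inl]
        omega
    · exact absurd (r.tvar_rhs hv) hvl

theorem recLen_all_eq (X : Config Sg) :
    recLen X.all = 1 + (num X.time : List (Letter Sg)).length + recLen (X.facts.map embed) := by
  rw [config_all, recLen_cons]
  simp [recWord, factWord, add_comm]

/-- Successors are linearly bounded in terms of `X`, with coefficients that depend only on the rules
and the alphabet. So a linear inequality, which the machine can test without knowing `k`, guarantees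
sufficient space. -/
theorem exists_roomy (hA : A.Finite) (hG₀ : 0 < G) (hG : ∀ r ∈ A, r.OffsetsLT G) :
    ∃ c : ℕ, ∀ (S₀ : Config Sg) (k : ℕ), IsFactSizeBound A S₀ k →
      ∀ X, ReflTransGen (Edge A CS G) S₀ X → ∀ N, c * recLen X.all + c ≤ N → Roomy A CS G N X := by
  obtain ⟨C, hC⟩ := exists_sort_bound Sg
  obtain ⟨a, ha⟩ := (hA.image fun r : Rule Sg => (r.rhs.map fun p => p.pat.length).sum).bddAbove
  obtain ⟨b, hb⟩ := (hA.image fun r : Rule Sg => (r.rhs.map Item.shift).sum).bddAbove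
  refine ⟨a * (C + 1) + b + G + a + 1, fun S₀ k hk X hX N hN => ⟨?_, fun hc r hr Y h => ?_,
    fun Y h => ?_⟩⟩
  · nlinarith [Nat.zero_le (a * (C + 1))]
  · have h₁ := h.recLen_le hC (k := k) fun Y' hY' F hF =>
      hk.size_le_of_edges hG₀ hG (hX.tail ⟨hc, .inl ⟨r, hr, hY'⟩⟩) hF
    have h₂ := ha ⟨r, hr, rfl⟩
    have h₃ := hb ⟨r, hr, rfl⟩
    refine (h₁.trans ?_).trans hN
    refine (Nat.add_le_add_right (Nat.add_le_add (Nat.mul_le_mul_right _ h₂) h₃) _).trans ?_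
    nlinarith [Nat.zero_le (a * (C + 1) * recLen X.all), Nat.zero_le (b * recLen X.all),
      Nat.zero_le (G * recLen X.all)]
  · have h₁ := length_num_succ (Sg := Sg) X.time
    rw [recLen_all_eq, h.1, h.2]
    have h₂ := recLen_all_eq X
    nlinarith [Nat.zero_le (a * (C + 1)), Nat.zero_le ((a * (C + 1) + b + G + a) * recLen X.all)]

/-! ### The size of reachable configurations -/

theorem recLen_le {X : Config Sg} {k T : ℕ} (hk : ∀ F ∈ X.facts, F.1.size ≤ k) (ht : X.time ≤ T)
    (hT : ∀ F ∈ X.facts, F.2 ≤ T) :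
    recLen X.all ≤ 1 + X.numFacts * (k + (num T : List (Letter Sg)).length) := by
  have h₁ := length_num_mono (Sg := Sg) ht
  have h₂ : recLen (X.facts.map embed) ≤
      X.facts.card * (k + (num T : List (Letter Sg)).length) := by
    rw [recLen, Multiset.map_map]
    refine (Multiset.sum_le_card_nsmul _ (k + (num T : List (Letter Sg)).length) ?_).trans (by simp)
    intro n hn
    obtain ⟨F, hF, rfl⟩ := Multiset.mem_map.1 hn
    simp only [Function.comp, recWord, embed, List.length_append,
      length_factWord (X.ground F hF)]
    exact add_le_add (hk F hF) (length_num_mono (hT F hF))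
  rw [recLen_all_eq, Config.numFacts]
  nlinarith

theorem length_num_le (D : ℕ) : (num D : List (Letter Sg)).length ≤ Nat.log 2 D + 1 := by
  simp only [num, List.length_map, Nat.size_eq_bits_len]
  rw [Nat.size_le]
  exact Nat.lt_pow_succ_log_self (by norm_num) D

/-- Times are at most `D + (m * G + G)`, where `m` is the number of facts. The crude estimate that
adding `d` lengthens a numeral by at most `d` is good enough, because a polynomial in `m` is
allowed. -/
theorem recLen_le_of_reachable (hA : IsBalanced A) (hG₀ : 0 < G) (hG : ∀ r ∈ A, r.OffsetsLT G)
    (hG' : ∀ r ∈ A, ∀ Q ∈ r.created, Q.2 ≤ G) {S₀ X : Config Sg} {k D : ℕ}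
    (hk : IsFactSizeBound A S₀ k) (hD : S₀.time ≤ D) (hD' : ∀ F ∈ S₀.facts, F.2 ≤ D)
    (h : ReflTransGen (Edge A CS G) S₀ X) :
    recLen X.all ≤ (G + 2) * (S₀.numFacts * (k + Nat.log 2 D + S₀.numFacts + 1)) := by
  obtain ⟨h₁, h₂, h₃⟩ := bounds_of_reachable hA hG₀ hG' hD hD' h
  have h₄ := recLen_le (T := D + (S₀.numFacts * G + G)) (fun F hF => hk.size_le_of_edges hG₀ hG h hF)
    (by omega) fun F hF => by have := h₃ F hF; omega
  have h₅ := length_num_add (Sg := Sg) D (S₀.numFacts * G + G)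
  have h₆ := length_num_le (Sg := Sg) D
  have h₇ : X.numFacts = S₀.numFacts := by rw [Config.numFacts, h₁]; rfl
  rw [h₇] at h₄
  have h₈ : 1 ≤ S₀.numFacts := Nat.succ_pos _
  generalize S₀.numFacts = m at *
  generalize Nat.log 2 D = l at *
  have h₉ := Nat.mul_le_mul_left m (Nat.add_le_add_left (h₅.trans (Nat.add_le_add_right h₆ _)) k)
  refine h₄.trans (le_trans (Nat.add_le_add_left h₉ 1) ?_)
  have e₁ : m * (k + (l + 1 + (m * G + G))) = m * (k + l + 1) + m * (m + 1) * G := by ring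
  have e₂ : (G + 2) * (m * (k + l + m + 1)) =
      m * (m + 1) * G + m * (k + l) * G + 2 * (m * (k + l + 1)) + 2 * (m * m) := by ring
  rw [e₁, e₂]
  have : 1 ≤ m * (k + l + 1) := Nat.mul_pos h₈ (Nat.succ_pos _)
  have := Nat.zero_le (m * (k + l) * G)
  have := Nat.zero_le (m * m)
  omega

/-- The input starts with the bare global time; prefixing the letter `time` turns it into the first
record. -/
theorem codes_encodeConfig {S : Config Sg} {l : List (Fact Sg × ℕ)}
    (hl : (l : Multiset (Fact Sg × ℕ)) = S.facts) :
    Codes (.time :: (encodeConfig S.time l).map .sym) S.all := by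
  refine ⟨(none, S.time) :: l.map embed, ?_, fun p hp => ground_all (S := S) ?_, ?_⟩
  · rw [config_all, ← hl]
    rfl
  · rw [config_all, ← hl]
    simpa using hp
  · have h : flat (l.map embed) = l.flatMap fun F =>
        F.1.encode.map .sym ++ (Nat.bits F.2).map fun b => .sym (.bit b) := by
      rw [flat, List.flatMap_map]
      rfl
    rw [flat_cons, h]
    simp [recWord, factWord, num, encodeConfig, List.map_flatMap, Function.comp_def]

end TimedMSR

namespace StackProg

open Function Turing

variable {G : Type} [Fintype G] [DecidableEq G] [Inhabited G]

/-! ### Search for a sufficient space bound -/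

/-- The stacks with `N` in unary and the word `x`. -/
def workStacks (N : ℕ) (x : List G) : Stacks G :=
  fun k => if k = 0 then List.replicate N default else if k = 1 then x else []

omit [Fintype G] [DecidableEq G] in
theorem workStacks_eq_nil {N k : ℕ} {x : List G} (hk : 2 ≤ k) : workStacks N x k = [] := by
  rw [workStacks, if_neg (by omega), if_neg (by omega)]

def searchBody (p : Prog G) : Prog G :=
  .seq (isLe 1 0 2) (.ite (fun v => v.flag)
    (.seq p (.ite (fun v => v.flag) (setCtl id 2) (.seq (pushC 0 default) (setCtl id 0))))
    (.seq (pushC 0 default) (setCtl id 0)))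

/-- Enlarge `N` until the test `p` succeeds, and then run the test `q`. -/
def search (p q : Prog G) : Prog G :=
  .seq (move 0 1) (.seq (setCtl id 0) (.seq (.while (fun v => decide (v.mode ≠ 2)) (searchBody p))
    (.seq q (.seq (clear 0) (clear 1)))))

/-- The test is assumed to succeed at `N₁`, so the search stops there at the latest, and the space
is governed by `N₁` although the program does not know it. The input arrives reversed on stack `0`;
the initial move restores its order on stack `1` and frees stack `0` for the counter. -/
theorem runs_search {P Q : ℕ → List G → Prop}
    (hP : Def fun N (e : Unit → List G) => P N (e ()))
    (hQ : Def fun N (e : Unit → List G) => Q N (e ())) :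
    ∃ (p : Prog G) (c : ℕ), ∀ (x : List G) (N₁ B : ℕ) (b : Bool) (m : Fin 3), x.length ≤ N₁ →
      P N₁ x → c * (N₁ + 2) ^ 2 ≤ B → ∃ N, x.length ≤ N ∧ P N x ∧ ∃ b', (b' = true ↔ Q N x) ∧
        Runs (fun _ => B) p b m (fun k => if k = 0 then x.reverse else []) b' 0 fun _ => [] := by
  obtain ⟨p, c₁, hp⟩ := hP (fun _ => 1) 2 (fun _ => by simp) (by simp)
  obtain ⟨q, c₂, hq⟩ := hQ (fun _ => 1) 2 (fun _ => by simp) (by simp)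
  refine ⟨search p q, c₁ + c₂ + 1, fun x N₁ B b m hx hN₁ hB => ?_⟩
  have hB' : ∀ N, N ≤ N₁ → c₁ * (N + 2) ^ 2 ≤ B ∧ c₂ * (N + 2) ^ 2 ≤ B ∧ N + 2 ≤ B := by
    intro N hN
    have h := Nat.pow_le_pow_left (Nat.add_le_add_right hN 2) 2
    have h₁ := Nat.mul_le_mul_left c₁ h
    have h₂ := Nat.mul_le_mul_left c₂ h
    have h₃ : N + 2 ≤ (N + 2) ^ 2 := Nat.le_self_pow (by simp) _
    have h₄ : (c₁ + c₂ + 1) * (N₁ + 2) ^ 2 =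
        c₁ * (N₁ + 2) ^ 2 + c₂ * (N₁ + 2) ^ 2 + (N₁ + 2) ^ 2 := by ring
    omega
  let t : Bool → Fin 3 → Bool := fun _ m => decide (m ≠ 2)
  have hpush : ∀ N, N < N₁ → ∀ b m, Runs (fun _ => B) (.seq (pushC 0 default) (setCtl id 0)) b m
      (workStacks N x) b 0 (workStacks (N + 1) x) := by
    intro N hN b m
    have := (hB' N hN.le).2.2
    refine (runs_pushC (by simp [workStacks]; omega)).seq ((runs_setCtl id 0).congr ?_)
    funext k
    by_cases hk : k = 0
    · subst hk; simp [workStacks, List.replicate_succ]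
    · simp [workStacks, hk]
  have hle : ∀ N, N ≤ N₁ → ∀ b m, Runs (fun _ => B) (isLe 1 0 2) b m (workStacks N x)
      (decide (x.length ≤ N)) m (workStacks N x) := by
    intro N hN b m
    have h := (hB' N hN).2.2
    have h' := (hB' N₁ le_rfl).2.2
    have := runs_isLe (B := B) (b := b) (m := m) (S := workStacks N x) (x := 1) (y := 0) (u := 2)
      (by omega) (by omega) rfl rfl rfl (by simp [workStacks]; omega) (by simp [workStacks]; omega)
    simpa [workStacks] using this
  have hloop : ∀ r N, N₁ - N = r → N ≤ N₁ → ∀ b, ∃ N', N' ≤ N₁ ∧ x.length ≤ N' ∧ P N' x ∧ ∃ b',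
      Runs (fun _ => B) (.while (fun v => t v.flag v.mode) (searchBody p)) b 0 (workStacks N x) b' 2
        (workStacks N' x) := by
    intro r
    induction r with
    | zero =>
      intro N hr hN b
      obtain rfl : N = N₁ := by omega
      obtain ⟨b', hb', e⟩ := hp N B (workStacks N x) true 0 rfl (fun _ => hx)
        (fun _ => workStacks_eq_nil) (hB' N hN).1
      have : b' = true := hb'.2 hN₁
      subst this
      have e₀ := hle N hN b 0
      simp only [hx, decide_true] at e₀
      refine ⟨N, hN, hx, hN₁, true, Runs.while_step t rfl (b₁ := true) (m₁ := 2)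
        (S₁ := workStacks N x) ?_ (Runs.while_stop t rfl)⟩
      exact e₀.seq (Runs.ite_flag (e.seq (Runs.ite_flag (runs_setCtl id 2))))
    | succ r ih =>
      intro N hr hN b
      have e₀ := hle N hN b 0
      obtain ⟨N', h₁, h₂, h₃, b', h₄⟩ := ih (N + 1) (by omega) (by omega) false
      by_cases hxN : x.length ≤ N
      · simp only [hxN, decide_true] at e₀
        obtain ⟨b₁, hb₁, e⟩ := hp N B (workStacks N x) true 0 rfl (fun _ => hxN)
          (fun _ => workStacks_eq_nil) (hB' N hN).1
        cases b₁ with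
        | true =>
          refine ⟨N, hN, hxN, hb₁.1 rfl, true, Runs.while_step t rfl (b₁ := true) (m₁ := 2)
            (S₁ := workStacks N x) ?_ (Runs.while_stop t rfl)⟩
          exact e₀.seq (Runs.ite_flag (e.seq (Runs.ite_flag (runs_setCtl id 2))))
        | false =>
          refine ⟨N', h₁, h₂, h₃, b', Runs.while_step t rfl (b₁ := false) (m₁ := 0)
            (S₁ := workStacks (N + 1) x) ?_ h₄⟩
          exact e₀.seq (Runs.ite_flag (e.seq (Runs.ite_flag (hpush N (by omega) false 0))))
      · simp only [hxN, decide_false] at e₀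
        refine ⟨N', h₁, h₂, h₃, b', Runs.while_step t rfl (b₁ := false) (m₁ := 0)
          (S₁ := workStacks (N + 1) x) ?_ h₄⟩
        exact e₀.seq (Runs.ite_flag (hpush N (by omega) false 0))
  obtain ⟨N, h₁, h₂, h₃, b₁, h₄⟩ := hloop _ 0 rfl (Nat.zero_le _) b
  obtain ⟨b', hb', e⟩ := hq N B (workStacks N x) b₁ 2 rfl (fun _ => h₂)
    (fun _ => workStacks_eq_nil) (hB' N h₁).2.1
  have hlast := (hB' N₁ le_rfl).2.2
  have hmove : Runs (fun _ => B) (move 0 1) b m (fun k => if k = 0 then x.reverse else []) b m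
      (workStacks 0 x) := by
    refine (runs_move (by simp) (by simp; omega)).congr ?_
    funext k
    by_cases hk : k = 0
    · subst hk; simp [workStacks]
    · by_cases hk' : k = 1
      · subst hk'; simp [workStacks]
      · simp [workStacks, hk, hk']
  refine ⟨N, h₂, h₃, b', hb', hmove.seq ((runs_setCtl id 0).seq (h₄.seq (e.seq ((runs_clear 0).seq
    ((runs_clear 1).congr ?_)))))⟩
  funext k
  by_cases hk : k = 0
  · subst hk; simp
  · by_cases hk' : k = 1
    · subst hk'; simp
    · simp [workStacks, hk, hk']

/-! ### A table for short words -/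

/-- Branching on the letter in the register. -/
def branch (k : G → Prog G) : List G → Prog G
  | [] => .load id
  | a :: l => .ite (fun v => decide (v.reg = some a)) (k a) (branch k l)

theorem exec_branch {s : ℕ → ℕ} {k : G → Prog G} {l : List G} {a : G} (ha : a ∈ l) {v v' : Ctl G}
    {S S' : Stacks G} (hv : v.reg = some a) (h : Exec s (k a) v S v' S') :
    Exec s (branch k l) v S v' S' := by
  induction l with
  | nil => simp at ha
  | cons c l ih =>
    refine .ite ?_
    by_cases hc : c = a
    · subst hc
      simpa [hv] using h
    · have : ¬ a = c := fun h => hc h.symm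
      simpa [hv, this] using ih (by simpa [this] using ha)

theorem width_branch {k : G → Prog G} {n : ℕ} (hk : ∀ a, (k a).width ≤ n) (l : List G) :
    (branch k l).width ≤ n := by
  induction l with
  | nil => exact Nat.zero_le _
  | cons c l ih => exact max_le (hk c) ih

/-- Push the letters of a word, the first one first, and continue. -/
def pushThen (p : Prog G) : List G → Prog G
  | [] => p
  | a :: u => .seq (pushC 0 a) (pushThen p u)

theorem exec_pushThen {s : ℕ → ℕ} {p : Prog G} {u x : List G} {S₀ S' : Stacks G} {v v' : Ctl G}
    (hs : (u.reverse ++ x).length ≤ s 0)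
    (h : Exec s p v (update S₀ 0 (u.reverse ++ x)) v' S') :
    Exec s (pushThen p u) v (update S₀ 0 x) v' S' := by
  induction u generalizing x with
  | nil => exact h
  | cons a u ih =>
    simp only [List.reverse_cons, List.append_assoc, List.cons_append, List.nil_append] at h hs
    have h₁ := ih hs h
    have h₂ : Exec s (pushC 0 a) v (update S₀ 0 x) v (update S₀ 0 (a :: x)) := by
      have := Exec.push (s := s) (k := 0) (f := fun _ => a) (v := v) (S := update S₀ 0 x)
        (by simp at hs ⊢; omega)
      simpa [pushC] using this
    exact .seq h₂ h₁

theorem width_pushThen (p : Prog G) (u : List G) : (pushThen p u).width ≤ max 1 p.width := by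
  induction u with
  | nil => exact le_max_right _ _
  | cons a u ih => exact max_le (le_max_left _ _) ih

/-- Words of length at most `n` are decided by `f`, others by `p`; the word `u` has been read. -/
noncomputable def table (f : List G → Bool) (p : Prog G) : ℕ → List G → Prog G
  | 0, u => .seq (popR 0) (.ite (fun v => v.reg.isNone) (setCtl (fun _ => f u) 0)
      (branch (fun a => pushThen p (a :: u)) Finset.univ.toList))
  | n + 1, u => .seq (popR 0) (.ite (fun v => v.reg.isNone) (setCtl (fun _ => f u) 0)
      (branch (fun a => table f p n (a :: u)) Finset.univ.toList))

theorem width_table (f : List G → Bool) (p : Prog G) (n : ℕ) (u : List G) :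
    (table f p n u).width ≤ max 1 p.width := by
  induction n generalizing u with
  | zero => exact max_le (le_max_left _ _) (max_le (Nat.zero_le _)
      (width_branch (fun a => width_pushThen p _) _))
  | succ n ih => exact max_le (le_max_left _ _) (max_le (Nat.zero_le _)
      (width_branch (fun a => ih _) _))

theorem exec_popR {s : ℕ → ℕ} {S₀ : Stacks G} (v : Ctl G) (x : List G) :
    Exec s (popR 0) v (update S₀ 0 x) { v with reg := x.head? } (update S₀ 0 x.tail) := by
  have := Exec.pop (s := s) (k := 0) (f := fun (v : Ctl G) o => { v with reg := o }) (v := v)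
    (S := update S₀ 0 x)
  simpa [popR] using this

theorem exec_table_short (s : ℕ → ℕ) (f : List G → Bool) (p : Prog G) (S₀ : Stacks G) :
    ∀ (n : ℕ) (u x : List G) (v : Ctl G), x.length ≤ n →
      ∃ v', v'.flag = f (x.reverse ++ u) ∧ Exec s (table f p n u) v (update S₀ 0 x) v' (update S₀ 0 []) := by
  have key : ∀ (q : Prog G) (u : List G) (v : Ctl G), ∃ v', v'.flag = f u ∧
      Exec s (.seq (popR 0) (.ite (fun v => v.reg.isNone) (setCtl (fun _ => f u) 0) q)) v
        (update S₀ 0 []) v' (update S₀ 0 []) := fun q u v =>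
    ⟨_, rfl, .seq (exec_popR v []) (.ite .load)⟩
  intro n
  induction n with
  | zero =>
    intro u x v hx
    obtain rfl := List.length_eq_zero_iff.1 (Nat.le_zero.1 hx)
    exact key _ u v
  | succ n ih =>
    intro u x v hx
    rcases x with - | ⟨a, x⟩
    · exact key _ u v
    · obtain ⟨v', h₁, h₂⟩ := ih (a :: u) x { v with reg := some a } (by simpa using hx)
      refine ⟨v', by simpa using h₁, .seq (exec_popR v (a :: x)) (.ite ?_)⟩
      exact exec_branch (by simp) rfl h₂

theorem exec_table_long {s : ℕ → ℕ} (f : List G → Bool) {p : Prog G} {S₀ S' : Stacks G} {b : Bool} :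
    ∀ (n : ℕ) (u x : List G) (v : Ctl G), n < x.length → (u.reverse ++ x).length ≤ s 0 →
      (∀ v, ∃ v', v'.flag = b ∧ Exec s p v (update S₀ 0 (u.reverse ++ x)) v' S') →
      ∃ v', v'.flag = b ∧ Exec s (table f p n u) v (update S₀ 0 x) v' S' := by
  intro n
  induction n with
  | zero =>
    intro u x v hx hs hp
    obtain ⟨a, x, rfl⟩ := List.exists_cons_of_length_pos hx
    obtain ⟨v', h₁, h₂⟩ := hp { v with reg := some a }
    refine ⟨v', h₁, .seq (exec_popR v (a :: x)) (.ite ?_)⟩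
    refine exec_branch (by simp) rfl (exec_pushThen (u := a :: u) (x := x) ?_ ?_)
    · simpa using hs
    · simpa using h₂
  | succ n ih =>
    intro u x v hx hs hp
    rcases x with - | ⟨a, x⟩
    · simp at hx
    · obtain ⟨v', h₁, h₂⟩ := ih (a :: u) x { v with reg := some a } (by simpa using hx)
        (by simpa using hs) (by simpa using hp)
      refine ⟨v', h₁, .seq (exec_popR v (a :: x)) (.ite ?_)⟩
      exact exec_branch (by simp) rfl h₂

/-- A question about words that is answered by `Q N` in any space `N` that is sufficient in the sense
of `P` is decided by a machine in quadratic space, and words of length at most `C` are decided in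
linear space. -/
theorem exists_machine {I : Type} [Fintype I] (e : I → G) {P Q : ℕ → List G → Prop}
    (hP : Def fun N (e : Unit → List G) => P N (e ()))
    (hQ : Def fun N (e : Unit → List G) => Q N (e ())) :
    ∃ c : ℕ, ∀ C : ℕ, ∃ p : Prog G, ∀ (w : List I) (N₁ : ℕ) (A : Prop), w.length ≤ N₁ →
      P N₁ (w.map e) → (∀ N, w.length ≤ N → P N (w.map e) → (Q N (w.map e) ↔ A)) →
      ∃ b, (b = true ↔ A) ∧ Nonempty (TM2Outputs (machine e p) w (some [b])) ∧
        ∀ cfg, StateTransition.Reaches (machine e p).step (initList (machine e p) w) cfg →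
          ∑ j ∈ @Finset.univ (machine e p).K (machine e p).kFin, (TM2.Cfg.stk cfg j).length ≤
            if w.length ≤ C then w.length + 1 else c * (N₁ + 2) ^ 2 := by
  classical
  obtain ⟨p, c, hp⟩ := runs_search hP hQ
  -- All sufficient `N` give the same answer, so the table may quantify over them.
  let f : List G → Bool := fun x => decide (∀ N, x.length ≤ N → P N x → Q N x)
  -- The table enlarges the finite control but not the number of stacks, which `width_table` bounds
  -- independently of `C`. This is why the constant can be fixed before `C`.
  refine ⟨(max 1 p.width + 1) * c + (max 1 p.width + 1) + 1, fun C => ⟨table f p C [], fun w N₁ A hw hN hA => ?_⟩⟩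
  have hwid := width_table f p C []
  have hst : (fun k => if k = 0 then (w.map e).reverse else []) =
      update (fun _ => []) 0 (w.map e).reverse := by
    funext k
    by_cases hk : k = 0
    · subst hk; simp
    · simp [hk]
  split_ifs with hC
  -- A short word is read off stack `0` into the control, and nothing is ever pushed.
  · obtain ⟨v', h₁, h₂⟩ := exec_table_short (fun k => if k = 0 then w.length else 0) f p (fun _ => [])
      C [] (w.map e).reverse (.init G) (by simpa using hC)
    rw [update_eq_self_iff.2 rfl, ← hst] at h₂
    refine ⟨v'.flag, ?_, machine_spec e _ h₂ (by simp) ?_⟩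
    · rw [h₁]
      simp only [List.reverse_reverse, List.append_nil, List.length_map, f, decide_eq_true_eq]
      exact ⟨fun h => (hA N₁ hw hN).1 (h N₁ hw hN), fun h N h' hN' => (hA N h' hN').2 h⟩
    · simp
  · obtain ⟨N, h₁, h₂, b, h₃, -⟩ := hp (w.map e) N₁ _ false 0 (by simpa using hw) hN le_rfl
    rw [List.length_map] at h₁
    rw [hA N h₁ h₂] at h₃
    let B := (c + 1) * (N₁ + 2) ^ 2
    have hB : N₁ ≤ B := by
      have : N₁ + 2 ≤ (N₁ + 2) ^ 2 := Nat.le_self_pow (by simp) _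
      have : (N₁ + 2) ^ 2 ≤ B := Nat.le_mul_of_pos_left _ (Nat.succ_pos _)
      omega
    obtain ⟨v', h₄, h₅⟩ := exec_table_long (s := fun _ => B) f (p := p) (S₀ := fun _ => [])
      (S' := fun _ => []) (b := b) C [] (w.map e).reverse (.init G) (by simpa using hC)
      (by simp; omega) (fun v => by
        obtain ⟨N', h₁', h₂', b', h₃', h⟩ := hp (w.map e) N₁ B v.flag v.mode (by simpa using hw) hN
          (Nat.mul_le_mul_right _ (Nat.le_succ _))
        rw [List.length_map] at h₁'
        rw [hA N' h₁' h₂'] at h₃'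
        obtain rfl : b' = b := Bool.eq_iff_iff.2 (h₃'.trans h₃.symm)
        obtain ⟨v', h₁, -, h₂⟩ := h v rfl rfl
        rw [hst] at h₂
        exact ⟨v', h₁, by simpa using h₂⟩)
    rw [← hst] at h₅
    refine ⟨v'.flag, by rw [h₄, h₃], machine_spec e _ h₅ (hw.trans hB) ?_⟩
    rw [Finset.sum_const, Finset.card_range, smul_eq_mul]
    have h₆ := Nat.mul_le_mul_right B (Nat.add_le_add_right hwid 1)
    have h₇ : 1 ≤ (N₁ + 2) ^ 2 := Nat.one_le_pow _ _ (Nat.succ_pos _)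
    have h₈ : (max 1 p.width + 1) * B = ((max 1 p.width + 1) * c + (max 1 p.width + 1)) * (N₁ + 2) ^ 2 := by
      simp only [B]; ring
    nlinarith

end StackProg

namespace TimedMSR

open StackProg Relation

variable {Sg : Alphabet} {ι : Type} {A : Set (Rule Sg)} {CS : Set (CriticalPair Sg)} {G N : ℕ}

/-! ### Deciding realizability in polynomial space -/

theorem exists_offset_bound (hA : A.Finite) (hCS : CS.Finite) :
    ∃ G : ℕ, 0 < G ∧ (∀ r ∈ A, r.OffsetsLT G) ∧ (∀ r ∈ A, ∀ Q ∈ r.created, Q.2 ≤ G) ∧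
      ∀ p ∈ CS, ∀ c ∈ p.guard, c.offset.natAbs < G := by
  obtain ⟨a, ha⟩ := (hA.image fun r : Rule Sg => r.guard.sup fun c => c.offset.natAbs).bddAbove
  obtain ⟨b, hb⟩ := (hA.image fun r : Rule Sg => (r.created.map Prod.snd).sup).bddAbove
  obtain ⟨d, hd⟩ :=
    (hCS.image fun p : CriticalPair Sg => p.guard.sup fun c => c.offset.natAbs).bddAbove
  refine ⟨a + b + d + 1, by omega, fun r hr c hc => ?_, fun r hr Q hQ => ?_, fun p hp c hc => ?_⟩
  · have h₁ := ha ⟨r, hr, rfl⟩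
    have h₂ := Finset.le_sup (f := fun c : TimeConstraint => c.offset.natAbs) hc
    simp only at h₁ h₂
    omega
  · have h₁ := hb ⟨r, hr, rfl⟩
    have h₂ := Multiset.le_sup (Multiset.mem_map_of_mem Prod.snd hQ)
    simp only at h₁
    omega
  · have h₁ := hd ⟨p, hp, rfl⟩
    have h₂ := Finset.le_sup (f := fun c : TimeConstraint => c.offset.natAbs) hc
    simp only at h₁ h₂
    omega

/-- The bound `N` leaves enough space for all words that are reachable from the input. -/
def startF (A : Set (Rule Sg)) (CS : Set (CriticalPair Sg)) (G c N : ℕ) (v : List (Letter Sg)) :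
    Prop :=
  ∃ w : List (Letter Sg), w.length ≤ N ∧ w = Letter.time :: v ∧ adequateF A CS G c N w

/-- A cycle is reachable from the input. -/
def decideF (A : Set (Rule Sg)) (CS : Set (CriticalPair Sg)) (G N : ℕ) (v : List (Letter Sg)) :
    Prop :=
  ∃ w : List (Letter Sg), w.length ≤ N ∧ w = Letter.time :: v ∧ cycleF A CS G N w

theorem def_eq_time_cons (i j : ι) :
    Def fun (_ : ℕ) (e : ι → List (Letter Sg)) => e i = Letter.time :: e j :=
  (Def.word [Sum.inl Letter.time, Sum.inr j] i).congr fun N e _ => by simp [fill]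

theorem def_startF (hA : A.Finite) (hCS : CS.Finite) (c : ℕ) (i : ι) :
    Def fun N (e : ι → List (Letter Sg)) => startF A CS G c N (e i) :=
  Def.ex ((def_eq_time_cons none (some i)).and (def_adequateF hA hCS c none))

theorem def_decideF (hA : A.Finite) (hCS : CS.Finite) (i : ι) :
    Def fun N (e : ι → List (Letter Sg)) => decideF A CS G N (e i) :=
  Def.ex ((def_eq_time_cons none (some i)).and (def_cycleF hA hCS none))

theorem startF_iff {c : ℕ} {v : List (Letter Sg)} :
    startF A CS G c N v ↔ v.length + 1 ≤ N ∧
      ∀ x, TC N (edgeF A CS G N) (.time :: v) x → c * x.length + c ≤ N := by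
  constructor
  · rintro ⟨w, hw, rfl, h⟩
    exact ⟨by simpa using hw, (adequateF_iff hw).1 h⟩
  · rintro ⟨h₁, h₂⟩
    exact ⟨_, by simpa using h₁, rfl, (adequateF_iff (by simpa using h₁)).2 h₂⟩

theorem decideF_iff {v : List (Letter Sg)} (h : v.length + 1 ≤ N) :
    decideF A CS G N v ↔ cycleF A CS G N (.time :: v) :=
  ⟨fun ⟨_, _, hw, h⟩ => hw ▸ h, fun h' => ⟨_, by simpa using h, rfl, h'⟩⟩

/-- An input not covered by the table is longer than the constant `c' * (c * (G + 2) + c + 2) ^ 2`.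
The constant is therefore at most `q + 1` and is absorbed by a third factor, so nothing in the
result depends on the system. -/
theorem space_bound {q c c' n G : ℕ} (hn : n ≤ q) :
    (if n ≤ c' * (c * (G + 2) + c + 2) ^ 2 then n + 1
      else c' * (c * ((G + 2) * q) + c + 2) ^ 2) ≤ (q + 1) ^ 3 := by
  split_ifs with h
  · exact (Nat.succ_le_succ hn).trans (Nat.le_self_pow (by norm_num) _)
  · have h₁ : c * ((G + 2) * q) + c + 2 ≤ (c * (G + 2) + c + 2) * (q + 1) := by
      nlinarith [Nat.zero_le (c * q), Nat.zero_le q, Nat.zero_le (c * (G + 2))]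
    calc c' * (c * ((G + 2) * q) + c + 2) ^ 2
        ≤ c' * ((c * (G + 2) + c + 2) * (q + 1)) ^ 2 :=
          Nat.mul_le_mul_left _ (Nat.pow_le_pow_left h₁ 2)
      _ = c' * (c * (G + 2) + c + 2) ^ 2 * (q + 1) ^ 2 := by ring
      _ ≤ (q + 1) * (q + 1) ^ 2 := Nat.mul_le_mul_right _ (by omega)
      _ = (q + 1) ^ 3 := by ring

/-- Every `N` that passes the test gives the right answer, since it has room for all successors of
reachable words. The value `c * ((G + 2) * q) + c` passes, by the bound on reachable configurations,
and so limits the search. The table covers inputs up to the constant of `space_bound`. -/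
theorem exists_decider (hA : A.Finite) (hCS : CS.Finite) (hP : IsProgressive A) :
    ∃ p : Prog (Letter Sg), ∀ (S₀ : Config Sg) (l : List (Fact Sg × ℕ)) (k D : ℕ),
      (l : Multiset (Fact Sg × ℕ)) = S₀.facts → IsFactSizeBound A S₀ k → S₀.time ≤ D →
      (∀ F ∈ S₀.facts, F.2 ≤ D) →
      ∃ b, (b = true ↔ Realizable A CS S₀) ∧
        Nonempty (Turing.TM2Outputs (machine Letter.sym p) (encodeConfig S₀.time l) (some [b])) ∧
        ∀ cfg, StateTransition.Reaches (machine Letter.sym p).step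
            (Turing.initList (machine Letter.sym p) (encodeConfig S₀.time l)) cfg →
          ∑ j ∈ @Finset.univ (machine (Letter.sym (Sg := Sg)) p).K (machine Letter.sym p).kFin,
              (Turing.TM2.Cfg.stk cfg j).length ≤
            (S₀.numFacts * (k + Nat.log 2 D + S₀.numFacts + 1) + 1) ^ 3 := by
  obtain ⟨G, hG₀, hG, hG', hGC⟩ := exists_offset_bound hA hCS
  obtain ⟨c₀, hc₀⟩ := exists_roomy (CS := CS) hA hG₀ hG
  obtain ⟨c, hc₁, hc⟩ : ∃ c : ℕ, 1 ≤ c ∧ ∀ (S₀ : Config Sg) (k : ℕ), IsFactSizeBound A S₀ k →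
      ∀ X, ReflTransGen (Edge A CS G) S₀ X → ∀ N, c * recLen X.all + c ≤ N → Roomy A CS G N X :=
    -- A positive constant ensures that the bound used for the search also exceeds the length of the
    -- input.
    ⟨c₀ + 1, by omega, fun S₀ k hk X hX N hN => hc₀ S₀ k hk X hX N (by nlinarith)⟩
  obtain ⟨c', hM⟩ := exists_machine (Letter.sym (Sg := Sg))
    (def_startF (ι := Unit) hA hCS (G := G) c ()) (def_decideF (ι := Unit) hA hCS (G := G) ())
  obtain ⟨p, hp⟩ := hM (c' * (c * (G + 2) + c + 2) ^ 2)
  refine ⟨p, fun S₀ l k D hl hk hD hD' => ?_⟩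
  have hw := codes_encodeConfig hl
  have hlen := hw.length_eq
  rw [List.length_cons, List.length_map] at hlen
  set w := encodeConfig S₀.time l
  have hreach : ∀ X, ReflTransGen (Edge A CS G) S₀ X →
      recLen X.all ≤ (G + 2) * (S₀.numFacts * (k + Nat.log 2 D + S₀.numFacts + 1)) := fun X hX =>
    recLen_le_of_reachable hP.1 hG₀ hG hG' hk hD hD' hX
  have h₀ := hreach S₀ .refl
  have hwq : w.length ≤ S₀.numFacts * (k + Nat.log 2 D + S₀.numFacts + 1) := by
    have h₁ := recLen_le (fun F hF => hk.size_le_of_edges (CS := CS) hG₀ hG .refl hF) hD hD'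
    have h₂ := Nat.mul_le_mul_left S₀.numFacts
      (Nat.add_le_add_left (length_num_le (Sg := Sg) D) k)
    have h₃ : S₀.numFacts * (k + (Nat.log 2 D + 1)) ≤
        S₀.numFacts * (k + Nat.log 2 D + S₀.numFacts + 1) := Nat.mul_le_mul_left _ (by omega)
    omega
  set q := S₀.numFacts * (k + Nat.log 2 D + S₀.numFacts + 1)
  have hle : w.length + 1 ≤ c * ((G + 2) * q) + c := by nlinarith
  have hstart : startF A CS G c (c * ((G + 2) * q) + c) (w.map .sym) := by
    refine startF_iff.2 ⟨by simpa using hle, fun x hx => ?_⟩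
    obtain ⟨X, hX, hxX⟩ := exists_config_of_tc hG₀ hG hGC hw (fun x X _ hX _ => hc S₀ k hk X hX _
      (Nat.add_le_add_right (Nat.mul_le_mul_left c (hreach X hX)) c)) hx
    rw [hxX.length_eq]
    exact Nat.add_le_add_right (Nat.mul_le_mul_left c (hreach X hX)) c
  have hdecide : ∀ N, w.length ≤ N → startF A CS G c N (w.map .sym) →
      (decideF A CS G N (w.map .sym) ↔ Realizable A CS S₀) := by
    intro N _ h
    obtain ⟨h₁, h₂⟩ := startF_iff.1 h
    rw [decideF_iff h₁, cycleF_iff hG₀ hG hGC hw (by simpa using h₁) fun x X hx hX hxX =>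
      hc S₀ k hk X hX N (hxX.length_eq ▸ h₂ x hx), realizable_iff hP hG₀ hG hGC]
  obtain ⟨b, hb, hout, hspace⟩ := hp w (c * ((G + 2) * q) + c) (Realizable A CS S₀) (by omega)
    hstart hdecide
  exact ⟨b, hb, hout, fun cfg h => (hspace cfg h).trans (space_bound hwq)⟩

end TimedMSR

theorem mainTheorem2 (Sg : TimedMSR.Alphabet) :
    ∃ p : MvPolynomial (Fin 3) ℕ,
      ∀ (A : Set (TimedMSR.Rule Sg)) (CS : Set (TimedMSR.CriticalPair Sg)),
        A.Finite → CS.Finite → TimedMSR.IsProgressive A →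
        ∃ M : Turing.TM2ComputableAux (TimedMSR.Sym Sg) Bool,
          ∀ (S₀ : TimedMSR.Config Sg) (l : List (TimedMSR.Fact Sg × ℕ)) (k Dmax : ℕ),
            (l : Multiset (TimedMSR.Fact Sg × ℕ)) = S₀.facts →
            TimedMSR.IsFactSizeBound A S₀ k →
            TimedMSR.IsNumericBound A CS S₀ Dmax →
            TimedMSR.DecidesInSpace M (TimedMSR.encodeConfig S₀.time l)
              (TimedMSR.Realizable A CS S₀)
              (MvPolynomial.eval ![S₀.numFacts, k, Nat.log 2 Dmax] p) := by
  refine ⟨(.X 0 * (.X 1 + .X 2 + .X 0 + 1) + 1) ^ 3, fun A CS hA hCS hP => ?_⟩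
  obtain ⟨p, hp⟩ := TimedMSR.exists_decider hA hCS hP
  refine ⟨⟨StackProg.machine TimedMSR.Letter.sym p, Equiv.refl _, Equiv.refl _⟩,
    fun S₀ l k Dmax hl hk hD => ?_⟩
  obtain ⟨b, hb, hout, hspace⟩ := hp S₀ l k Dmax hl hk hD.1 hD.2.1
  have hid : (TimedMSR.encodeConfig S₀.time l).map
      (Equiv.refl (TimedMSR.Sym Sg)).symm = TimedMSR.encodeConfig S₀.time l := List.map_id _
  refine ⟨⟨b, hb, ?_⟩, fun cfg h => ?_⟩
  · exact hid.symm ▸ hout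
  · have h' := hspace cfg (hid ▸ h)
    simpa using h'
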